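/- Let $f^\varepsilon(x,y)$ be a $C^\infty$ family of functions, smooth in $(\varepsilon,x,y)$ near $0$; consider the surfaces $S_\varepsilon:\ z=f^\varepsilon(x,y)$ and put $f=f^0$, $f_{ij}=\partial_x^i\partial_y^jf$, $\partial_{\vec u}=u_1\partial_x+u_2\partial_y$. Suppose that the origin is a flat umbilic of $S_0$, $f_{20}=f_{11}=f_{02}=0$ at $0$, that the cubic form $\vec u\mapsto\partial^3_{\vec u}f(0)$ is nondegenerate (no multiple linear factor), and that the family is generic: its second-order jet $(\varepsilon,x,y)\mapsto(f^\varepsilon_{20},f^\varepsilon_{11},f^\varepsilon_{02})(x,y)$ is transverse at $0$ to the flat-umbilic stratum $\{0\}$, i.e. has invertible differential at $0$. Terminology. A point of $S_\varepsilon$ is elliptic, parabolic or hyperbolic if the Hessian determinant of $f^\varepsilon$ is positive, zero or negative there. A direction $\vec v\ne0$ is asymptotic if $\partial_{\vec v}^2f^\varepsilon=0$; the point is flecnodal if moreover $\partial_{\vec v}^3f^\varepsilon=0$ for some asymptotic $\vec v$ (at least 4-point contact with a tangent line), and a biflecnode if also $\partial_{\vec v}^4f^\varepsilon=0$. An elliptic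 domain is co-oriented by the side of the tangent planes on which the surface locally lies. A godron is a parabolic point with a unique asymptotic line, which is tangent to the (regular) parabolic curve; it is negative if it is simple ($3f_{21}^2\neq f_{02}f_{40}$ at the point, in affine coordinates whose first axis is the asymptotic line) and if, at neighbouring parabolic points, the half-asymptotic lines directed to the hyperbolic domain point away from the godron. A node is a point at which the quadratic form of the Taylor expansion divides the cubic form; a hyperbonode (ellipnode) is a hyperbolic (elliptic) point at which the two real (complex conjugate) branches of the flecnodal curve, associated with the two real (complex conjugate) asymptotic direction fields, intersect transversely. Then there are arbitrarily small convex open neighbourhoods $U$ of $0$ in the $(x,y)$-plane, and for each of them an $\varepsilon_0>0$, such that over $U$ and for $|\varepsilon|<\varepsilon_0$ the following holds. (a) ($D_4^-$) Suppose $\vec u,\vec v,\vec w$ are pairwise linearly independent with $\partial^3_{\vec u}f=\partial^3_{\vec v}f=\partial^3_{\vec w}f=0$ and $\partial^4_{\vec u}f\,\partial^4_{\vec v}f\,\partial^4_{\vec w}f\ne0$ at $0$. For $\varepsilon=0$ the flecnodal curve is the union of three smooth arcs through the umbilic with directions $\vec u,\vec v,\vec w$, which meet pairwise only at the umbilic;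 there is no elliptic point, and the umbilic is the only parabolic point. For $\varepsilon\neq0$ the elliptic points form a disc bounded by the parabolic curve, which is a smooth closed curve; there are exactly three godrons, all negative, and exactly three hyperbolic nodes, all hyperbonodes. The closed disc, the godrons and the hyperbonodes collapse to the umbilic as $\varepsilon\to0$ and reappear when $\varepsilon$ changes sign (the godrons and the hyperbonodes form continuous families through $\varepsilon=0$), and the discs for $\varepsilon<0$ and for $\varepsilon>0$ have opposite co-orientations. There are no biflecnodes. (b) ($D_4^+$) Suppose that the solutions of $\partial^3_{\vec w}f(0)=0$ are exactly the multiples of one vector $\vec u\neq0$, and that $\partial^4_{\vec u}f(0)\neq0$. For $\varepsilon=0$ the parabolic curve consists of two smooth branches through the umbilic and the flecnodal curve is one smooth arc through the umbilic with direction $\vec u$; the three curves are pairwise transverse and meet only at the umbilic. For every $\varepsilon$ there are exactly two elliptic domains, of opposite co-orientation. For $\varepsilon=0$ their closures meet in $U$ exactly at the umbilic; for $\varepsilon\neq0$ their closures are disjoint in $U$, and the parabolic curve is smooth and consists of two curves, the boundaries of the two domains. For $\varepsilon\ne0$ there are exactly one elliptic node, which is an ellipnode, and exactly one godron, which is negative;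 both depend continuously on $\varepsilon$ and pass through the umbilic at $\varepsilon=0$. When $\varepsilon$ changes sign, the ellipnode passes from one elliptic domain to the other, and the godron passes from the boundary of one elliptic domain to that of the other (for each $\varepsilon\ne0$ the godron is on the boundary of the domain that does not contain the ellipnode); here the domains for different $\varepsilon$ are identified by their co-orientation. There are no biflecnodes. -/

import Mathlib

open Set Filter Topology
open scoped ContDiff

namespace FlatUmbilic

/-- The plane of the affine coordinates `(x, y)`; a surface is the graph `z = f (x, y)`. -/
abbrev Plane := ℝ × ℝ

/-- The derivation `∂_v = v₁ ∂_x + v₂ ∂_y` acting on functions of `(x, y)`. -/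
noncomputable def dd (v : Plane) (f : Plane → ℝ) : Plane → ℝ := fun p => fderiv ℝ f p v

/-- `∂_v ^ n f (p)`. The tangent line of the graph at `p` over the direction `v ≠ 0` has at least
`k`-point contact with the graph iff `∂_v ^ n f (p) = 0` for all `2 ≤ n < k`. -/
noncomputable def ddPow (n : ℕ) (v : Plane) (f : Plane → ℝ) (p : Plane) : ℝ := (dd v)^[n] f p

noncomputable def fxx (f : Plane → ℝ) : Plane → ℝ := dd (1, 0) (dd (1, 0) f)
noncomputable def fxy (f : Plane → ℝ) : Plane → ℝ := dd (1, 0) (dd (0, 1) f)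
noncomputable def fyy (f : Plane → ℝ) : Plane → ℝ := dd (0, 1) (dd (0, 1) f)

/-- The Hessian determinant. It is positive on the elliptic domain, negative on the hyperbolic
domain, and its zero set is the parabolic curve. -/
noncomputable def hess (f : Plane → ℝ) (p : Plane) : ℝ := fxx f p * fyy f p - fxy f p ^ 2

/-- The point over `0` is a flat umbilic: the quadratic part of `f` vanishes there. -/
def IsFlatUmbilic (f : Plane → ℝ) : Prop := fxx f 0 = 0 ∧ fxy f 0 = 0 ∧ fyy f 0 = 0

/-- The cubic form `v ↦ ∂_v ^ 3 f (0)` is nondegenerate: its differential, which at `v` is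
`w ↦ 3 ∂_w ∂_v ∂_v f (0)`, vanishes only at `v = 0`, i.e. it has no multiple linear factor
(a multiple linear factor of a real binary cubic form is automatically real). -/
def NondegenerateCubic (f : Plane → ℝ) : Prop :=
  ∀ v : Plane, v ≠ 0 → ∃ w : Plane, dd w (dd v (dd v f)) 0 ≠ 0

/-- The second-order part of the jet extension of a family `F ε` of functions,
`(ε, (x, y)) ↦ (f_xx, f_xy, f_yy)`. -/
noncomputable def secondJet (F : ℝ → Plane → ℝ) (z : ℝ × Plane) : ℝ × ℝ × ℝ :=
  (fxx (F z.1) z.2, fxy (F z.1) z.2, fyy (F z.1) z.2)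

/-- Genericity of a one-parameter family with a flat umbilic over `0` at `ε = 0`: its jet extension
is transverse there to the (codimension three) submanifold of the jets with zero quadratic part. -/
def IsGenericFamily (F : ℝ → Plane → ℝ) : Prop :=
  Function.Surjective (fderiv ℝ (secondJet F) (0, 0))

/-- The flecnodal curve: an asymptotic line has at least 4-point contact with the graph. -/
def IsFlecnodal (f : Plane → ℝ) (p : Plane) : Prop :=
  ∃ v : Plane, v ≠ 0 ∧ ddPow 2 v f p = 0 ∧ ddPow 3 v f p = 0

/-- Biflecnode: an asymptotic line has at least 5-point contact with the graph. -/
def IsBiflecnode (f : Plane → ℝ) (p : Plane) : Prop :=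
  ∃ v : Plane, v ≠ 0 ∧ ddPow 2 v f p = 0 ∧ ddPow 3 v f p = 0 ∧ ddPow 4 v f p = 0

/-- The graph lies, locally at `p`, in the upper half-space of its tangent plane at `p`. At an
elliptic point the natural co-orientation is then the upward one. -/
def CoorientedUp (f : Plane → ℝ) (p : Plane) : Prop :=
  ∀ᶠ q in 𝓝 p, f p + fderiv ℝ f p (q - p) ≤ f q

/-- The graph lies, locally at `p`, in the lower half-space of its tangent plane at `p`. -/
def CoorientedDown (f : Plane → ℝ) (p : Plane) : Prop :=
  ∀ᶠ q in 𝓝 p, f q ≤ f p + fderiv ℝ f p (q - p)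

/-- `p` is a godron, with asymptotic direction `v`: `v` spans the unique asymptotic line at `p`, and
it is tangent at `p` to the (regular) parabolic curve. -/
def IsGodronDir (f : Plane → ℝ) (p v : Plane) : Prop :=
  v ≠ 0 ∧ (∀ w : Plane, ddPow 2 w f p = 0 ↔ ∃ c : ℝ, w = c • v) ∧
    hess f p = 0 ∧ fderiv ℝ (hess f) p ≠ 0 ∧ fderiv ℝ (hess f) p v = 0

def IsGodron (f : Plane → ℝ) (p : Plane) : Prop := ∃ v : Plane, IsGodronDir f p v

/-- A simple (not double) godron: in coordinates with the asymptotic line as the first axis,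
`3 f₂₁² - f₀₂ f₄₀ ≠ 0` (the value does not depend on the second axis up to a nonzero factor). -/
def IsSimpleGodron (f : Plane → ℝ) (p : Plane) : Prop :=
  ∃ v w : Plane, IsGodronDir f p v ∧ LinearIndependent ℝ ![v, w] ∧
    3 * (dd v (dd v (dd w f)) p) ^ 2 - ddPow 2 w f p * ddPow 4 v f p ≠ 0

/-- A negative godron (index `-1`): a simple godron such that, at the neighbouring parabolic points
`q`, the asymptotic vectors `v` directed to the hyperbolic domain point away from the godron. -/
def IsNegativeGodron (f : Plane → ℝ) (p : Plane) : Prop :=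
  IsSimpleGodron f p ∧
    ∀ᶠ q in 𝓝[≠] p, hess f q = 0 → ∀ v : Plane, v ≠ 0 → ddPow 2 v f q = 0 →
      fderiv ℝ (hess f) q v ≠ 0 ∧
      (fderiv ℝ (hess f) q v < 0 → 0 < v.1 * (q.1 - p.1) + v.2 * (q.2 - p.2))

/-- A node (projective umbilic): the quadratic form of `f` at `p` divides the cubic form. -/
def IsNode (f : Plane → ℝ) (p : Plane) : Prop :=
  ∃ l : Plane →ₗ[ℝ] ℝ, ∀ v : Plane, ddPow 3 v f p = l v * ddPow 2 v f p

/-- Hyperbonode: a hyperbolic point where the two branches of the flecnodal curve, one for each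
of the two fields `a`, `b` of asymptotic directions, intersect transversely. -/
def IsHyperbonode (f : Plane → ℝ) (p : Plane) : Prop :=
  hess f p < 0 ∧ ∃ a b : Plane → Plane, ContDiffAt ℝ ∞ a p ∧ ContDiffAt ℝ ∞ b p ∧
    LinearIndependent ℝ ![a p, b p] ∧
    (∀ᶠ q in 𝓝 p, ddPow 2 (a q) f q = 0 ∧ ddPow 2 (b q) f q = 0) ∧
    ddPow 3 (a p) f p = 0 ∧ ddPow 3 (b p) f p = 0 ∧
    LinearIndependent ℝ ![fderiv ℝ (fun q => ddPow 3 (a q) f q) p,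
      fderiv ℝ (fun q => ddPow 3 (b q) f q) p]

/-- Real part of `∂_{a + i b} ^ 3 f (p)`. -/
noncomputable def reCube (a b : Plane) (f : Plane → ℝ) (p : Plane) : ℝ :=
  ddPow 3 a f p - 3 * dd a (dd b (dd b f)) p

/-- Imaginary part of `∂_{a + i b} ^ 3 f (p)`. -/
noncomputable def imCube (a b : Plane) (f : Plane → ℝ) (p : Plane) : ℝ :=
  3 * dd a (dd a (dd b f)) p - ddPow 3 b f p

/-- Ellipnode: an elliptic point where the two complex conjugate branches of the flecnodal curve,
one for each of the two fields `a ± i b` of complex asymptotic directions, intersect transversely.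
The equation of the branches is `∂_{a ± i b} ^ 3 f = 0`, and transversality means that the real and
the imaginary part of the left-hand side have linearly independent differentials. -/
def IsEllipnode (f : Plane → ℝ) (p : Plane) : Prop :=
  0 < hess f p ∧ ∃ a b : Plane → Plane, ContDiffAt ℝ ∞ a p ∧ ContDiffAt ℝ ∞ b p ∧
    LinearIndependent ℝ ![a p, b p] ∧
    (∀ᶠ q in 𝓝 p, ddPow 2 (a q) f q = ddPow 2 (b q) f q ∧ dd (a q) (dd (b q) f) q = 0) ∧
    reCube (a p) (b p) f p = 0 ∧ imCube (a p) (b p) f p = 0 ∧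
    LinearIndependent ℝ ![fderiv ℝ (fun q => reCube (a q) (b q) f q) p,
      fderiv ℝ (fun q => imCube (a q) (b q) f q) p]

/-- The elliptic, parabolic and flecnodal sets of the graph of `f` over `U`. -/
def ellipticSet (f : Plane → ℝ) (U : Set Plane) : Set Plane := {p ∈ U | 0 < hess f p}
def parabolicSet (f : Plane → ℝ) (U : Set Plane) : Set Plane := {p ∈ U | hess f p = 0}
def flecnodalSet (f : Plane → ℝ) (U : Set Plane) : Set Plane := {p ∈ U | IsFlecnodal f p}

/-- The parts of the elliptic set that are co-oriented upwards and downwards. -/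
def ellipticUp (f : Plane → ℝ) (U : Set Plane) : Set Plane :=
  {p ∈ ellipticSet f U | CoorientedUp f p}
def ellipticDown (f : Plane → ℝ) (U : Set Plane) : Set Plane :=
  {p ∈ ellipticSet f U | CoorientedDown f p}

/-- `A` is a smooth regular curve in `U`, closed in `U` and homeomorphic to a line, which passes
through `0` with direction `d`. -/
def IsSmoothArc (A U : Set Plane) (d : Plane) : Prop :=
  d ≠ 0 ∧ ∃ φ : Plane → ℝ, ContDiffOn ℝ ∞ φ U ∧ A = {q ∈ U | φ q = 0} ∧
    (∀ q ∈ A, fderiv ℝ φ q ≠ 0) ∧ Nonempty (A ≃ₜ ℝ) ∧ (0 : Plane) ∈ A ∧ fderiv ℝ φ 0 d = 0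

/-- The `D₄⁻` transition of the family `F ε`, `|ε| < ε₀`, over the neighbourhood `U` of `0`, with
kernel directions `u 0`, `u 1`, `u 2`. -/
structure DFourMinusTransition (F : ℝ → Plane → ℝ) (u : Fin 3 → Plane) (U : Set Plane)
    (ε₀ : ℝ) : Prop where
  /-- At the transition moment, three flecnodal curves with the given directions meet at `0`. -/
  flecnodal_zero : ∃ A : Fin 3 → Set Plane, (∀ i, IsSmoothArc (A i) U (u i)) ∧
    (∀ i j, i ≠ j → A i ∩ A j = {0}) ∧ flecnodalSet (F 0) U = ⋃ i, A i
  /-- At the transition moment, the elliptic disc is reduced to the umbilic. -/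
  elliptic_zero : ellipticSet (F 0) U = ∅
  parabolic_zero : parabolicSet (F 0) U = {0}
  /-- Before and after, the elliptic set is a disc bounded by the smooth parabolic curve. -/
  elliptic_disc : ∀ ε : ℝ, |ε| < ε₀ → ε ≠ 0 →
    (∃ Φ : Plane ≃ₜ Plane,
      Φ '' {q | q.1 ^ 2 + q.2 ^ 2 < 1} = ellipticSet (F ε) U ∧
      Φ '' {q | q.1 ^ 2 + q.2 ^ 2 = 1} = parabolicSet (F ε) U) ∧
    ∀ p ∈ parabolicSet (F ε) U, fderiv ℝ (hess (F ε)) p ≠ 0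
  /-- The closed disc collapses to `0` when `ε` tends to `0`. -/
  collapse : ∀ N ∈ 𝓝 (0 : Plane), ∀ᶠ ε in 𝓝 (0 : ℝ),
    ellipticSet (F ε) U ∪ parabolicSet (F ε) U ⊆ N
  /-- The discs before and after the transition have opposite co-orientations. -/
  coorientation : ∃ s : ℝ, (s = 1 ∨ s = -1) ∧ ∀ ε : ℝ, |ε| < ε₀ → ∀ p ∈ ellipticSet (F ε) U,
    (0 < s * ε → CoorientedUp (F ε) p) ∧ (s * ε < 0 → CoorientedDown (F ε) p)
  /-- Three negative godrons (and no other godron) collapse at `0` and reappear. -/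
  godrons : ∃ g : Fin 3 → ℝ → Plane,
    (∀ i, ContinuousOn (g i) (Ioo (-ε₀) ε₀) ∧ g i 0 = 0) ∧
    ∀ ε : ℝ, |ε| < ε₀ → ε ≠ 0 → Function.Injective (fun i => g i ε) ∧
      {p ∈ U | IsGodron (F ε) p} = range (fun i => g i ε) ∧
      ∀ i, IsNegativeGodron (F ε) (g i ε)
  /-- Three hyperbonodes (and no other hyperbolic node) collapse at `0` and reappear. -/
  hyperbonodes : ∃ h : Fin 3 → ℝ → Plane,
    (∀ i, ContinuousOn (h i) (Ioo (-ε₀) ε₀) ∧ h i 0 = 0) ∧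
    ∀ ε : ℝ, |ε| < ε₀ → ε ≠ 0 → Function.Injective (fun i => h i ε) ∧
      {p ∈ U | hess (F ε) p < 0 ∧ IsNode (F ε) p} = range (fun i => h i ε) ∧
      ∀ i, IsHyperbonode (F ε) (h i ε)
  no_biflecnode : ∀ ε : ℝ, |ε| < ε₀ → ∀ p ∈ U, ¬ IsBiflecnode (F ε) p

/-- The `D₄⁺` transition of the family `F ε`, `|ε| < ε₀`, over the neighbourhood `U` of `0`, with
kernel direction `u`. -/
structure DFourPlusTransition (F : ℝ → Plane → ℝ) (u : Plane) (U : Set Plane)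
    (ε₀ : ℝ) : Prop where
  /-- At the transition moment, the flecnodal curve is one curve with direction `u`, and the
  parabolic curve consists of two branches; the three curves are pairwise transverse at `0`. -/
  curves_zero : ∃ (d₁ d₂ : Plane) (P₁ P₂ : Set Plane),
    IsSmoothArc (flecnodalSet (F 0) U) U u ∧ IsSmoothArc P₁ U d₁ ∧ IsSmoothArc P₂ U d₂ ∧
    parabolicSet (F 0) U = P₁ ∪ P₂ ∧ P₁ ∩ P₂ = {0} ∧
    flecnodalSet (F 0) U ∩ parabolicSet (F 0) U = {0} ∧
    LinearIndependent ℝ ![d₁, d₂] ∧ LinearIndependent ℝ ![u, d₁] ∧ LinearIndependent ℝ ![u, d₂]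
  /-- At each moment there are two elliptic domains, of opposite co-orientation. -/
  domains : ∀ ε : ℝ, |ε| < ε₀ →
    IsConnected (ellipticUp (F ε) U) ∧ IsConnected (ellipticDown (F ε) U) ∧
    ellipticSet (F ε) U = ellipticUp (F ε) U ∪ ellipticDown (F ε) U
  /-- At the transition moment they touch each other, exactly at the umbilic. -/
  touch : U ∩ (closure (ellipticUp (F 0) U) ∩ closure (ellipticDown (F 0) U)) = {0}
  /-- Before and after they are apart; the parabolic curve is smooth, and it consists of two
  curves, the boundaries of the two elliptic domains. -/
  apart : ∀ ε : ℝ, |ε| < ε₀ → ε ≠ 0 →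
    U ∩ (closure (ellipticUp (F ε) U) ∩ closure (ellipticDown (F ε) U)) = ∅ ∧
    parabolicSet (F ε) U =
      (U ∩ frontier (ellipticUp (F ε) U)) ∪ (U ∩ frontier (ellipticDown (F ε) U)) ∧
    Nonempty (↥(U ∩ frontier (ellipticUp (F ε) U)) ≃ₜ ℝ) ∧
    Nonempty (↥(U ∩ frontier (ellipticDown (F ε) U)) ≃ₜ ℝ) ∧
    ∀ p ∈ parabolicSet (F ε) U, fderiv ℝ (hess (F ε)) p ≠ 0
  /-- One ellipnode `e ε` (and no other elliptic node) passes through `0` from one elliptic domain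
  to the other; one negative godron `g ε` (and no other godron) passes through `0` from one
  parabolic curve to the other, in the opposite sense. -/
  passage : ∃ (s : ℝ) (e g : ℝ → Plane), (s = 1 ∨ s = -1) ∧
    ContinuousOn e (Ioo (-ε₀) ε₀) ∧ e 0 = 0 ∧ ContinuousOn g (Ioo (-ε₀) ε₀) ∧ g 0 = 0 ∧
    ∀ ε : ℝ, |ε| < ε₀ → ε ≠ 0 →
      {p ∈ U | 0 < hess (F ε) p ∧ IsNode (F ε) p} = {e ε} ∧ IsEllipnode (F ε) (e ε) ∧
      {p ∈ U | IsGodron (F ε) p} = {g ε} ∧ IsNegativeGodron (F ε) (g ε) ∧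
      (0 < s * ε → e ε ∈ ellipticUp (F ε) U ∧ g ε ∈ frontier (ellipticDown (F ε) U)) ∧
      (s * ε < 0 → e ε ∈ ellipticDown (F ε) U ∧ g ε ∈ frontier (ellipticUp (F ε) U))
  no_biflecnode : ∀ ε : ℝ, |ε| < ε₀ → ∀ p ∈ U, ¬ IsBiflecnode (F ε) p

end FlatUmbilic

/-! The coefficients `(f₂₀, f₁₁, f₀₂)` map `(ε, x, y)`-space to the three-dimensional space of
binary quadratic forms, and genericity says that this map is a local diffeomorphism at the umbilic.
The cubic form is nondegenerate, so its roots are smooth functions of `(ε, x, y)` near the origin.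
The special points are given by the position of the quadratic form relative to the cubic form. At a
godron the quadratic form is a multiple of the square of a real linear factor of the cubic form. At
a hyperbolic or elliptic node it is a multiple of the product of two linear factors, real or complex
conjugate.

A line in the space of forms has one smooth curve as preimage. If the line is transverse to the
image of the plane `ε = 0`, the curve has the form `(ε, e ε)`: there is exactly one point for each
`ε`, and the factor of proportionality changes sign with `ε`. `NormalFamily.exists_ray` proves this
by the implicit function theorem, even for a form that varies smoothly with the point. Applied to
the squares and products of linear factors, it gives existence, uniqueness and continuity of all
godrons, hyperbonodes and ellipnodes.

A linear change of coordinates makes the cubic form `x³ + 3σxy²`, with `σ = 1` for `D₄⁺` and `σ =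
-1` for `D₄⁻` (`exists_normal_basis`, `exists_normalFamily`). The functional `-Q₁ + σQ₃` vanishes on
the image of the plane `ε = 0`, and its value on a form decides the sign of the factor. In the case
`D₄⁺` it is `-1` on the square of the real factor and `2` on the definite factor, and this is why
the godron and the ellipnode pass in opposite senses. The nondegeneracy conditions follow by
continuity from the umbilic, where the quadratic form vanishes and only the cubic form counts. In
particular `3f₂₁² - f₀₂f₄₀` tends to `3f₂₁² > 0`, so that every godron is simple and negative
(`PosGodron.isNegativeGodron`). Biflecnodes are excluded because the quartic form does not vanish at
the roots of the cubic form.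

The shape of the elliptic set is found separately in the two cases. For `D₄⁺` the `x`-derivative of
the Hessian matrix is near the identity, so both eigenvalues increase with `x` and vanish along
graphs `x = α y` and `x = β y`, and the elliptic domains are the outer sides of these graphs. For
`D₄⁻` the function `-hess` is strictly convex and equal to `x² + y²` to second order at `ε = 0`. The
elliptic set is therefore a convex sublevel set of size `O(ε)`, nonempty for `ε ≠ 0` because it
contains the ray of the form `x² + y²`. Finally all notions are transported back through the linear
change of coordinates. -/

namespace FlatUmbilic

/-! ### Directional derivatives in terms of partial derivatives; smooth families -/

section Calculus

variable {f g : Plane → ℝ}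

theorem dd_contDiff (hf : ContDiff ℝ ∞ f) (v : Plane) : ContDiff ℝ ∞ (dd v f) := by
  have h : ContDiff ℝ ∞ (fderiv ℝ f) := hf.fderiv_right (m := ∞) (by simp)
  exact h.clm_apply contDiff_const

theorem dd_eq (f : Plane → ℝ) (v p : Plane) :
    dd v f p = v.1 * dd (1, 0) f p + v.2 * dd (0, 1) f p := by
  have : v = v.1 • ((1, 0) : Plane) + v.2 • ((0, 1) : Plane) := by ext <;> simp
  unfold dd
  conv_lhs => rw [this]
  simp only [map_add, map_smul, smul_eq_mul]

theorem dd_comm (hf : ContDiff ℝ ∞ f) (v w : Plane) : dd v (dd w f) = dd w (dd v f) := by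
  funext p
  have hd : DifferentiableAt ℝ (fderiv ℝ f) p :=
    (hf.fderiv_right (m := ∞) (by simp)).differentiable (by simp) p
  have key : ∀ v w : Plane, dd v (dd w f) p = fderiv ℝ (fderiv ℝ f) p v w := by
    intro v w
    unfold dd
    rw [fderiv_clm_apply hd (differentiableAt_const w)]
    simp
  have hs : IsSymmSndFDerivAt ℝ f p :=
    (contDiff_infty.mp hf 2).contDiffAt.isSymmSndFDerivAt (by simp)
  rw [key, key, hs.eq]

theorem dd_lin {v : Plane} (hf : ContDiff ℝ ∞ f) (hg : ContDiff ℝ ∞ g) (α β : ℝ) :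
    dd v (fun p => α * f p + β * g p) = fun p => α * dd v f p + β * dd v g p := by
  funext p
  have h1 := hf.differentiable (by simp) p
  have h2 := hg.differentiable (by simp) p
  unfold dd
  rw [fderiv_fun_add (h1.const_mul _) (h2.const_mul _), fderiv_const_mul h1, fderiv_const_mul h2]
  simp

theorem dd_mul {v : Plane} (hf : ContDiff ℝ ∞ f) (hg : ContDiff ℝ ∞ g) :
    dd v (fun p => f p * g p) = fun p => f p * dd v g p + g p * dd v f p := by
  funext p
  have h1 := hf.differentiable (by simp) p
  have h2 := hg.differentiable (by simp) p
  unfold dd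
  rw [fderiv_fun_mul h1 h2]
  simp

/-- The partial derivative `∂_x ^ i ∂_y ^ j f`. -/
noncomputable def jet (i j : ℕ) (f : Plane → ℝ) : Plane → ℝ := (dd (1, 0))^[i] ((dd (0, 1))^[j] f)

theorem iterate_dd_contDiff (hf : ContDiff ℝ ∞ f) (v : Plane) (n : ℕ) :
    ContDiff ℝ ∞ ((dd v)^[n] f) := by
  induction n with
  | zero => exact hf
  | succ n ih => rw [Function.iterate_succ_apply']; exact dd_contDiff ih v

theorem jet_contDiff (hf : ContDiff ℝ ∞ f) (i j : ℕ) : ContDiff ℝ ∞ (jet i j f) :=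
  iterate_dd_contDiff (iterate_dd_contDiff hf _ _) _ _

theorem dd_x_jet (i j : ℕ) (f : Plane → ℝ) : dd (1, 0) (jet i j f) = jet (i + 1) j f := by
  unfold jet; rw [Function.iterate_succ_apply']

theorem dd_y_jet (hf : ContDiff ℝ ∞ f) (i j : ℕ) : dd (0, 1) (jet i j f) = jet i (j + 1) f := by
  induction i with
  | zero => unfold jet; simp only [Function.iterate_zero, id, Function.iterate_succ_apply']
  | succ n ih => rw [← dd_x_jet, dd_comm (jet_contDiff hf _ _), ih, dd_x_jet]

theorem dd_jet (hf : ContDiff ℝ ∞ f) (v : Plane) (i j : ℕ) :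
    dd v (jet i j f) = fun p => v.1 * jet (i + 1) j f p + v.2 * jet i (j + 1) f p := by
  funext p; rw [dd_eq, dd_x_jet, dd_y_jet hf]

theorem dd_one (f : Plane → ℝ) (v : Plane) :
    dd v f = fun p => v.1 * jet 1 0 f p + v.2 * jet 0 1 f p := by
  funext p; exact dd_eq f v p

theorem dd_two (hf : ContDiff ℝ ∞ f) (u v : Plane) :
    dd u (dd v f) = fun p => u.1 * v.1 * jet 2 0 f p + (u.1 * v.2 + u.2 * v.1) * jet 1 1 f p
      + u.2 * v.2 * jet 0 2 f p := by
  rw [dd_one f v, dd_lin (jet_contDiff hf _ _) (jet_contDiff hf _ _)]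
  simp only [dd_jet hf]
  funext p; norm_num; ring

theorem dd_lin₃ {v : Plane} {h : Plane → ℝ} (hf : ContDiff ℝ ∞ f) (hg : ContDiff ℝ ∞ g)
    (hh : ContDiff ℝ ∞ h) (α β γ : ℝ) :
    dd v (fun p => α * f p + β * g p + γ * h p) =
      fun p => α * dd v f p + β * dd v g p + γ * dd v h p := by
  have := dd_lin (v := v) (f := fun p => α * f p + β * g p) (g := h)
    ((contDiff_const.mul hf).add (contDiff_const.mul hg)) hh 1 γ
  simp only [one_mul] at this
  rw [this, dd_lin hf hg]

theorem dd_lin₄ {v : Plane} {h k : Plane → ℝ} (hf : ContDiff ℝ ∞ f) (hg : ContDiff ℝ ∞ g)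
    (hh : ContDiff ℝ ∞ h) (hk : ContDiff ℝ ∞ k) (α β γ δ : ℝ) :
    dd v (fun p => α * f p + β * g p + γ * h p + δ * k p) =
      fun p => α * dd v f p + β * dd v g p + γ * dd v h p + δ * dd v k p := by
  have := dd_lin (v := v) (f := fun p => α * f p + β * g p + γ * h p) (g := k)
    (((contDiff_const.mul hf).add (contDiff_const.mul hg)).add (contDiff_const.mul hh)) hk 1 δ
  simp only [one_mul] at this
  rw [this, dd_lin₃ hf hg hh]

theorem dd_three (hf : ContDiff ℝ ∞ f) (u v w : Plane) :
    dd u (dd v (dd w f)) = fun p => u.1 * v.1 * w.1 * jet 3 0 f p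
      + (u.1 * v.1 * w.2 + u.1 * v.2 * w.1 + u.2 * v.1 * w.1) * jet 2 1 f p
      + (u.1 * v.2 * w.2 + u.2 * v.1 * w.2 + u.2 * v.2 * w.1) * jet 1 2 f p
      + u.2 * v.2 * w.2 * jet 0 3 f p := by
  rw [dd_two hf v w, dd_lin₃ (jet_contDiff hf _ _) (jet_contDiff hf _ _) (jet_contDiff hf _ _)]
  simp only [dd_jet hf]
  funext p; norm_num; ring

theorem dd_four (hf : ContDiff ℝ ∞ f) (t u v w : Plane) (p : Plane) :
    dd t (dd u (dd v (dd w f))) p =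
      u.1 * v.1 * w.1 * (t.1 * jet 4 0 f p + t.2 * jet 3 1 f p)
      + (u.1 * v.1 * w.2 + u.1 * v.2 * w.1 + u.2 * v.1 * w.1) *
        (t.1 * jet 3 1 f p + t.2 * jet 2 2 f p)
      + (u.1 * v.2 * w.2 + u.2 * v.1 * w.2 + u.2 * v.2 * w.1) *
        (t.1 * jet 2 2 f p + t.2 * jet 1 3 f p)
      + u.2 * v.2 * w.2 * (t.1 * jet 1 3 f p + t.2 * jet 0 4 f p) := by
  rw [dd_three hf u v w, dd_lin₄ (jet_contDiff hf _ _) (jet_contDiff hf _ _) (jet_contDiff hf _ _)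
    (jet_contDiff hf _ _)]
  simp only [dd_jet hf]

theorem ddPow_two (hf : ContDiff ℝ ∞ f) (v p : Plane) : ddPow 2 v f p =
    v.1 ^ 2 * jet 2 0 f p + 2 * v.1 * v.2 * jet 1 1 f p + v.2 ^ 2 * jet 0 2 f p := by
  change dd v (dd v f) p = _
  rw [dd_two hf]; ring

theorem ddPow_three (hf : ContDiff ℝ ∞ f) (v p : Plane) : ddPow 3 v f p =
    v.1 ^ 3 * jet 3 0 f p + 3 * v.1 ^ 2 * v.2 * jet 2 1 f p + 3 * v.1 * v.2 ^ 2 * jet 1 2 f p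
      + v.2 ^ 3 * jet 0 3 f p := by
  change dd v (dd v (dd v f)) p = _
  rw [dd_three hf]; ring

theorem ddPow_four (hf : ContDiff ℝ ∞ f) (v p : Plane) : ddPow 4 v f p =
    v.1 ^ 4 * jet 4 0 f p + 4 * v.1 ^ 3 * v.2 * jet 3 1 f p + 6 * v.1 ^ 2 * v.2 ^ 2 * jet 2 2 f p
      + 4 * v.1 * v.2 ^ 3 * jet 1 3 f p + v.2 ^ 4 * jet 0 4 f p := by
  change dd v (dd v (dd v (dd v f))) p = _
  rw [dd_four hf]; ring

theorem hess_eq (f : Plane → ℝ) (p : Plane) :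
    hess f p = jet 2 0 f p * jet 0 2 f p - jet 1 1 f p ^ 2 := rfl

theorem hess_contDiff (hf : ContDiff ℝ ∞ f) : ContDiff ℝ ∞ (hess f) := by
  have h1 := jet_contDiff hf 2 0
  have h2 := jet_contDiff hf 0 2
  have h3 := jet_contDiff hf 1 1
  exact (h1.mul h2).sub (h3.pow 2)

theorem hasFDerivAt_of_contDiff (hf : ContDiff ℝ ∞ f) (p : Plane) :
    HasFDerivAt f (fderiv ℝ f p) p := (hf.differentiable (by simp) p).hasFDerivAt

theorem fderiv_hess (hf : ContDiff ℝ ∞ f) (p d : Plane) :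
    fderiv ℝ (hess f) p d = jet 2 0 f p * (d.1 * jet 1 2 f p + d.2 * jet 0 3 f p)
      + jet 0 2 f p * (d.1 * jet 3 0 f p + d.2 * jet 2 1 f p)
      - 2 * jet 1 1 f p * (d.1 * jet 2 1 f p + d.2 * jet 1 2 f p) := by
  have h1 := jet_contDiff hf 2 0
  have h2 := jet_contDiff hf 0 2
  have h3 := jet_contDiff hf 1 1
  have e : hess f = fun p => 1 * (jet 2 0 f p * jet 0 2 f p) + (-1) * (jet 1 1 f p * jet 1 1 f p) := by
    funext p; rw [hess_eq]; ring
  change dd d (hess f) p = _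
  rw [e, dd_lin (h1.mul h2) (h3.mul h3), dd_mul h1 h2, dd_mul h3 h3]
  simp only [dd_jet hf]; norm_num; ring

/-- The value at `p` of the partial derivative of the `ε`-th member of a family. -/
noncomputable def J (G : ℝ → Plane → ℝ) (i j : ℕ) (z : ℝ × Plane) : ℝ := jet i j (G z.1) z.2

/-- The family is jointly smooth in the parameter and the point. -/
def SmoothFamily (G : ℝ → Plane → ℝ) : Prop := ContDiff ℝ ∞ (fun z : ℝ × Plane => G z.1 z.2)

variable {G : ℝ → Plane → ℝ}

theorem SmoothFamily.slice (hG : SmoothFamily G) (ε : ℝ) : ContDiff ℝ ∞ (G ε) :=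
  ContDiff.comp (g := fun z : ℝ × Plane => G z.1 z.2) (f := fun p : Plane => (ε, p)) hG
    (contDiff_const.prodMk contDiff_id)

theorem fderiv_slice {H : ℝ × Plane → ℝ} {z : ℝ × Plane} (hH : DifferentiableAt ℝ H z) (d : Plane) :
    fderiv ℝ (fun p => H (z.1, p)) z.2 d = fderiv ℝ H z (0, d) := by
  have h1 : HasFDerivAt (fun p : Plane => (z.1, p)) (ContinuousLinearMap.inr ℝ ℝ Plane) z.2 :=
    hasFDerivAt_prodMk_right z.1 z.2
  have h2 : HasFDerivAt (fun p => H (z.1, p)) _ z.2 :=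
    HasFDerivAt.comp (g := H) (f := fun p : Plane => (z.1, p)) z.2 hH.hasFDerivAt h1
  rw [h2.fderiv]; simp

theorem SmoothFamily.dd (hG : SmoothFamily G) (v : Plane) :
    SmoothFamily (fun ε => dd v (G ε)) := by
  have h : ContDiff ℝ ∞ (fderiv ℝ (fun z : ℝ × Plane => G z.1 z.2)) :=
    ContDiff.fderiv_right (m := ∞) hG (by simp)
  have h2 : ContDiff ℝ ∞ (fun z => fderiv ℝ (fun z : ℝ × Plane => G z.1 z.2) z ((0 : ℝ), v)) :=
    h.clm_apply contDiff_const
  unfold SmoothFamily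
  convert h2 using 2 with z
  exact fderiv_slice (H := fun z : ℝ × Plane => G z.1 z.2)
    (ContDiff.differentiable hG (by simp) z) v

theorem SmoothFamily.jet (hG : SmoothFamily G) (i j : ℕ) : ContDiff ℝ ∞ (J G i j) := by
  have h1 : ∀ n v (H : ℝ → Plane → ℝ), SmoothFamily H →
      SmoothFamily (fun ε => (FlatUmbilic.dd v)^[n] (H ε)) := by
    intro n v
    induction n with
    | zero => intro H hH; exact hH
    | succ n ih => intro H hH; simp only [Function.iterate_succ_apply]; exact ih _ (hH.dd v)
  exact h1 i (1, 0) _ (h1 j (0, 1) G hG)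

/-- Along the plane, differentiating `J` gives values of `J` again; only the derivative in `ε` is
new data of the family. -/
theorem SmoothFamily.fderiv_J (hG : SmoothFamily G) (i j : ℕ) (z : ℝ × Plane) (d : Plane) :
    fderiv ℝ (J G i j) z (0, d) = d.1 * J G (i + 1) j z + d.2 * J G i (j + 1) z := by
  rw [← fderiv_slice ((hG.jet i j).differentiable (by simp) z)]
  exact congrFun (dd_jet (hG.slice z.1) d i j) z.2

end Calculus

/-! ### A sign criterion for negative godrons -/

section NegativeGodron

/-- If `h`, `k`, `m` vanish at `p`, and the derivatives of `k` and `m` along the tangent line of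
`h = 0` have opposite signs, then so have the values of `k` and `m` on `h = 0` near `p`. -/
theorem eventually_mul_neg_on_curve {h k m : Plane → ℝ} {h' k' m' : Plane →L[ℝ] ℝ} {p v : Plane}
    (hh : HasFDerivAt h h' p) (hk : HasFDerivAt k k' p) (hm : HasFDerivAt m m' p)
    (h0 : h p = 0) (k0 : k p = 0) (m0 : m p = 0) (hv : h' v = 0) (hne : h' ≠ 0)
    (hkm : k' v * m' v < 0) :
    ∀ᶠ q in 𝓝[≠] p, h q = 0 → k q * m q < 0 := by
  have hmv : m' v ≠ 0 := by rintro e; simp [e] at hkm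
  obtain ⟨w, hw⟩ : ∃ w, h' w ≠ 0 := by
    by_contra! hc; exact hne (ContinuousLinearMap.ext hc)
  -- decomposition of vectors
  have hv0 : v ≠ 0 := by rintro rfl; simp at hmv
  have hli : v.1 * w.2 - v.2 * w.1 ≠ 0 := by
    intro hc
    apply hw
    have e1 : v.1 • w = w.1 • v := by ext <;> simp <;> linarith
    have e2 : v.2 • w = w.2 • v := by ext <;> simp <;> linarith
    have e1' := congrArg h' e1
    have e2' := congrArg h' e2
    simp only [map_smul, smul_eq_mul, hv, mul_zero, mul_eq_zero] at e1' e2'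
    rcases e1' with a | a
    · rcases e2' with b | b
      · exact absurd (Prod.ext a b) hv0
      · exact b
    · exact a
  set δ := v.1 * w.2 - v.2 * w.1 with hδ
  have dec : ∀ d : Plane, d = ((d.1 * w.2 - d.2 * w.1) / δ) • v
      + ((v.1 * d.2 - v.2 * d.1) / δ) • w := by
    intro d
    ext
    · simp only [Prod.fst_add, Prod.smul_fst, smul_eq_mul]; field_simp; rw [hδ]; ring
    · simp only [Prod.snd_add, Prod.smul_snd, smul_eq_mul]; field_simp; rw [hδ]; ring
  -- `h'` and `m'` span the dual plane, so `k' = α h' + β m'`. On the curve `h = 0` the values of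
  -- `k` and `β m` then agree to first order, and `β < 0`.
  set β := k' v / m' v with hβ
  have hβ0 : β < 0 := by
    rw [hβ, div_eq_mul_inv]
    have : k' v * (m' v)⁻¹ = (k' v * m' v) * ((m' v)⁻¹) ^ 2 := by field_simp
    rw [this]; exact mul_neg_of_neg_of_pos hkm (by positivity)
  set α := (k' w - β * m' w) / h' w with hα
  have hk' : ∀ d, k' d = α * h' d + β * m' d := by
    intro d
    rw [dec d]
    simp only [map_add, map_smul, smul_eq_mul, hv]
    have e1 : k' v = β * m' v := by rw [hβ]; field_simp
    have e2 : k' w = α * h' w + β * m' w := by rw [hα]; field_simp; ring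
    rw [e1, e2]; ring
  -- The pair `(h', m')` is injective: the `w`-coordinate of `d` is read off from `h' d`, and then
  -- the `v`-coordinate from `m' d`.
  have hnorm : ∃ C > 0, ∀ d : Plane, ‖d‖ ≤ C * (|h' d| + |m' d|) := by
    refine ⟨(‖v‖ * (1 + |m' w|/ |h' w|)) / |m' v| + ‖w‖ / |h' w| + 1, by positivity, ?_⟩
    intro d
    set x := (d.1 * w.2 - d.2 * w.1) / δ
    set y := (v.1 * d.2 - v.2 * d.1) / δ
    have hd := dec d
    have ey : |y| = |h' d| / |h' w| := by
      have : h' d = y * h' w := by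
        conv_lhs => rw [hd]
        simp only [map_add, map_smul, smul_eq_mul, hv, mul_zero, zero_add]; rfl
      rw [this, abs_mul]
      field_simp
    have ex : x * m' v = m' d - y * m' w := by
      conv_rhs => rw [hd]
      simp only [map_add, map_smul, smul_eq_mul]; ring
    have ex' : |x| ≤ (|m' d| + |y| * |m' w|) / |m' v| := by
      rw [le_div_iff₀ (by positivity), ← abs_mul, ex, ← abs_mul]
      exact abs_sub _ _
    have : ‖d‖ ≤ |x| * ‖v‖ + |y| * ‖w‖ := by
      calc ‖d‖ = ‖x • v + y • w‖ := by rw [← hd]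
        _ ≤ ‖x • v‖ + ‖y • w‖ := norm_add_le _ _
        _ = _ := by rw [norm_smul, norm_smul]; rfl
    refine this.trans ?_
    have h1 : |x| * ‖v‖ ≤ (|m' d| + |y| * |m' w|) / |m' v| * ‖v‖ := by gcongr
    have h2 : 0 ≤ ‖v‖ / |m' v| := by positivity
    have h3 : 0 ≤ |m' w| / |h' w| := by positivity
    have h4 : 0 ≤ ‖w‖ / |h' w| := by positivity
    have e3 : (|m' d| + |y| * |m' w|) / |m' v| * ‖v‖
        = ‖v‖ / |m' v| * (|m' d| + |h' d| * (|m' w| / |h' w|)) := by rw [ey]; ring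
    have e4 : |y| * ‖w‖ = |h' d| * (‖w‖ / |h' w|) := by rw [ey]; ring
    have e5 : ‖v‖ * (1 + |m' w| / |h' w|) / |m' v| = ‖v‖ / |m' v| * (1 + |m' w| / |h' w|) := by ring
    rw [e3] at h1
    rw [e4, e5]
    have p1 := abs_nonneg (h' d)
    have p2 := abs_nonneg (m' d)
    have q1 := mul_nonneg h2 p1
    have q2 := mul_nonneg (mul_nonneg h2 h3) p2
    have q3 := mul_nonneg h4 p2
    nlinarith
  obtain ⟨C, hC, hCd⟩ := hnorm
  set M := |α| + |β| + 1 with hM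
  have hMpos : 0 < M := by positivity
  -- The first bound allows the error terms to be absorbed, giving `‖d‖ ≤ 2C|m q|` on the curve. The
  -- second makes the error of `k q - β m q` at most half of `|β m q|`.
  set η := min (1 / (4 * C)) (|β| / (4 * C * M)) with hη
  have hβp : 0 < |β| := abs_pos.mpr hβ0.ne
  have hηpos : 0 < η := lt_min (by positivity) (by positivity)
  have L1 := hh.isLittleO.def hηpos
  have L2 := hk.isLittleO.def hηpos
  have L3 := hm.isLittleO.def hηpos
  have : ∀ᶠ q in 𝓝 p, q ≠ p → h q = 0 → k q * m q < 0 := by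
    filter_upwards [L1, L2, L3] with q l1 l2 l3 hq hz
    rw [h0, hz] at l1; rw [k0] at l2; rw [m0] at l3
    simp only [sub_zero, zero_sub, norm_neg, Real.norm_eq_abs] at l1 l2 l3
    set d := q - p with hd
    have hdpos : 0 < ‖d‖ := norm_pos_iff.mpr (sub_ne_zero.mpr hq)
    have b1 := hCd d
    have b2 : |m' d| ≤ |m q| + η * ‖d‖ := by
      have : m' d = m q - (m q - m' d) := by ring
      calc |m' d| = |m q - (m q - m' d)| := by rw [← this]
        _ ≤ |m q| + |m q - m' d| := abs_sub _ _
        _ ≤ _ := by linarith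
    have hη1 : C * η ≤ 1 / 4 := by
      have : η ≤ 1 / (4 * C) := min_le_left _ _
      calc C * η ≤ C * (1 / (4 * C)) := by gcongr
        _ = 1 / 4 := by field_simp
    have b3 : ‖d‖ ≤ 2 * C * |m q| := by
      have : ‖d‖ ≤ C * (η * ‖d‖ + (|m q| + η * ‖d‖)) := b1.trans (by gcongr)
      nlinarith
    have hmq : 0 < |m q| := by
      by_contra! hc
      nlinarith [abs_nonneg (m q)]
    have b4 : |k q - β * m q| ≤ M * (η * ‖d‖) := by
      have e : k q - β * m q = (k q - k' d) + α * h' d - β * (m q - m' d) := by rw [hk' d]; ring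
      rw [e]
      have t1 := abs_sub (k q - k' d + α * h' d) (β * (m q - m' d))
      have t2 := abs_add_le (k q - k' d) (α * h' d)
      rw [abs_mul] at t1 t2
      have t3 : |α| * |h' d| ≤ |α| * (η * ‖d‖) := by gcongr
      have t4 : |β| * |m q - m' d| ≤ |β| * (η * ‖d‖) := by gcongr
      rw [hM]; nlinarith
    have b5 : |k q - β * m q| ≤ |β| / 2 * |m q| := by
      have : η ≤ |β| / (4 * C * M) := min_le_right _ _
      calc _ ≤ M * (η * ‖d‖) := b4
        _ ≤ M * (|β| / (4 * C * M) * (2 * C * |m q|)) := by gcongr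
        _ = _ := by field_simp; norm_num
    have b6 : k q * m q = β * m q ^ 2 + (k q - β * m q) * m q := by ring
    have b8 : |m q| * |m q| = m q ^ 2 := by rw [← sq, sq_abs]
    have b7 : (k q - β * m q) * m q ≤ -β / 2 * m q ^ 2 := by
      calc _ ≤ |(k q - β * m q) * m q| := le_abs_self _
        _ = |k q - β * m q| * |m q| := abs_mul _ _
        _ ≤ |β| / 2 * |m q| * |m q| := by gcongr
        _ = _ := by rw [abs_of_neg hβ0, mul_assoc, b8]
    have : 0 < m q ^ 2 := by rw [← b8]; positivity
    have b9 : β * m q ^ 2 < 0 := mul_neg_of_neg_of_pos hβ0 this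
    rw [b6]; linarith
  exact eventually_nhdsWithin_iff.mpr this

/-- A godron with `3 f₂₁² - f₀₂ f₄₀ > 0`. -/
def PosGodron (f : Plane → ℝ) (p : Plane) : Prop :=
  ∃ v w : Plane, IsGodronDir f p v ∧ LinearIndependent ℝ ![v, w] ∧
    0 < 3 * (dd v (dd v (dd w f)) p) ^ 2 - ddPow 2 w f p * ddPow 4 v f p

theorem linearIndependent_pair_iff (v w : Plane) :
    LinearIndependent ℝ ![v, w] ↔ v.1 * w.2 - v.2 * w.1 ≠ 0 := by
  rw [LinearIndependent.pair_iff]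
  constructor
  · intro h hc
    have h1 := h w.2 (-v.2) (by ext <;> simp <;> linarith)
    have h2 := h w.1 (-v.1) (by ext <;> simp <;> linarith)
    have := h 1 1 (by ext <;> simp <;> linarith)
    exact one_ne_zero this.1
  · intro h s t hst
    have e1 : s * v.1 + t * w.1 = 0 := by simpa using congrArg Prod.fst hst
    have e2 : s * v.2 + t * w.2 = 0 := by simpa using congrArg Prod.snd hst
    constructor
    · apply (mul_eq_zero.mp (?_ : s * (v.1 * w.2 - v.2 * w.1) = 0)).resolve_right h
      linear_combination w.2 * e1 - w.1 * e2
    · apply (mul_eq_zero.mp (?_ : t * (v.1 * w.2 - v.2 * w.1) = 0)).resolve_right h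
      linear_combination v.1 * e2 - v.2 * e1

/-- In the basis `v, w` let `A, B, C` be the coefficients of the quadratic form. At parabolic points
near `p` the asymptotic line is spanned by `n = Cv - Bw`. Both `∂ₙ hess` and the scalar product of
`n` with `q - p` vanish at `p`. Their derivatives along `v` are, up to the positive factor `δ²`,
`-C·D` and `C·|v|²`, where `D = 3f₂₁² - f₀₂f₄₀`. For `D > 0` these have opposite signs, so `n`
points to the hyperbolic side exactly when it points away from `p`. -/
theorem PosGodron.isNegativeGodron {f : Plane → ℝ} (hf : ContDiff ℝ ∞ f) {p : Plane}
    (h : PosGodron f p) : IsNegativeGodron f p := by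
  obtain ⟨v, w, hg, hli, hD⟩ := h
  refine ⟨⟨v, w, hg, hli, hD.ne'⟩, ?_⟩
  obtain ⟨hv0, huniq, hhess, hreg, htan⟩ := hg
  rw [linearIndependent_pair_iff] at hli
  set δ := v.1 * w.2 - v.2 * w.1 with hδ
  have hA : ContDiff ℝ ∞ (dd v (dd v f)) := dd_contDiff (dd_contDiff hf _) _
  have hB : ContDiff ℝ ∞ (dd v (dd w f)) := dd_contDiff (dd_contDiff hf _) _
  have hC : ContDiff ℝ ∞ (dd w (dd w f)) := dd_contDiff (dd_contDiff hf _) _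
  set A := dd v (dd v f) with eA
  set B := dd v (dd w f) with eB
  set C := dd w (dd w f) with eC
  have quad : ∀ (x y : ℝ) q, ddPow 2 (x • v + y • w) f q = x ^ 2 * A q + 2 * x * y * B q + y ^ 2 * C q := by
    intro x y q
    rw [ddPow_two hf, eA, eB, eC, dd_two hf, dd_two hf, dd_two hf]
    simp; ring
  have hhAC : ∀ q, δ ^ 2 * hess f q = A q * C q - B q ^ 2 := by
    intro q
    rw [hess_eq, eA, eB, eC, dd_two hf, dd_two hf, dd_two hf, hδ]; ring
  have A0 : A p = 0 := by
    have := (huniq v).2 ⟨1, by simp⟩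
    exact this
  have C0 : C p ≠ 0 := by
    intro h0
    obtain ⟨c, hc⟩ := (huniq w).1 h0
    apply hli; rw [hδ, hc]; simp; ring
  have B0 : B p = 0 := by
    have := hhAC p
    rw [hhess, A0] at this
    have : B p ^ 2 = 0 := by linarith
    exact pow_eq_zero_iff (two_ne_zero) |>.mp this
  -- the derivative of the Hessian along the field `C v - B w`
  let n : Plane → Plane := fun q => C q • v - B q • w
  let k : Plane → ℝ := fun q => δ ^ 2 * fderiv ℝ (hess f) q (n q)
  have hk : ∀ q u, δ ^ 2 * fderiv ℝ (hess f) q u = A q * dd u C q + C q * dd u A q - 2 * B q * dd u B q := by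
    intro q u
    have e : hess f = fun q => (1 / δ ^ 2) * (A q * C q) + (-(1 / δ ^ 2)) * (B q * B q) := by
      funext q
      have := hhAC q
      field_simp
      linarith
    have e2 : fderiv ℝ (hess f) q u = dd u (hess f) q := rfl
    rw [e2, e, dd_lin (hA.mul hC) (hB.mul hB), dd_mul hA hC, dd_mul hB hB]
    field_simp; ring
  have ddlin : ∀ (g : Plane → ℝ) (x y : ℝ) q, dd (x • v - y • w) g q = x * dd v g q - y * dd w g q := by
    intro g x y q; unfold dd; simp
  have hkq : k = fun q => A q * (C q * dd v C q - B q * dd w C q)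
      + (C q * (C q * dd v A q - B q * dd w A q) + (-2) * (B q * (C q * dd v B q - B q * dd w B q))) := by
    funext q
    change δ ^ 2 * fderiv ℝ (hess f) q (n q) = _
    rw [hk, ddlin, ddlin, ddlin]; ring
  let m : Plane → ℝ := fun q => (n q).1 * (q.1 - p.1) + (n q).2 * (q.2 - p.2)
  have ksm : ContDiff ℝ ∞ k := by
    rw [hkq]
    have := dd_contDiff hA v
    have := dd_contDiff hA w
    have := dd_contDiff hB v
    have := dd_contDiff hB w
    have := dd_contDiff hC v
    have := dd_contDiff hC w
    fun_prop
  have msm : ContDiff ℝ ∞ m := by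
    simp only [m, n]
    simp only [Prod.fst_sub, Prod.snd_sub, Prod.smul_fst, Prod.smul_snd, smul_eq_mul]
    fun_prop
  have tri : dd v A p = 0 := by
    have := hk p v
    rw [htan, A0, B0] at this
    simp only [mul_zero, zero_mul, zero_add, sub_zero] at this
    exact (mul_eq_zero.mp this.symm).resolve_left C0
  have AwBv : dd w A p = dd v B p := by
    rw [eA, eB, dd_comm (dd_contDiff hf v) w v, dd_comm hf w v]
  set D := 3 * (dd v (dd v (dd w f)) p) ^ 2 - ddPow 2 w f p * ddPow 4 v f p with hDdef
  -- `A` and `B` vanish at `p`, so does `∂ᵥA`, and `∂_w A = ∂ᵥB`. What survives is `C² ∂ᵥ²A - 3C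
  -- (∂ᵥB)²`.
  have dk : fderiv ℝ k p v = - C p * D := by
    change dd v k p = _
    have s1 := dd_contDiff hA v
    have s2 := dd_contDiff hA w
    have s3 := dd_contDiff hB v
    have s4 := dd_contDiff hB w
    have s5 := dd_contDiff hC v
    have s6 := dd_contDiff hC w
    have i1 : ContDiff ℝ ∞ (fun q => C q * dd v C q - B q * dd w C q) := by fun_prop
    have i2 : ContDiff ℝ ∞ (fun q => C q * dd v A q - B q * dd w A q) := by fun_prop
    have i3 : ContDiff ℝ ∞ (fun q => C q * dd v B q - B q * dd w B q) := by fun_prop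
    have e := dd_lin₃ (v := v) (hA.mul i1) (hC.mul i2) (hB.mul i3) 1 1 (-2)
    have e' := congrFun e p
    have : k = fun q => 1 * (A q * (C q * dd v C q - B q * dd w C q))
      + 1 * (C q * (C q * dd v A q - B q * dd w A q)) + (-2) * (B q * (C q * dd v B q - B q * dd w B q)) := by
      rw [hkq]; funext q; ring
    rw [this]; refine e'.trans ?_
    rw [dd_mul hA i1, dd_mul hC i2, dd_mul hB i3]
    have j2 : dd v (fun q => C q * dd v A q - B q * dd w A q) p = C p * dd v (dd v A) p - dd v B p * dd w A p := by
      have : (fun q => C q * dd v A q - B q * dd w A q) = fun q => 1 * (C q * dd v A q) + (-1) * (B q * dd w A q) := by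
        funext q; ring
      rw [this, dd_lin (hC.mul s1) (hB.mul s2), dd_mul hC s1, dd_mul hB s2]
      simp only [tri, B0]; ring
    have q4 : dd v (dd v A) p = ddPow 4 v f p := rfl
    have qC : ddPow 2 w f p = C p := rfl
    simp only [j2, A0, B0, tri, AwBv]
    rw [hDdef, q4, qC, eB]; ring
  have n0 : n p = C p • v := by simp [n, B0]
  have dm : fderiv ℝ m p v = C p * (v.1 ^ 2 + v.2 ^ 2) := by
    have h1 : ContDiff ℝ ∞ (fun q : Plane => (n q).1) := by
      simp only [n, Prod.fst_sub, Prod.smul_fst, smul_eq_mul]; fun_prop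
    have h2 : ContDiff ℝ ∞ (fun q : Plane => (n q).2) := by
      simp only [n, Prod.snd_sub, Prod.smul_snd, smul_eq_mul]; fun_prop
    have h3 : ContDiff ℝ ∞ (fun q : Plane => q.1 - p.1) := by fun_prop
    have h4 : ContDiff ℝ ∞ (fun q : Plane => q.2 - p.2) := by fun_prop
    have : m = fun q => 1 * ((n q).1 * (q.1 - p.1)) + 1 * ((n q).2 * (q.2 - p.2)) := by
      funext q; simp [m]
    change dd v m p = _
    rw [this, dd_lin (h1.mul h3) (h2.mul h4), dd_mul h1 h3, dd_mul h2 h4]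
    have g1 : dd v (fun q : Plane => q.1 - p.1) p = v.1 := by
      unfold dd; rw [fderiv_sub_const]; exact congrArg (fun L : Plane →L[ℝ] ℝ => L v) fderiv_fst
    have g2 : dd v (fun q : Plane => q.2 - p.2) p = v.2 := by
      unfold dd; rw [fderiv_sub_const]; exact congrArg (fun L : Plane →L[ℝ] ℝ => L v) fderiv_snd
    simp only [g1, g2, n0, sub_self]
    simp; ring
  have hvv : 0 < v.1 ^ 2 + v.2 ^ 2 := by
    rcases eq_or_ne v.1 0 with h1 | h1
    · have : v.2 ≠ 0 := fun h2 => hv0 (Prod.ext h1 h2)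
      positivity
    · positivity
  have key := eventually_mul_neg_on_curve (hasFDerivAt_of_contDiff (hess_contDiff hf) p)
    (hasFDerivAt_of_contDiff ksm p) (hasFDerivAt_of_contDiff msm p) hhess
    (by simp [k, n0, htan]) (by simp [m]) htan hreg
    (by rw [dk, dm]
        have : -C p * D * (C p * (v.1 ^ 2 + v.2 ^ 2)) = - (C p ^ 2 * D * (v.1 ^ 2 + v.2 ^ 2)) := by ring
        rw [this, neg_lt_zero]
        have : 0 < C p ^ 2 := by positivity
        positivity)
  have hCn : ∀ᶠ q in 𝓝[≠] p, C q ≠ 0 :=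
    (hC.continuous.continuousAt.eventually_ne C0).filter_mono nhdsWithin_le_nhds
  filter_upwards [key, hCn] with q hq hCq hz u hu hqu
  have hkm := hq hz
  -- `u` is a multiple of `n q`
  have hu' : ∃ c : ℝ, c ≠ 0 ∧ u = c • n q := by
    set x := (u.1 * w.2 - u.2 * w.1) / δ with hx
    set y := (v.1 * u.2 - v.2 * u.1) / δ with hy
    have dec : u = x • v + y • w := by
      ext
      · simp only [Prod.fst_add, Prod.smul_fst, smul_eq_mul, hx, hy]; field_simp; rw [hδ]; ring
      · simp only [Prod.snd_add, Prod.smul_snd, smul_eq_mul, hx, hy]; field_simp; rw [hδ]; ring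
    rw [dec, quad] at hqu
    have h1 := hhAC q
    rw [hz, mul_zero] at h1
    -- When `AC = B²`, the form multiplied by `C` is this perfect square.
    have h2 : (x * B q + y * C q) ^ 2 = 0 := by linear_combination C q * hqu + x ^ 2 * h1
    have h3 : x * B q + y * C q = 0 := pow_eq_zero_iff two_ne_zero |>.mp h2
    have hyx : y = - (x * B q / C q) := by field_simp; linarith
    refine ⟨x / C q, ?_, ?_⟩
    · intro hc
      have : x = 0 := by simpa [hCq] using hc
      apply hu; rw [dec, hyx, this]; simp
    · rw [dec]; simp only [n, smul_sub, smul_smul]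
      rw [hyx]
      have e1 : x / C q * C q = x := by field_simp
      have e2 : x / C q * B q = x * B q / C q := by ring
      rw [e1, e2, neg_smul, sub_eq_add_neg]
  obtain ⟨c, hc, rfl⟩ := hu'
  have hδ2 : 0 < δ ^ 2 := by positivity
  have e1 : δ ^ 2 * fderiv ℝ (hess f) q (c • n q) = c * k q := by
    simp only [map_smul, smul_eq_mul, k]; ring
  constructor
  · intro h0
    rw [h0, mul_zero] at e1
    have : k q = 0 := (mul_eq_zero.mp e1.symm).resolve_left hc
    rw [this, zero_mul] at hkm; exact lt_irrefl _ hkm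
  · intro hneg
    have h1 : c * k q < 0 := by rw [← e1]; exact mul_neg_of_pos_of_neg hδ2 hneg
    have h2 : (c • n q).1 * (q.1 - p.1) + (c • n q).2 * (q.2 - p.2) = c * m q := by
      simp only [Prod.smul_fst, Prod.smul_snd, smul_eq_mul, m]; ring
    rw [h2]
    have h3 : 0 < (c * k q) * (k q * m q) := mul_pos_of_neg_of_neg h1 hkm
    have hk0 : k q ≠ 0 := by rintro e; simp [e] at hkm
    have h4 : (c * k q) * (k q * m q) = k q ^ 2 * (c * m q) := by ring
    rw [h4] at h3
    exact pos_of_mul_pos_right h3 (by positivity)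

end NegativeGodron

/-! ### Transversality criteria for hyperbonodes and ellipnodes -/

section NodeCriteria

variable {f : Plane → ℝ}

theorem linearIndependent_of_det {R I : Plane →L[ℝ] ℝ} (u w : Plane)
    (h : R u * I w - R w * I u ≠ 0) : LinearIndependent ℝ ![R, I] := by
  rw [LinearIndependent.pair_iff]
  intro s t hst
  have e1 : s * R u + t * I u = 0 := by simpa using congrArg (fun L : Plane →L[ℝ] ℝ => L u) hst
  have e2 : s * R w + t * I w = 0 := by simpa using congrArg (fun L : Plane →L[ℝ] ℝ => L w) hst
  constructor
  · apply (mul_eq_zero.mp (?_ : s * (R u * I w - R w * I u) = 0)).resolve_right h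
    linear_combination I w * e1 - I u * e2
  · apply (mul_eq_zero.mp (?_ : t * (R u * I w - R w * I u) = 0)).resolve_right h
    linear_combination R u * e2 - R w * e1

/-- An asymptotic direction `u` at `p`, not tangent to the conjugate of `w`, extends to a smooth
field of asymptotic directions. -/
theorem exists_asymptotic_field (hf : ContDiff ℝ ∞ f) {p u w : Plane}
    (hu : ddPow 2 u f p = 0) (hB : dd u (dd w f) p ≠ 0) :
    ∃ a : Plane → Plane, ContDiffAt ℝ ∞ a p ∧ a p = u ∧ (∀ᶠ q in 𝓝 p, ddPow 2 (a q) f q = 0) ∧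
      ∀ d, 2 * dd u (dd w f) p * fderiv ℝ (fun q => ddPow 3 (a q) f q) p d =
        2 * dd u (dd w f) p * dd d (ddPow 3 u f) p
          - 3 * dd u (dd u (dd w f)) p * dd d (ddPow 2 u f) p := by
  have sA : ContDiff ℝ ∞ (dd u (dd u f)) := dd_contDiff (dd_contDiff hf _) _
  have sB : ContDiff ℝ ∞ (dd u (dd w f)) := dd_contDiff (dd_contDiff hf _) _
  have sC : ContDiff ℝ ∞ (dd w (dd w f)) := dd_contDiff (dd_contDiff hf _) _
  set A := dd u (dd u f) with eA
  set B := dd u (dd w f) with eB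
  set C := dd w (dd w f) with eC
  have eA2 : ddPow 2 u f = A := rfl
  rw [eA2] at hu
  rw [eA2]
  -- The vector `u + δw` is asymptotic when `A + 2Bδ + Cδ² = 0`. The small root is written with `A`
  -- in the numerator, so that `C` is allowed to vanish.
  let S : Plane → ℝ := fun q => 1 - A q * C q / B q ^ 2
  let δ : Plane → ℝ := fun q => - A q / (B q * (1 + √(S q)))
  have hSp : S p = 1 := by simp [S, hu]
  have hSd : ContDiffAt ℝ ∞ S p :=
    contDiffAt_const.sub ((sA.contDiffAt.mul sC.contDiffAt).div (sB.contDiffAt.pow 2) (by positivity))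
  have hδd : ContDiffAt ℝ ∞ δ p := by
    refine sA.contDiffAt.neg.div (sB.contDiffAt.mul (contDiffAt_const.add
      (hSd.sqrt (by simp [hSp])))) ?_
    rw [hSp]; simp [hB]
  have hδp : δ p = 0 := by simp [δ, hu]
  have evB : ∀ᶠ q in 𝓝 p, B q ≠ 0 := sB.continuous.continuousAt.eventually_ne hB
  have evS : ∀ᶠ q in 𝓝 p, 0 < S q :=
    hSd.continuousAt.eventually (lt_mem_nhds (by rw [hSp]; exact one_pos))
  have ev : ∀ᶠ q in 𝓝 p, A q + 2 * B q * δ q + C q * δ q ^ 2 = 0 := by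
    filter_upwards [evB, evS] with q hb hs
    have h1 : √(S q) ^ 2 = 1 - A q * C q / B q ^ 2 := Real.sq_sqrt hs.le
    have h2 : 0 ≤ √(S q) := Real.sqrt_nonneg _
    simp only [δ]
    set s := √(S q)
    have h3 : 1 + s ≠ 0 := by positivity
    have h4 : s ^ 2 * B q ^ 2 = B q ^ 2 - A q * C q := by rw [h1]; field_simp
    field_simp
    linear_combination A q * h4
  refine ⟨fun q => u + δ q • w, contDiffAt_const.add (hδd.smul contDiffAt_const), by simp [hδp],
    ?_, ?_⟩
  · filter_upwards [ev] with q hq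
    rw [← hq, ddPow_two hf, eA, eB, eC, dd_two hf, dd_two hf, dd_two hf]
    simp; ring
  · intro d
    have s0 : ContDiff ℝ ∞ (dd u (dd u (dd u f))) := dd_contDiff (dd_contDiff (dd_contDiff hf _) _) _
    have s1 : ContDiff ℝ ∞ (dd u (dd u (dd w f))) := dd_contDiff (dd_contDiff (dd_contDiff hf _) _) _
    have s2 : ContDiff ℝ ∞ (dd u (dd w (dd w f))) := dd_contDiff (dd_contDiff (dd_contDiff hf _) _) _
    have s3 : ContDiff ℝ ∞ (dd w (dd w (dd w f))) := dd_contDiff (dd_contDiff (dd_contDiff hf _) _) _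
    have e3 : ddPow 3 u f = dd u (dd u (dd u f)) := rfl
    rw [e3]
    have hcub : (fun q => ddPow 3 (u + δ q • w) f q) = fun q => dd u (dd u (dd u f)) q
        + 3 * (δ q * dd u (dd u (dd w f)) q) + 3 * (δ q ^ 2 * dd u (dd w (dd w f)) q)
        + δ q ^ 3 * dd w (dd w (dd w f)) q := by
      funext q
      rw [ddPow_three hf, dd_three hf, dd_three hf, dd_three hf, dd_three hf]
      simp; ring
    have hD := (hδd.differentiableAt (by simp)).hasFDerivAt
    set c0 := dd u (dd u (dd u f))
    set c1 := dd u (dd u (dd w f))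
    set c2 := dd u (dd w (dd w f))
    set c3 := dd w (dd w (dd w f))
    have d1 := (((hasFDerivAt_of_contDiff s0 p).add
      ((hD.mul (hasFDerivAt_of_contDiff s1 p)).const_mul 3)).add
      (((hD.pow 2).mul (hasFDerivAt_of_contDiff s2 p)).const_mul 3)).add
      ((hD.pow 3).mul (hasFDerivAt_of_contDiff s3 p))
    have d2 := ((hasFDerivAt_of_contDiff sA p).add
      (((hasFDerivAt_of_contDiff sB p).const_mul 2).mul hD)).add
      ((hasFDerivAt_of_contDiff sC p).mul (hD.pow 2))
    have d3 : HasFDerivAt (fun _ : Plane => (0 : ℝ)) _ p :=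
      HasFDerivAt.congr_of_eventuallyEq d2 (by
        filter_upwards [ev] with q hq; exact hq.symm)
    have d4 := congrArg (fun L : Plane →L[ℝ] ℝ => L d) (d3.unique (hasFDerivAt_const _ _))
    have d5 : HasFDerivAt (fun q => ddPow 3 (u + δ q • w) f q) _ p :=
      HasFDerivAt.congr_of_eventuallyEq d1 (Eventually.of_forall fun q => congrFun hcub q)
    rw [d5.fderiv]
    simp [hδp] at d4 ⊢
    unfold dd
    -- As `δ p = 0`, the derivative of the cubic form along the field is `c₀' + 3c₁δ'`, and `d4` is
    -- the differentiated equation `A' + 2Bδ' = 0`.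
    linear_combination 3 * c1 p * d4

/-- A point with two distinct asymptotic directions `u`, `w`, both having 4-point contact, is a
hyperbonode as soon as an explicit determinant is nonzero. -/
theorem isHyperbonode_of_det (hf : ContDiff ℝ ∞ f) {p u w : Plane}
    (hli : LinearIndependent ℝ ![u, w])
    (hu : ddPow 2 u f p = 0) (hw : ddPow 2 w f p = 0) (hB : dd u (dd w f) p ≠ 0)
    (hu3 : ddPow 3 u f p = 0) (hw3 : ddPow 3 w f p = 0)
    (hdet : (2 * dd u (dd w f) p * dd u (ddPow 3 u f) p
          - 3 * dd u (dd u (dd w f)) p * dd u (ddPow 2 u f) p) *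
        (2 * dd u (dd w f) p * dd w (ddPow 3 w f) p
          - 3 * dd w (dd w (dd u f)) p * dd w (ddPow 2 w f) p) -
        (2 * dd u (dd w f) p * dd w (ddPow 3 u f) p
          - 3 * dd u (dd u (dd w f)) p * dd w (ddPow 2 u f) p) *
        (2 * dd u (dd w f) p * dd u (ddPow 3 w f) p
          - 3 * dd w (dd w (dd u f)) p * dd u (ddPow 2 w f) p) ≠ 0) :
    IsHyperbonode f p := by
  have hcomm : dd w (dd u f) p = dd u (dd w f) p := by rw [dd_comm hf]
  obtain ⟨a, ha, hap, hqa, hda⟩ := exists_asymptotic_field hf hu hB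
  obtain ⟨b, hb, hbp, hqb, hdb⟩ := exists_asymptotic_field hf hw (hcomm.symm ▸ hB : dd w (dd u f) p ≠ 0)
  refine ⟨?_, a, b, ha, hb, by rwa [hap, hbp], hqa.and hqb, by rwa [hap], by rwa [hbp], ?_⟩
  · have hδ := (linearIndependent_pair_iff u w).1 hli
    have : (u.1 * w.2 - u.2 * w.1) ^ 2 * hess f p = ddPow 2 u f p * ddPow 2 w f p - dd u (dd w f) p ^ 2 := by
      rw [hess_eq, ddPow_two hf, ddPow_two hf, dd_two hf]; ring
    rw [hu, hw] at this
    have h1 : 0 < (u.1 * w.2 - u.2 * w.1) ^ 2 := by positivity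
    have h2 : 0 < dd u (dd w f) p ^ 2 := by positivity
    by_contra! hc
    nlinarith [mul_nonneg h1.le hc]
  · rw [hcomm] at hdb
    -- The determinant in the hypothesis is that of the two differentials evaluated on `u, w`, each
    -- differential multiplied by `2 ∂ᵤ∂_w f`.
    refine linearIndependent_of_det u w ?_
    rw [← hda, ← hda, ← hdb, ← hdb] at hdet
    intro h0
    apply hdet
    linear_combination (2 * dd u (dd w f) p) ^ 2 * h0

/-- Real part of the derivative along `d` of the cubic form at the complex asymptotic direction
`(x + i y, 1)`, multiplied by `2 f_xx y`. -/
noncomputable def ellRe (f : Plane → ℝ) (p : Plane) (x y : ℝ) (d : Plane) : ℝ :=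
  2 * jet 2 0 f p * y * ((x ^ 3 - 3 * x * y ^ 2) * dd d (jet 3 0 f) p
    + 3 * (x ^ 2 - y ^ 2) * dd d (jet 2 1 f) p + 3 * x * dd d (jet 1 2 f) p + dd d (jet 0 3 f) p)
  - 3 * (((x ^ 2 - y ^ 2) * jet 3 0 f p + 2 * x * jet 2 1 f p + jet 1 2 f p) *
      (2 * x * y * dd d (jet 2 0 f) p + 2 * y * dd d (jet 1 1 f) p)
    + (2 * x * y * jet 3 0 f p + 2 * y * jet 2 1 f p) *
      ((x ^ 2 - y ^ 2) * dd d (jet 2 0 f) p + 2 * x * dd d (jet 1 1 f) p + dd d (jet 0 2 f) p))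

/-- Imaginary part of the derivative along `d` of the cubic form at the complex asymptotic direction
`(x + i y, 1)`, multiplied by `2 f_xx y`. -/
noncomputable def ellIm (f : Plane → ℝ) (p : Plane) (x y : ℝ) (d : Plane) : ℝ :=
  2 * jet 2 0 f p * y * ((3 * x ^ 2 * y - y ^ 3) * dd d (jet 3 0 f) p
    + 6 * x * y * dd d (jet 2 1 f) p + 3 * y * dd d (jet 1 2 f) p)
  + 3 * (((x ^ 2 - y ^ 2) * jet 3 0 f p + 2 * x * jet 2 1 f p + jet 1 2 f p) *
      ((x ^ 2 - y ^ 2) * dd d (jet 2 0 f) p + 2 * x * dd d (jet 1 1 f) p + dd d (jet 0 2 f) p)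
    - (2 * x * y * jet 3 0 f p + 2 * y * jet 2 1 f p) *
      (2 * x * y * dd d (jet 2 0 f) p + 2 * y * dd d (jet 1 1 f) p))

/-- The complex asymptotic direction `(x + iy, 1)` at nearby points has `x = -f₁₁/f₂₀` and `f₂₀²y² =
hess`, so `(x, 1)` and `(y, 0)` serve as the two smooth fields. Differentiating these two equations
gives the derivatives of `x` and `y`. The factor `2f₂₀y` in `ellRe` and `ellIm` clears the
denominators. -/
theorem isEllipnode_of_det (hf : ContDiff ℝ ∞ f) {p : Plane} {x₀ y₀ : ℝ}
    (h20 : jet 2 0 f p ≠ 0) (hy : y₀ ≠ 0) (hx₀ : jet 2 0 f p * x₀ + jet 1 1 f p = 0)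
    (hy₀ : jet 2 0 f p ^ 2 * y₀ ^ 2 = hess f p)
    (hre : (x₀ ^ 3 - 3 * x₀ * y₀ ^ 2) * jet 3 0 f p + 3 * (x₀ ^ 2 - y₀ ^ 2) * jet 2 1 f p
      + 3 * x₀ * jet 1 2 f p + jet 0 3 f p = 0)
    (him : (3 * x₀ ^ 2 * y₀ - y₀ ^ 3) * jet 3 0 f p + 6 * x₀ * y₀ * jet 2 1 f p
      + 3 * y₀ * jet 1 2 f p = 0)
    (hdet : ellRe f p x₀ y₀ (1, 0) * ellIm f p x₀ y₀ (0, 1)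
      - ellRe f p x₀ y₀ (0, 1) * ellIm f p x₀ y₀ (1, 0) ≠ 0) : IsEllipnode f p := by
  have hh : 0 < hess f p := by rw [← hy₀]; positivity
  have sm := fun i j => jet_contDiff hf i j
  let x : Plane → ℝ := fun q => - jet 1 1 f q / jet 2 0 f q
  let S : Plane → ℝ := fun q => hess f q / (jet 2 0 f q ^ 2 * y₀ ^ 2)
  -- Normalised by `y₀`, so that the branch through `y₀` is continued whatever its sign.
  let y : Plane → ℝ := fun q => y₀ * √(S q)
  have hSp : S p = 1 := by simp only [S]; rw [hy₀]; field_simp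
  have hxp : x p = x₀ := by simp only [x]; field_simp; linarith
  have hyp : y p = y₀ := by simp [y, hSp]
  have hxd : ContDiffAt ℝ ∞ x p := (sm 1 1).contDiffAt.neg.div (sm 2 0).contDiffAt h20
  have hSd : ContDiffAt ℝ ∞ S p :=
    (hess_contDiff hf).contDiffAt.div (((sm 2 0).contDiffAt.pow 2).mul contDiffAt_const)
      (by positivity)
  have hyd : ContDiffAt ℝ ∞ y p := contDiffAt_const.mul (hSd.sqrt (by simp [hSp]))
  have ev20 : ∀ᶠ q in 𝓝 p, jet 2 0 f q ≠ 0 := (sm 2 0).continuous.continuousAt.eventually_ne h20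
  have evh : ∀ᶠ q in 𝓝 p, 0 < hess f q :=
    (hess_contDiff hf).continuous.continuousAt.eventually (lt_mem_nhds hh)
  have evx : ∀ᶠ q in 𝓝 p, jet 2 0 f q * x q + jet 1 1 f q = 0 := by
    filter_upwards [ev20] with q h; simp only [x]; field_simp; ring
  have evy : ∀ᶠ q in 𝓝 p, jet 2 0 f q ^ 2 * y q ^ 2 - (jet 2 0 f q * jet 0 2 f q - jet 1 1 f q ^ 2) = 0 := by
    filter_upwards [ev20, evh] with q h h'
    simp only [y]; rw [mul_pow, Real.sq_sqrt (by positivity), ← hess_eq]; simp only [S]; field_simp; ring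
  refine ⟨hh, fun q => (x q, 1), fun q => (y q, 0), hxd.prodMk contDiffAt_const,
    hyd.prodMk contDiffAt_const, ?_, ?_, ?_, ?_, ?_⟩
  · rw [linearIndependent_pair_iff]; simp [hyp, hy]
  · filter_upwards [ev20, evx, evy] with q h h1 h2
    have h02 : jet 0 2 f q = jet 2 0 f q * (x q ^ 2 + y q ^ 2) := by
      apply mul_left_cancel₀ h
      linear_combination -h2 + (jet 1 1 f q - jet 2 0 f q * x q) * h1
    constructor
    · rw [ddPow_two hf, ddPow_two hf, h02]; simp; linear_combination 2 * x q * h1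
    · rw [dd_two hf]; simp; linear_combination y q * h1
  · change reCube (x p, 1) (y p, 0) f p = 0
    unfold reCube; rw [ddPow_three hf, dd_three hf, hxp, hyp]; simp; linear_combination hre
  · change imCube (x p, 1) (y p, 0) f p = 0
    unfold imCube; rw [ddPow_three hf, dd_three hf, hxp, hyp]; simp; linear_combination him
  · have eR : (fun q => reCube (x q, 1) (y q, 0) f q) = fun q =>
        (x q ^ 3 - 3 * (x q * y q ^ 2)) * jet 3 0 f q + 3 * (x q ^ 2 - y q ^ 2) * jet 2 1 f q
          + 3 * x q * jet 1 2 f q + jet 0 3 f q := by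
      funext q; unfold reCube; rw [ddPow_three hf, dd_three hf]; simp; ring
    have eI : (fun q => imCube (x q, 1) (y q, 0) f q) = fun q =>
        (3 * (x q ^ 2 * y q) - y q ^ 3) * jet 3 0 f q + 6 * (x q * y q) * jet 2 1 f q
          + 3 * y q * jet 1 2 f q := by
      funext q; unfold imCube; rw [ddPow_three hf, dd_three hf]; simp; ring
    have hX := (hxd.differentiableAt (by simp)).hasFDerivAt
    have hY := (hyd.differentiableAt (by simp)).hasFDerivAt
    have hj := fun i j => hasFDerivAt_of_contDiff (sm i j) p
    have dR := ((((hX.pow 3).sub ((hX.mul (hY.pow 2)).const_mul 3)).mul (hj 3 0)).add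
      ((((hX.pow 2).sub (hY.pow 2)).const_mul 3).mul (hj 2 1))).add
      ((hX.const_mul 3).mul (hj 1 2)) |>.add (hj 0 3)
    have dI := (((((hX.pow 2).mul hY).const_mul 3).sub (hY.pow 3)).mul (hj 3 0)).add
      (((hX.mul hY).const_mul 6).mul (hj 2 1)) |>.add ((hY.const_mul 3).mul (hj 1 2))
    have dx := ((hj 2 0).mul hX).add (hj 1 1)
    have dy := (((hj 2 0).pow 2).mul (hY.pow 2)).sub (((hj 2 0).mul (hj 0 2)).sub ((hj 1 1).pow 2))
    have dx0 : HasFDerivAt (fun _ : Plane => (0 : ℝ)) _ p :=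
      HasFDerivAt.congr_of_eventuallyEq dx (by filter_upwards [evx] with q hq; exact hq.symm)
    have dy0 : HasFDerivAt (fun _ : Plane => (0 : ℝ)) _ p :=
      HasFDerivAt.congr_of_eventuallyEq dy (by filter_upwards [evy] with q hq; exact hq.symm)
    have h02 : jet 0 2 f p = jet 2 0 f p * (x₀ ^ 2 + y₀ ^ 2) := by
      apply mul_left_cancel₀ h20
      rw [hess_eq] at hy₀
      linear_combination -hy₀ + (jet 1 1 f p - jet 2 0 f p * x₀) * hx₀
    have h11 : jet 1 1 f p = - (jet 2 0 f p * x₀) := by linarith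
    have kx : ∀ d, jet 2 0 f p * fderiv ℝ x p d
        = - (x₀ * fderiv ℝ (jet 2 0 f) p d + fderiv ℝ (jet 1 1 f) p d) := by
      intro d
      have := congrArg (fun L : Plane →L[ℝ] ℝ => L d) (dx0.unique (hasFDerivAt_const _ _))
      simp [hxp] at this
      linear_combination this
    have ky : ∀ d, 2 * jet 2 0 f p * y₀ * fderiv ℝ y p d = (x₀ ^ 2 - y₀ ^ 2) * fderiv ℝ (jet 2 0 f) p d
        + 2 * x₀ * fderiv ℝ (jet 1 1 f) p d + fderiv ℝ (jet 0 2 f) p d := by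
      intro d
      have := congrArg (fun L : Plane →L[ℝ] ℝ => L d) (dy0.unique (hasFDerivAt_const _ _))
      simp [hyp, h02, h11] at this
      apply mul_left_cancel₀ h20
      linear_combination this
    have vR : ∀ d, 2 * jet 2 0 f p * y₀ * fderiv ℝ (fun q => reCube (x q, 1) (y q, 0) f q) p d
        = ellRe f p x₀ y₀ d := by
      intro d
      have e : HasFDerivAt (fun q => reCube (x q, 1) (y q, 0) f q) _ p :=
        HasFDerivAt.congr_of_eventuallyEq dR (Eventually.of_forall fun q => congrFun eR q)
      rw [e.fderiv]
      simp [hxp, hyp]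
      unfold ellRe dd
      linear_combination (6 * y₀ * (jet 3 0 f p * (x₀ ^ 2 - y₀ ^ 2) + 2 * x₀ * jet 2 1 f p + jet 1 2 f p)) * kx d
        - 3 * (2 * jet 3 0 f p * x₀ * y₀ + 2 * y₀ * jet 2 1 f p) * ky d
    have vI : ∀ d, 2 * jet 2 0 f p * y₀ * fderiv ℝ (fun q => imCube (x q, 1) (y q, 0) f q) p d
        = ellIm f p x₀ y₀ d := by
      intro d
      have e : HasFDerivAt (fun q => imCube (x q, 1) (y q, 0) f q) _ p :=
        HasFDerivAt.congr_of_eventuallyEq dI (Eventually.of_forall fun q => congrFun eI q)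
      rw [e.fderiv]
      simp [hxp, hyp]
      unfold ellIm dd
      linear_combination (6 * y₀ * (2 * jet 3 0 f p * x₀ * y₀ + 2 * y₀ * jet 2 1 f p)) * kx d
        + 3 * (jet 3 0 f p * (x₀ ^ 2 - y₀ ^ 2) + 2 * x₀ * jet 2 1 f p + jet 1 2 f p) * ky d
    refine linearIndependent_of_det (1, 0) (0, 1) ?_
    rw [← vR, ← vR, ← vI, ← vI] at hdet
    intro h0
    apply hdet
    linear_combination (2 * jet 2 0 f p * y₀) ^ 2 * h0

end NodeCriteria

/-! ### Convexity and the co-orientation of elliptic points -/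

section Convexity

variable {f : Plane → ℝ}

theorem quad_pos {a b c : ℝ} (ha : 0 < a) (h : 0 < a * c - b ^ 2) {v : Plane} (hv : v ≠ 0) :
    0 < v.1 ^ 2 * a + 2 * v.1 * v.2 * b + v.2 ^ 2 * c := by
  have e : a * (v.1 ^ 2 * a + 2 * v.1 * v.2 * b + v.2 ^ 2 * c)
      = (a * v.1 + b * v.2) ^ 2 + (a * c - b ^ 2) * v.2 ^ 2 := by ring
  rcases eq_or_ne v.2 0 with h2 | h2
  · have h1 : v.1 ≠ 0 := fun h1 => hv (Prod.ext h1 h2)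
    rw [h2]; have := mul_pos (pow_pos (abs_pos.mpr h1) 2) ha
    rw [sq_abs] at this; linarith
  · have : 0 < a * (v.1 ^ 2 * a + 2 * v.1 * v.2 * b + v.2 ^ 2 * c) := by rw [e]; positivity
    exact pos_of_mul_pos_right this ha.le

/-- A function with positive definite second differential lies strictly above its tangent planes. -/
theorem tangent_lt_of_posDef (hf : ContDiff ℝ ∞ f) {S : Set Plane} (hS : Convex ℝ S)
    (hpos : ∀ q ∈ S, ∀ v : Plane, v ≠ 0 → 0 < ddPow 2 v f q) {p q : Plane} (hp : p ∈ S) (hq : q ∈ S)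
    (hne : q ≠ p) : f p + fderiv ℝ f p (q - p) < f q := by
  set d := q - p with hd
  have hd0 : d ≠ 0 := sub_ne_zero.mpr hne
  have hline : ∀ t : ℝ, HasDerivAt (fun t : ℝ => p + t • d) d t := by
    intro t
    simpa using ((hasDerivAt_id t).smul_const d).const_add p
  have hder : ∀ (g : Plane → ℝ), ContDiff ℝ ∞ g → ∀ t : ℝ,
      HasDerivAt (fun t : ℝ => g (p + t • d)) (dd d g (p + t • d)) t := by
    intro g hg t
    exact (hasFDerivAt_of_contDiff hg (p + t • d)).comp_hasDerivAt t (hline t)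
  have h1 := hder f hf
  have h2 := hder (dd d f) (dd_contDiff hf d)
  have hmem : ∀ t ∈ Icc (0 : ℝ) 1, p + t • d ∈ S := by
    intro t ht
    have := hS.add_smul_sub_mem hp hq ht
    exact this
  have hmono : StrictMonoOn (fun t : ℝ => dd d f (p + t • d)) (Icc 0 1) := by
    apply strictMonoOn_of_deriv_pos (convex_Icc 0 1)
    · exact fun t _ => (h2 t).continuousAt.continuousWithinAt
    · intro t ht
      rw [interior_Icc] at ht
      rw [(h2 t).deriv]
      exact hpos _ (hmem t (Ioo_subset_Icc_self ht)) d hd0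
  -- The increment of `f` over the segment is its derivative at an interior point, which exceeds the
  -- derivative at `p` by strict monotonicity.
  obtain ⟨c, hc, hcd⟩ := exists_hasDerivAt_eq_slope (fun t : ℝ => f (p + t • d)) _ (zero_lt_one)
    (fun t _ => (h1 t).continuousAt.continuousWithinAt) (fun t _ => h1 t)
  have := hmono (left_mem_Icc.mpr zero_le_one) (Ioo_subset_Icc_self hc) hc.1
  simp only [zero_smul, add_zero] at this
  rw [hcd] at this
  simp only [one_smul, zero_smul, add_zero, sub_zero, div_one] at this
  have e : p + d = q := by rw [hd]; abel
  rw [e] at this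
  have e2 : dd d f p = fderiv ℝ f p d := rfl
  rw [e2] at this
  linarith

theorem eventually_tangent_lt (hf : ContDiff ℝ ∞ f) {p : Plane} (h1 : 0 < jet 2 0 f p)
    (h2 : 0 < hess f p) : ∀ᶠ q in 𝓝 p, q ≠ p → f p + fderiv ℝ f p (q - p) < f q := by
  have e1 : ∀ᶠ q in 𝓝 p, 0 < jet 2 0 f q :=
    (jet_contDiff hf 2 0).continuous.continuousAt.eventually (lt_mem_nhds h1)
  have e2 : ∀ᶠ q in 𝓝 p, 0 < hess f q :=
    (hess_contDiff hf).continuous.continuousAt.eventually (lt_mem_nhds h2)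
  obtain ⟨r, hr, hball⟩ := Metric.eventually_nhds_iff_ball.mp (e1.and e2)
  filter_upwards [Metric.ball_mem_nhds p hr] with q hq hne
  refine tangent_lt_of_posDef hf (convex_ball p r) ?_ (Metric.mem_ball_self hr) hq hne
  intro q hq v hv
  rw [ddPow_two hf]
  exact quad_pos (hball q hq).1 (hball q hq).2 hv

theorem jet_neg (f : Plane → ℝ) (i j : ℕ) (p : Plane) :
    jet i j (fun q => - f q) p = - jet i j f p := by
  have key : ∀ v (n : ℕ) (g : Plane → ℝ), (dd v)^[n] (fun q => - g q) = fun q => - (dd v)^[n] g q := by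
    intro v n
    induction n with
    | zero => intro g; rfl
    | succ n ih =>
      intro g
      rw [Function.iterate_succ_apply, Function.iterate_succ_apply, ← ih]
      congr 1
      funext q; unfold dd; rw [fderiv_fun_neg]; simp
  unfold jet
  rw [key, key]

theorem eventually_lt_tangent (hf : ContDiff ℝ ∞ f) {p : Plane} (h1 : jet 2 0 f p < 0)
    (h2 : 0 < hess f p) : ∀ᶠ q in 𝓝 p, q ≠ p → f q < f p + fderiv ℝ f p (q - p) := by
  have := eventually_tangent_lt (f := fun q => - f q) (p := p) hf.neg
    (by rw [jet_neg]; linarith)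
    (by rw [hess_eq, jet_neg, jet_neg, jet_neg]; rw [hess_eq] at h2; linarith)
  filter_upwards [this] with q hq hne
  have h := hq hne
  rw [fderiv_fun_neg] at h
  simp only [neg_apply] at h
  linarith

/-- At an elliptic point `f₂₀ ≠ 0`. If `f₂₀ < 0`, the graph is strictly below the tangent plane in a
punctured neighbourhood, which contradicts even the weak inequality of `CoorientedUp`. -/
theorem coorientedUp_iff (hf : ContDiff ℝ ∞ f) {p : Plane} (hh : 0 < hess f p) :
    CoorientedUp f p ↔ 0 < jet 2 0 f p := by
  constructor
  · intro h
    by_contra! hc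
    have hne : jet 2 0 f p ≠ 0 := by
      intro h0; rw [hess_eq, h0] at hh; nlinarith [sq_nonneg (jet 1 1 f p)]
    have h2 := eventually_lt_tangent hf (lt_of_le_of_ne hc hne) hh
    have h3 : ∀ᶠ q in 𝓝[≠] p, False := by
      rw [eventually_nhdsWithin_iff]
      filter_upwards [h, h2] with q a b hq
      exact absurd (b hq) (not_lt.mpr a)
    rw [eventually_false_iff_eq_bot] at h3
    exact (Module.punctured_nhds_neBot ℝ Plane p).ne h3
  · intro h
    filter_upwards [eventually_tangent_lt hf h hh] with q hq
    rcases eq_or_ne q p with rfl | hne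
    · simp
    · exact (hq hne).le

theorem coorientedDown_iff (hf : ContDiff ℝ ∞ f) {p : Plane} (hh : 0 < hess f p) :
    CoorientedDown f p ↔ jet 2 0 f p < 0 := by
  have e : CoorientedDown f p ↔ CoorientedUp (fun q => - f q) p := by
    unfold CoorientedDown CoorientedUp
    rw [fderiv_fun_neg]
    refine eventually_congr (Eventually.of_forall fun q => ?_)
    simp only [neg_apply]
    constructor <;> intro h <;> linarith
  rw [e, coorientedUp_iff hf.neg, jet_neg]
  · exact neg_pos
  · rw [hess_eq, jet_neg, jet_neg, jet_neg]; rw [hess_eq] at hh; linarith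

end Convexity

/-! ### Smooth implicit functions -/

section ImplicitFunction

/-- Multiplication by a bump function equal to `1` near `x`. It allows locally defined implicit
functions and families to be treated as smooth everywhere. -/
theorem exists_contDiff_eventuallyEq {E F : Type*} [NormedAddCommGroup E] [NormedSpace ℝ E]
    [FiniteDimensional ℝ E] [NormedAddCommGroup F] [NormedSpace ℝ F] {g : E → F} {x : E}
    (h : ∀ᶠ y in 𝓝 x, ContDiffAt ℝ ∞ g y) : ∃ g' : E → F, ContDiff ℝ ∞ g' ∧ g' =ᶠ[𝓝 x] g := by
  obtain ⟨r, hr, hball⟩ := Metric.eventually_nhds_iff_ball.mp h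
  let χ : ContDiffBump x := ⟨r / 4, r / 2, by positivity, by linarith⟩
  refine ⟨fun y => χ y • g y, ?_, ?_⟩
  · rw [contDiff_iff_contDiffAt]
    intro y
    by_cases hy : y ∈ Metric.ball x r
    · exact χ.contDiffAt.smul (hball y hy)
    · have : y ∈ (Metric.closedBall x (r / 2))ᶜ := by
        simp only [mem_compl_iff, Metric.mem_closedBall, not_le]
        simp only [Metric.mem_ball, not_lt] at hy
        linarith
      have ho : (Metric.closedBall x (r / 2))ᶜ ∈ 𝓝 y :=
        Metric.isClosed_closedBall.isOpen_compl.mem_nhds this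
      have : (fun y => χ y • g y) =ᶠ[𝓝 y] fun _ => 0 := by
        filter_upwards [ho] with w hw
        rw [χ.zero_of_le_dist, zero_smul]
        simp only [mem_compl_iff, Metric.mem_closedBall, not_le] at hw
        exact hw.le
      exact contDiffAt_const.congr_of_eventuallyEq this
  · filter_upwards [χ.eventuallyEq_one] with y hy
    rw [hy]; simp

/-- Smoothness of order `∞` at the single point `0` only gives, for each `n`, a neighbourhood on
which the implicit function is `Cⁿ`. A common neighbourhood is obtained because the partial
derivative stays invertible at nearby points of the graph. The function is then cut off to be smooth
everywhere. -/
theorem exists_smooth_implicit {E F : Type*} [NormedAddCommGroup E] [NormedSpace ℝ E]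
    [FiniteDimensional ℝ E] [NormedAddCommGroup F] [NormedSpace ℝ F] [FiniteDimensional ℝ F]
    {R : E × F → F} (hR : ContDiff ℝ ∞ R) {y₀ : F} (h0 : R (0, y₀) = 0)
    (hinj : ∀ y, fderiv ℝ R (0, y₀) (0, y) = 0 → y = 0) :
    ∃ g : E → F, ContDiff ℝ ∞ g ∧ g 0 = y₀ ∧ (∀ᶠ x in 𝓝 0, R (x, g x) = 0) ∧
      ∀ᶠ z in 𝓝 ((0 : E), y₀), R z = 0 → z.2 = g z.1 := by
  have : CompleteSpace E := FiniteDimensional.complete ℝ E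
  have : CompleteSpace F := FiniteDimensional.complete ℝ F
  have hn : (∞ : WithTop ℕ∞) ≠ 0 := by simp
  have hinv : (fderiv ℝ R (0, y₀) ∘L .inr ℝ E F).IsInvertible := by
    set T := fderiv ℝ R (0, y₀) ∘L .inr ℝ E F with hT
    have hi : Function.Injective (T : F →ₗ[ℝ] F) := by
      rw [← LinearMap.ker_eq_bot, LinearMap.ker_eq_bot']
      intro y hy
      exact hinj y (by simpa [hT] using hy)
    let e := LinearEquiv.ofInjectiveEndo (T : F →ₗ[ℝ] F) hi
    refine ⟨e.toContinuousLinearEquiv, ?_⟩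
    ext y; rfl
  have cd : ContDiffAt ℝ ∞ R (0, y₀) := hR.contDiffAt
  set g := cd.implicitFunction hn hinv with hg
  have g0 : g 0 = y₀ := cd.implicitFunction_apply_self hn hinv
  have ev1 : ∀ᶠ x in 𝓝 (0 : E), R (x, g x) = 0 := by
    have := cd.eventually_apply_implicitFunction hn hinv
    rw [h0] at this; exact this
  have ev2 := cd.eventually_apply_eq_iff_implicitFunction hn hinv
  rw [h0] at ev2
  have hgsm : ContDiffAt ℝ ∞ g 0 := cd.contDiffAt_implicitFunction hn hinv
  have hg1 : ContDiffAt ℝ 1 g 0 := hgsm.of_le (by simp)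
  have evg1 : ∀ᶠ x in 𝓝 (0 : E), ContinuousAt g x :=
    (hg1.eventually (by simp)).mono fun x hx => hx.continuousAt
  have evinv : ∀ᶠ x in 𝓝 (0 : E), (fderiv ℝ R (x, g x) ∘L .inr ℝ E F).IsInvertible := by
    have c1 : ContinuousAt (fun x : E => (fderiv ℝ R (x, g x)) ∘L (.inr ℝ E F)) 0 := by
      have : Continuous (fderiv ℝ R) := (hR.fderiv_right (m := ∞) (by simp)).continuous
      have h2 : ContinuousAt (fun x : E => (x, g x)) 0 := continuousAt_id.prodMk hgsm.continuousAt
      have h3 : ContinuousAt (fun x : E => fderiv ℝ R (x, g x)) 0 :=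
        this.continuousAt.comp (f := fun x : E => (x, g x)) h2
      exact h3.clm_comp continuousAt_const
    have ho : IsOpen {L : F →L[ℝ] F | L.IsInvertible} := ContinuousLinearEquiv.isOpen
    exact c1.eventually (ho.mem_nhds (by
      change (fderiv ℝ R (0, g 0) ∘L .inr ℝ E F).IsInvertible
      rw [g0]; exact hinv))
  -- The implicit function theorem applied at `(x, g x)` produces a function smooth at `x`, which
  -- coincides with `g` near `x` by local uniqueness.
  have evsm : ∀ᶠ x in 𝓝 (0 : E), ContDiffAt ℝ ∞ g x := by
    filter_upwards [evg1, evinv, ev1.eventually_nhds] with x hc hi hz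
    have cdx : ContDiffAt ℝ ∞ R (x, g x) := hR.contDiffAt
    have e1 := cdx.contDiffAt_implicitFunction hn hi
    have e2 := cdx.eventually_apply_eq_iff_implicitFunction hn hi
    refine e1.congr_of_eventuallyEq ?_
    have hcx : Tendsto (fun y : E => (y, g y)) (𝓝 x) (𝓝 (x, g x)) :=
      (continuousAt_id.prodMk hc : ContinuousAt (fun y : E => (y, g y)) x)
    filter_upwards [hcx.eventually e2, hz] with y h1 h2
    exact (h1.1 (by rw [h2, hz.self_of_nhds])).symm
  obtain ⟨g', hg', hgg⟩ := exists_contDiff_eventuallyEq evsm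
  refine ⟨g', hg', hgg.self_of_nhds.trans g0, ?_, ?_⟩
  · filter_upwards [ev1, hgg] with x h1 h2; rw [h2]; exact h1
  · have hf : Tendsto (fun z : E × F => z.1) (𝓝 (0, y₀)) (𝓝 0) := continuous_fst.tendsto _
    filter_upwards [ev2, hf.eventually hgg] with z h1 h2 h3
    rw [h2]; exact (h1.1 h3).symm

end ImplicitFunction

/-! ### Hadamard's lemma -/

section Hadamard

/-- Repeated differentiation under the integral sign. The codomain is quantified after `n` because
each derivative takes values in a new space. -/
theorem contDiff_integral_nat {E : Type} [NormedAddCommGroup E] [NormedSpace ℝ E]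
    [FiniteDimensional ℝ E] (n : ℕ) : ∀ {F : Type} [NormedAddCommGroup F] [NormedSpace ℝ F]
    [CompleteSpace F] {H : E × ℝ → F}, ContDiff ℝ ∞ H →
      ContDiff ℝ n (fun x => ∫ t in (0 : ℝ)..1, H (x, t)) := by
  have key : ∀ {F : Type} [NormedAddCommGroup F] [NormedSpace ℝ F] [CompleteSpace F]
      {H : E × ℝ → F}, ContDiff ℝ ∞ H → ∀ x₀ : E,
      HasFDerivAt (fun x => ∫ t in (0 : ℝ)..1, H (x, t))
        (∫ t in (0 : ℝ)..1, (fderiv ℝ H (x₀, t)).comp (.inl ℝ E ℝ)) x₀ := by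
    intro F _ _ _ H hH x₀
    have : ProperSpace E := FiniteDimensional.proper ℝ E
    have hcd : Continuous (fun z : E × ℝ => (fderiv ℝ H z).comp (.inl ℝ E ℝ)) :=
      (hH.fderiv_right (m := ∞) (by simp)).continuous.clm_comp continuous_const
    obtain ⟨C, hC⟩ := ((isCompact_closedBall x₀ 1).prod (isCompact_Icc (a := (0 : ℝ)) (b := 1))).exists_bound_of_continuousOn
      hcd.continuousOn
    refine intervalIntegral.hasFDerivAt_integral_of_dominated_of_fderiv_le (bound := fun _ => C)
      (s := Metric.closedBall x₀ 1) (F' := fun x t => (fderiv ℝ H (x, t)).comp (.inl ℝ E ℝ))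
      (Metric.closedBall_mem_nhds x₀ one_pos) ?_ ?_ ?_ ?_ ?_ ?_
    · exact Eventually.of_forall fun x =>
        (hH.continuous.comp (continuous_const.prodMk continuous_id)).aestronglyMeasurable
    · exact (hH.continuous.comp (continuous_const.prodMk continuous_id)).intervalIntegrable _ _
    · exact (hcd.comp (continuous_const.prodMk continuous_id)).aestronglyMeasurable
    · refine Eventually.of_forall fun t ht x hx => ?_
      rw [uIoc_of_le zero_le_one] at ht
      exact hC (x, t) ⟨hx, Ioc_subset_Icc_self ht⟩
    · exact intervalIntegrable_const
    · refine Eventually.of_forall fun t _ x _ => ?_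
      exact ((hH.differentiable (by simp) (x, t)).hasFDerivAt).comp x (hasFDerivAt_prodMk_left x t)
  induction n with
  | zero =>
    intro F _ _ _ H hH
    rw [Nat.cast_zero, contDiff_zero, continuous_iff_continuousAt]
    exact fun x => (key hH x).continuousAt
  | succ n ih =>
    intro F _ _ _ H hH
    rw [Nat.cast_succ, contDiff_succ_iff_fderiv]
    refine ⟨fun x => (key hH x).differentiableAt, by simp, ?_⟩
    have : fderiv ℝ (fun x => ∫ t in (0 : ℝ)..1, H (x, t)) =
        fun x => ∫ t in (0 : ℝ)..1, (fderiv ℝ H (x, t)).comp (.inl ℝ E ℝ) :=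
      funext fun x => (key hH x).fderiv
    rw [this]
    exact ih (H := fun z => (fderiv ℝ H z).comp (.inl ℝ E ℝ))
      ((hH.fderiv_right (m := ∞) (by simp)).clm_comp contDiff_const)

/-- Hadamard's lemma: a smooth function vanishing on `y = 0` is divisible by `y`. -/
theorem exists_smooth_div {g : ℝ × ℝ → ℝ} (hg : ContDiff ℝ ∞ g) (h0 : ∀ s, g (s, 0) = 0) :
    ∃ m : ℝ × ℝ → ℝ, ContDiff ℝ ∞ m ∧ (∀ s y, g (s, y) = y * m (s, y)) ∧
      ∀ s, m (s, 0) = fderiv ℝ g (s, 0) (0, 1) := by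
  -- Since `g (s, 0) = 0`, integrating `∂ₜ g(s, ty)` over `[0, 1]` gives `g(s, y) = y ∫ ∂₂g(s, ty)
  -- dt`.
  let H : (ℝ × ℝ) × ℝ → ℝ := fun z => fderiv ℝ g (z.1.1, z.2 * z.1.2) (0, 1)
  have hH : ContDiff ℝ ∞ H := by
    have h1 : ContDiff ℝ ∞ (fderiv ℝ g) := hg.fderiv_right (m := ∞) (by simp)
    have h2 : ContDiff ℝ ∞ (fun z : (ℝ × ℝ) × ℝ => (z.1.1, z.2 * z.1.2)) := by fun_prop
    exact (h1.comp h2).clm_apply contDiff_const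
  refine ⟨fun x => ∫ t in (0 : ℝ)..1, H (x, t), contDiff_infty.mpr fun n => contDiff_integral_nat n hH,
    ?_, ?_⟩
  · intro s y
    have hd : ∀ t : ℝ, HasDerivAt (fun t : ℝ => g (s, t * y)) (y * H ((s, y), t)) t := by
      intro t
      have h1 : HasDerivAt (fun t : ℝ => ((s, t * y) : ℝ × ℝ)) (0, y) t := by
        have := (hasDerivAt_const t s).prodMk ((hasDerivAt_id t).mul_const y)
        simpa using this
      have h2 := ((hg.differentiable (by simp) (s, t * y)).hasFDerivAt).comp_hasDerivAt t h1
      have e : fderiv ℝ g (s, t * y) (0, y) = y * H ((s, y), t) := by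
        have : ((0 : ℝ), y) = y • ((0 : ℝ), (1 : ℝ)) := by ext <;> simp
        rw [this, map_smul]; rfl
      rw [e] at h2; exact h2
    have := intervalIntegral.integral_eq_sub_of_hasDerivAt (a := 0) (b := 1) (fun t _ => hd t)
      ((continuous_const.mul (hH.continuous.comp (continuous_const.prodMk continuous_id))).intervalIntegrable _ _)
    simp only [one_mul, zero_mul, h0, sub_zero] at this
    rw [← this, intervalIntegral.integral_const_mul]
  · intro s
    simp [H]

end Hadamard

/-! ### Curves and domains in a box; convex sets as discs -/

section PlaneTopology

/-- The convex neighbourhoods of the origin over which the transitions are described. -/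
def box (r : ℝ) : Set Plane := Ioo (-(4 * r)) (4 * r) ×ˢ Ioo (-r) r

theorem mem_box {r : ℝ} {p : Plane} :
    p ∈ box r ↔ (-(4 * r) < p.1 ∧ p.1 < 4 * r) ∧ (-r < p.2 ∧ p.2 < r) := Iff.rfl

theorem isOpen_box (r : ℝ) : IsOpen (box r) := isOpen_Ioo.prod isOpen_Ioo

theorem convex_box (r : ℝ) : Convex ℝ (box r) := (convex_Ioo _ _).prod (convex_Ioo _ _)

theorem zero_mem_box {r : ℝ} (hr : 0 < r) : (0 : Plane) ∈ box r := by
  rw [mem_box]; simp; linarith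

theorem norm_lt_of_mem_box {r : ℝ} {p : Plane} (hp : p ∈ box r) : ‖p‖ < 4 * r := by
  rw [mem_box] at hp
  have : 0 < r := by linarith [hp.2.1, hp.2.2]
  rw [Prod.norm_def, max_lt_iff, Real.norm_eq_abs, Real.norm_eq_abs, abs_lt, abs_lt]
  refine ⟨hp.1, ?_, ?_⟩ <;> linarith [hp.2.1, hp.2.2]

theorem mem_box_of_norm_lt {r : ℝ} {p : Plane} (hp : ‖p‖ < r) : p ∈ box r := by
  rw [Prod.norm_def, max_lt_iff, Real.norm_eq_abs, Real.norm_eq_abs, abs_lt, abs_lt] at hp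
  rw [mem_box]
  refine ⟨⟨?_, ?_⟩, hp.2⟩ <;> linarith [hp.1.1, hp.1.2]

/-- The zero set of a function of `(x, y)` which changes sign from `-` to `+` in `x` is a graph. -/
theorem exists_graph {r : ℝ} {g : Plane → ℝ} (hg : ContinuousOn g (box r))
    (hmono : ∀ x x' y, (x, y) ∈ box r → (x', y) ∈ box r → x < x' → 0 ≤ g (x, y) → 0 < g (x', y))
    (hneg : ∀ y ∈ Ioo (-r) r, g (-(3 * r), y) < 0) (hpos : ∀ y ∈ Ioo (-r) r, 0 < g (3 * r, y)) :
    ∃ α : ℝ → ℝ, ContinuousOn α (Ioo (-r) r) ∧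
      (∀ y ∈ Ioo (-r) r, -(3 * r) < α y ∧ α y < 3 * r) ∧
      ∀ p ∈ box r, (g p = 0 ↔ p.1 = α p.2) ∧ (0 < g p ↔ α p.2 < p.1) ∧ (g p < 0 ↔ p.1 < α p.2) := by
  have hex : ∀ y ∈ Ioo (-r) r, ∃ x, (-(3 * r) < x ∧ x < 3 * r) ∧ g (x, y) = 0 := by
    intro y hy
    have hr : 0 < r := by linarith [hy.1, hy.2]
    have hc : ContinuousOn (fun x : ℝ => g (x, y)) (Icc (-(3 * r)) (3 * r)) := by
      refine hg.comp (by fun_prop) ?_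
      intro x hx
      exact ⟨⟨by linarith [hx.1], by linarith [hx.2]⟩, hy⟩
    obtain ⟨x, hx, hx0⟩ := intermediate_value_Ioo (by linarith) hc
      (show (0 : ℝ) ∈ Ioo _ _ from ⟨hneg y hy, hpos y hy⟩)
    exact ⟨x, hx, hx0⟩
  choose! α hα hα0 using hex
  have main : ∀ p ∈ box r, (p.1 = α p.2 → g p = 0) ∧ (α p.2 < p.1 → 0 < g p) ∧ (p.1 < α p.2 → g p < 0) := by
    intro p hp
    have hy : p.2 ∈ Ioo (-r) r := hp.2
    have hr : 0 < r := by linarith [hy.1, hy.2]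
    have ha := hα _ hy
    have hab : (α p.2, p.2) ∈ box r := ⟨⟨by linarith [ha.1], by linarith [ha.2]⟩, hy⟩
    refine ⟨?_, ?_, ?_⟩
    · intro h
      have := hα0 _ hy; rw [← h] at this; exact this
    · intro h
      exact hmono _ _ _ hab hp h (hα0 _ hy).ge
    · intro h
      by_contra! hc
      exact (hmono _ _ _ hp hab h hc).ne' (hα0 _ hy)
  refine ⟨α, ?_, hα, ?_⟩
  · intro y hy
    have hr : 0 < r := by linarith [hy.1, hy.2]
    have ha := hα _ hy
    refine ContinuousAt.continuousWithinAt ?_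
    -- The inequality `a < α y` amounts to `g (a, y) < 0`, which is an open condition on `y`, and
    -- likewise for `a > α y`. Values `a` beyond `±3r` are settled by the bound on `α`.
    rw [ContinuousAt, tendsto_order]
    have hcy : ∀ a, a ∈ Ioo (-(4 * r)) (4 * r) → ContinuousAt (fun y : ℝ => g (a, y)) y := by
      intro a haa
      have : ContinuousAt g (a, y) := hg.continuousAt ((isOpen_box r).mem_nhds ⟨haa, hy⟩)
      exact ContinuousAt.comp (f := fun y : ℝ => (a, y)) this (by fun_prop)
    have hIoo : Ioo (-r) r ∈ 𝓝 y := isOpen_Ioo.mem_nhds hy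
    constructor
    · intro a hlt
      rcases le_or_gt a (-(3 * r)) with h | h
      · filter_upwards [hIoo] with y' hy'
        exact h.trans_lt (hα y' hy').1
      · have hb : a ∈ Ioo (-(4 * r)) (4 * r) := ⟨by linarith, by linarith [ha.2]⟩
        have h1 : g (a, y) < 0 := (main (a, y) ⟨hb, hy⟩).2.2 hlt
        filter_upwards [hIoo, (hcy a hb).eventually (gt_mem_nhds h1)] with y' hy' h2
        by_contra! hc
        rcases hc.lt_or_eq with h3 | h3
        · exact absurd ((main (a, y') ⟨hb, hy'⟩).2.1 h3) (not_lt.mpr h2.le)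
        · exact h2.ne ((main (a, y') ⟨hb, hy'⟩).1 h3.symm)
    · intro a hlt
      rcases le_or_gt (3 * r) a with h | h
      · filter_upwards [hIoo] with y' hy'
        exact (hα y' hy').2.trans_le h
      · have hb : a ∈ Ioo (-(4 * r)) (4 * r) := ⟨by linarith [ha.1], by linarith⟩
        have h1 : 0 < g (a, y) := (main (a, y) ⟨hb, hy⟩).2.1 hlt
        filter_upwards [hIoo, (hcy a hb).eventually (lt_mem_nhds h1)] with y' hy' h2
        by_contra! hc
        rcases hc.lt_or_eq with h3 | h3
        · exact absurd ((main (a, y') ⟨hb, hy'⟩).2.2 h3) (not_lt.mpr h2.le)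
        · exact h2.ne' ((main (a, y') ⟨hb, hy'⟩).1 h3)
  · intro p hp
    obtain ⟨h1, h2, h3⟩ := main p hp
    refine ⟨⟨fun h => ?_, h1⟩, ⟨fun h => ?_, h2⟩, ⟨fun h => ?_, h3⟩⟩
    · rcases lt_trichotomy p.1 (α p.2) with a | a | a
      · exact absurd h (h3 a).ne
      · exact a
      · exact absurd h (h2 a).ne'
    · rcases lt_trichotomy p.1 (α p.2) with a | a | a
      · exact absurd h (h3 a).not_gt
      · exact absurd h (h1 a).not_gt
      · exact a
    · rcases lt_trichotomy p.1 (α p.2) with a | a | a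
      · exact a
      · exact absurd h (h1 a).not_lt
      · exact absurd h (h2 a).not_gt

variable {r : ℝ} {α : ℝ → ℝ}

theorem graph_homeomorph_real (hr : 0 < r) (hα : ContinuousOn α (Ioo (-r) r))
    (hb : ∀ y ∈ Ioo (-r) r, -(3 * r) < α y ∧ α y < 3 * r) {A : Set Plane}
    (hA : A = {p ∈ box r | p.1 = α p.2}) : Nonempty (A ≃ₜ ℝ) := by
  subst hA
  let I := Ioo (-1 : ℝ) 1
  have hmul : ∀ t : I, r * (t : ℝ) ∈ Ioo (-r) r := by
    intro t; constructor <;> nlinarith [t.2.1, t.2.2]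
  let e : ({p ∈ box r | p.1 = α p.2} : Set Plane) ≃ₜ I :=
    { toFun := fun p => ⟨p.1.2 / r, by
        have := p.2.1.2
        constructor
        · rw [lt_div_iff₀ hr]; linarith [this.1]
        · rw [div_lt_iff₀ hr]; linarith [this.2]⟩
      invFun := fun t => ⟨(α (r * t), r * t), by
        have h1 := hmul t
        have h2 := hb _ h1
        exact ⟨⟨⟨by linarith [h2.1], by linarith [h2.2]⟩, h1⟩, rfl⟩⟩
      left_inv := by
        intro p
        have h := p.2.2
        apply Subtype.ext
        have e : r * (p.1.2 / r) = p.1.2 := by field_simp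
        simp only [e, ← h]
      right_inv := by
        intro t
        apply Subtype.ext
        simp only
        field_simp
      continuous_toFun := by fun_prop
      continuous_invFun := by
        refine Continuous.subtype_mk (Continuous.prodMk ?_ (by fun_prop)) _
        exact hα.comp_continuous (by fun_prop) hmul }
  exact ⟨e.trans (orderIsoIooNegOneOne ℝ).toHomeomorph.symm⟩

/-- The region is the image of the rectangle `(0, 1) × (-r, r)` under stretching each horizontal
segment onto `(α y, 4r)`. -/
theorem isConnected_above (hr : 0 < r) (hα : ContinuousOn α (Ioo (-r) r))
    (hb : ∀ y ∈ Ioo (-r) r, -(3 * r) < α y ∧ α y < 3 * r) :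
    IsConnected {p ∈ box r | α p.2 < p.1} := by
  have e : {p ∈ box r | α p.2 < p.1} =
      (fun q : ℝ × ℝ => (α q.2 + q.1 * (4 * r - α q.2), q.2)) '' (Ioo (0 : ℝ) 1 ×ˢ Ioo (-r) r) := by
    ext p
    constructor
    · rintro ⟨hp, h⟩
      have h2 := hb _ hp.2
      have h3 : 0 < 4 * r - α p.2 := by linarith [h2.2]
      refine ⟨((p.1 - α p.2) / (4 * r - α p.2), p.2), ⟨⟨by apply div_pos <;> linarith, ?_⟩, hp.2⟩, ?_⟩
      · rw [div_lt_one h3]; linarith [hp.1.2]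
      · ext
        · simp only; field_simp; ring
        · rfl
    · rintro ⟨q, ⟨hq1, hq2⟩, rfl⟩
      have h2 := hb _ hq2
      have h3 : 0 < 4 * r - α q.2 := by linarith [h2.2]
      have h4 : 0 < q.1 * (4 * r - α q.2) := mul_pos hq1.1 h3
      have h5 : q.1 * (4 * r - α q.2) < 1 * (4 * r - α q.2) := by
        apply mul_lt_mul_of_pos_right hq1.2 h3
      refine ⟨⟨⟨?_, ?_⟩, hq2⟩, ?_⟩ <;> simp only <;> linarith [h2.1]
  rw [e]
  refine IsConnected.image ?_ _ ?_
  · exact ((convex_Ioo _ _).prod (convex_Ioo _ _)).isConnected ⟨(1 / 2, 0), by constructor <;> constructor <;> norm_num <;> linarith⟩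
  · have h1 : ContinuousOn (fun q : ℝ × ℝ => α q.2) (Ioo (0 : ℝ) 1 ×ˢ Ioo (-r) r) :=
      hα.comp (by fun_prop) fun q hq => hq.2
    exact (h1.add (continuousOn_fst.mul (continuousOn_const.sub h1))).prodMk continuousOn_snd

theorem isConnected_below (hr : 0 < r) (hα : ContinuousOn α (Ioo (-r) r))
    (hb : ∀ y ∈ Ioo (-r) r, -(3 * r) < α y ∧ α y < 3 * r) :
    IsConnected {p ∈ box r | p.1 < α p.2} := by
  have h := isConnected_above (α := fun y => - α y) hr hα.neg
    (fun y hy => by have := hb y hy; constructor <;> linarith)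
  have e : {p ∈ box r | p.1 < α p.2} =
      (fun p : Plane => (-p.1, p.2)) '' {p ∈ box r | - α p.2 < p.1} := by
    ext p
    constructor
    · rintro ⟨hp, h⟩
      refine ⟨(-p.1, p.2), ⟨⟨⟨?_, ?_⟩, hp.2⟩, ?_⟩, by simp⟩ <;> simp only <;> linarith [hp.1.1, hp.1.2]
    · rintro ⟨q, ⟨hq, h⟩, rfl⟩
      refine ⟨⟨⟨?_, ?_⟩, hq.2⟩, ?_⟩ <;> simp only <;> linarith [hq.1.1, hq.1.2]
  rw [e]
  exact h.image _ (by fun_prop)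

theorem box_inter_closure_above (hα : ContinuousOn α (Ioo (-r) r)) :
    box r ∩ closure {p ∈ box r | α p.2 < p.1} = {p ∈ box r | α p.2 ≤ p.1} := by
  ext p
  constructor
  · rintro ⟨hp, hc⟩
    refine ⟨hp, ?_⟩
    by_contra! hlt
    have c : ContinuousAt (fun q : Plane => α q.2 - q.1) p :=
      ((hα.continuousAt (isOpen_Ioo.mem_nhds hp.2)).comp (f := fun q : Plane => q.2) (by fun_prop)).sub
        (by fun_prop)
    have := c.eventually (lt_mem_nhds (show (0 : ℝ) < α p.2 - p.1 by linarith))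
    obtain ⟨q, hq1, hq2⟩ := mem_closure_iff_nhds.mp hc _ this
    have h3 : α q.2 < q.1 := hq2.2
    have h4 : 0 < α q.2 - q.1 := hq1
    linarith
  · rintro ⟨hp, h⟩
    refine ⟨hp, ?_⟩
    have ht : Tendsto (fun t : ℝ => ((p.1 + t, p.2) : Plane)) (𝓝[>] 0) (𝓝 p) := by
      have : ContinuousAt (fun t : ℝ => ((p.1 + t, p.2) : Plane)) 0 := by fun_prop
      have h2 := this.tendsto
      simp only [add_zero] at h2
      exact h2.mono_left nhdsWithin_le_nhds
    refine mem_closure_of_tendsto ht ?_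
    filter_upwards [ht.eventually ((isOpen_box r).mem_nhds hp), self_mem_nhdsWithin] with t h1 h2
    have h3 : (0 : ℝ) < t := h2
    exact ⟨h1, by linarith⟩

theorem box_inter_closure_below (hα : ContinuousOn α (Ioo (-r) r)) :
    box r ∩ closure {p ∈ box r | p.1 < α p.2} = {p ∈ box r | p.1 ≤ α p.2} := by
  ext p
  constructor
  · rintro ⟨hp, hc⟩
    refine ⟨hp, ?_⟩
    by_contra! hlt
    have c : ContinuousAt (fun q : Plane => q.1 - α q.2) p :=
      ContinuousAt.sub (by fun_prop) ((hα.continuousAt (isOpen_Ioo.mem_nhds hp.2)).comp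
        (f := fun q : Plane => q.2) (by fun_prop))
    have := c.eventually (lt_mem_nhds (show (0 : ℝ) < p.1 - α p.2 by linarith))
    obtain ⟨q, hq1, hq2⟩ := mem_closure_iff_nhds.mp hc _ this
    have h3 : q.1 < α q.2 := hq2.2
    have h4 : 0 < q.1 - α q.2 := hq1
    linarith
  · rintro ⟨hp, h⟩
    refine ⟨hp, ?_⟩
    have ht : Tendsto (fun t : ℝ => ((p.1 - t, p.2) : Plane)) (𝓝[>] 0) (𝓝 p) := by
      have : ContinuousAt (fun t : ℝ => ((p.1 - t, p.2) : Plane)) 0 := by fun_prop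
      have h2 := this.tendsto
      simp only [sub_zero] at h2
      exact h2.mono_left nhdsWithin_le_nhds
    refine mem_closure_of_tendsto ht ?_
    filter_upwards [ht.eventually ((isOpen_box r).mem_nhds hp), self_mem_nhdsWithin] with t h1 h2
    have h3 : (0 : ℝ) < t := h2
    exact ⟨h1, by linarith⟩

theorem isOpen_above (hα : ContinuousOn α (Ioo (-r) r)) : IsOpen {p ∈ box r | α p.2 < p.1} := by
  have c : ContinuousOn (fun q : Plane => q.1 - α q.2) (box r) :=
    continuousOn_fst.sub (hα.comp continuousOn_snd fun q hq => hq.2)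
  have := c.isOpen_inter_preimage (isOpen_box r) (isOpen_Ioi (a := (0 : ℝ)))
  convert! this using 1
  ext p; simp

theorem isOpen_below (hα : ContinuousOn α (Ioo (-r) r)) : IsOpen {p ∈ box r | p.1 < α p.2} := by
  have c : ContinuousOn (fun q : Plane => q.1 - α q.2) (box r) :=
    continuousOn_fst.sub (hα.comp continuousOn_snd fun q hq => hq.2)
  have := c.isOpen_inter_preimage (isOpen_box r) (isOpen_Iio (a := (0 : ℝ)))
  convert! this using 1
  ext p; simp

theorem box_inter_frontier_above (hα : ContinuousOn α (Ioo (-r) r)) :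
    box r ∩ frontier {p ∈ box r | α p.2 < p.1} = {p ∈ box r | p.1 = α p.2} := by
  rw [(isOpen_above hα).frontier_eq, ← inter_sdiff_assoc, box_inter_closure_above hα]
  ext p
  constructor
  · rintro ⟨⟨h1, h2⟩, h3⟩; exact ⟨h1, le_antisymm (not_lt.mp fun h => h3 ⟨h1, h⟩) h2⟩
  · rintro ⟨h1, h2⟩; exact ⟨⟨h1, h2.ge⟩, fun h => h2.le.not_gt h.2⟩

theorem box_inter_frontier_below (hα : ContinuousOn α (Ioo (-r) r)) :
    box r ∩ frontier {p ∈ box r | p.1 < α p.2} = {p ∈ box r | p.1 = α p.2} := by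
  rw [(isOpen_below hα).frontier_eq, ← inter_sdiff_assoc, box_inter_closure_below hα]
  ext p
  constructor
  · rintro ⟨⟨h1, h2⟩, h3⟩; exact ⟨h1, le_antisymm h2 (not_lt.mp fun h => h3 ⟨h1, h⟩)⟩
  · rintro ⟨h1, h2⟩; exact ⟨⟨h1, h2.le⟩, fun h => h2.ge.not_gt h.2⟩

/-- Two bounded convex sets with nonempty interior are matched by a homeomorphism of the plane. The
model is the Euclidean disc, which is not a ball of the supremum norm of `Plane`, so its convexity,
boundedness and frontier are verified directly. -/
theorem exists_homeomorph_disc {s : Set Plane} (hc : Convex ℝ s) (ho : IsOpen s)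
    (hne : s.Nonempty) (hb : Bornology.IsBounded s) :
    ∃ Φ : Plane ≃ₜ Plane, Φ '' {q | q.1 ^ 2 + q.2 ^ 2 < 1} = s ∧
      Φ '' {q | q.1 ^ 2 + q.2 ^ 2 = 1} = frontier s := by
  set D : Set Plane := {q | q.1 ^ 2 + q.2 ^ 2 < 1} with hD
  have hDo : IsOpen D := isOpen_lt (by fun_prop) (by fun_prop)
  have hDc : Convex ℝ D := by
    intro x hx y hy a b ha hb hab
    simp only [hD, mem_ofPred_eq] at hx hy ⊢
    simp only [Prod.fst_add, Prod.smul_fst, Prod.snd_add, Prod.smul_snd, smul_eq_mul]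
    obtain rfl : b = 1 - a := by linarith
    have : (a * x.1 + (1 - a) * y.1) ^ 2 + (a * x.2 + (1 - a) * y.2) ^ 2
        = a * (x.1 ^ 2 + x.2 ^ 2) + (1 - a) * (y.1 ^ 2 + y.2 ^ 2)
          - a * (1 - a) * ((x.1 - y.1) ^ 2 + (x.2 - y.2) ^ 2) := by ring
    rw [this]
    have h1 : 0 ≤ a * (1 - a) * ((x.1 - y.1) ^ 2 + (x.2 - y.2) ^ 2) := by positivity
    rcases ha.eq_or_lt with rfl | ha'
    · simp only [zero_mul, sub_zero, one_mul, zero_add] at *; linarith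
    · nlinarith
  have hDb : Bornology.IsBounded D := by
    refine (Metric.isBounded_closedBall (x := (0 : Plane)) (r := 1)).subset ?_
    intro q hq
    simp only [hD, mem_ofPred_eq] at hq
    rw [mem_closedBall_zero_iff, Prod.norm_def, max_le_iff, Real.norm_eq_abs, Real.norm_eq_abs]
    constructor <;> apply abs_le_one_iff_mul_self_le_one.mpr <;> nlinarith [sq_nonneg q.1, sq_nonneg q.2]
  have hfr : frontier D = {q | q.1 ^ 2 + q.2 ^ 2 = 1} := by
    apply Subset.antisymm
    · exact frontier_lt_subset_eq (by fun_prop) (by fun_prop)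
    · intro q hq
      simp only [mem_ofPred_eq] at hq
      rw [hDo.frontier_eq]
      refine ⟨?_, by simp [hD, hq]⟩
      have ht : Tendsto (fun t : ℝ => ((1 - t) * q.1, (1 - t) * q.2)) (𝓝[>] 0) (𝓝 q) := by
        have : ContinuousAt (fun t : ℝ => (((1 - t) * q.1, (1 - t) * q.2) : Plane)) 0 := by fun_prop
        have h2 := this.tendsto
        simp only [sub_zero, one_mul] at h2
        exact h2.mono_left nhdsWithin_le_nhds
      refine mem_closure_of_tendsto ht ?_
      filter_upwards [Ioo_mem_nhdsGT (zero_lt_one' ℝ)] with t h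
      simp only [hD, mem_ofPred_eq]
      have : ((1 - t) * q.1) ^ 2 + ((1 - t) * q.2) ^ 2 = (1 - t) ^ 2 := by
        linear_combination (1 - t) ^ 2 * hq
      rw [this]; nlinarith [h.1, h.2]
  obtain ⟨e, h1, -, h3⟩ := exists_homeomorph_image_eq hDc
    (by rw [hDo.interior_eq]; exact ⟨0, by simp [hD]⟩) (NormedSpace.isVonNBounded_of_isBounded _ hDb)
    hc (by rwa [ho.interior_eq]) (NormedSpace.isVonNBounded_of_isBounded _ hb)
  rw [hDo.interior_eq, ho.interior_eq] at h1
  rw [hfr] at h3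
  exact ⟨e, h1, h3⟩

end PlaneTopology

/-! ### Normal families and the rays of proportional quadratic forms -/

section NormalFamily

variable {σ : ℝ} {G : ℝ → Plane → ℝ}

/-- A generic family with a flat umbilic at `0` whose cubic form is `x ^ 3 + 3 σ x y ^ 2`,
`σ = 1` for `D₄⁺` and `σ = -1` for `D₄⁻`. -/
structure NormalFamily (σ : ℝ) (G : ℝ → Plane → ℝ) : Prop where
  smooth : SmoothFamily G
  sq : σ * σ = 1
  j20 : J G 2 0 0 = 0
  j11 : J G 1 1 0 = 0
  j02 : J G 0 2 0 = 0
  j30 : J G 3 0 0 = 1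
  j21 : J G 2 1 0 = 0
  j12 : J G 1 2 0 = σ
  j03 : J G 0 3 0 = 0
  transverse : - fderiv ℝ (J G 2 0) 0 (1, 0) + σ * fderiv ℝ (J G 0 2) 0 (1, 0) ≠ 0

/-- The speed at which the family crosses the flat-umbilic stratum. -/
noncomputable def speed (σ : ℝ) (G : ℝ → Plane → ℝ) : ℝ :=
  - fderiv ℝ (J G 2 0) 0 (1, 0) + σ * fderiv ℝ (J G 0 2) 0 (1, 0)

theorem quad_J (hG : SmoothFamily G) (z : ℝ × Plane) (v : Plane) : ddPow 2 v (G z.1) z.2 =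
    v.1 ^ 2 * J G 2 0 z + 2 * v.1 * v.2 * J G 1 1 z + v.2 ^ 2 * J G 0 2 z :=
  ddPow_two (hG.slice z.1) v z.2

theorem cubic_J (hG : SmoothFamily G) (z : ℝ × Plane) (v : Plane) : ddPow 3 v (G z.1) z.2 =
    v.1 ^ 3 * J G 3 0 z + 3 * v.1 ^ 2 * v.2 * J G 2 1 z + 3 * v.1 * v.2 ^ 2 * J G 1 2 z
      + v.2 ^ 3 * J G 0 3 z :=
  ddPow_three (hG.slice z.1) v z.2

theorem quartic_J (hG : SmoothFamily G) (z : ℝ × Plane) (v : Plane) : ddPow 4 v (G z.1) z.2 =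
    v.1 ^ 4 * J G 4 0 z + 4 * v.1 ^ 3 * v.2 * J G 3 1 z + 6 * v.1 ^ 2 * v.2 ^ 2 * J G 2 2 z
      + 4 * v.1 * v.2 ^ 3 * J G 1 3 z + v.2 ^ 4 * J G 0 4 z :=
  ddPow_four (hG.slice z.1) v z.2

theorem hess_J (G : ℝ → Plane → ℝ) (z : ℝ × Plane) :
    hess (G z.1) z.2 = J G 2 0 z * J G 0 2 z - J G 1 1 z ^ 2 := rfl

/-- The `(x, y)`-plane is sent to the forms `(x, σy, σx)`, which is the kernel of `-Q₁ + σQ₃`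
because `σ² = 1`. The field `transverse` says that the `ε`-direction is not sent into this kernel.
-/
theorem NormalFamily.fderiv_zero (h : NormalFamily σ G) (z : ℝ × Plane) :
    fderiv ℝ (J G 2 0) 0 z = z.1 * fderiv ℝ (J G 2 0) 0 (1, 0) + z.2.1 ∧
    fderiv ℝ (J G 1 1) 0 z = z.1 * fderiv ℝ (J G 1 1) 0 (1, 0) + σ * z.2.2 ∧
    fderiv ℝ (J G 0 2) 0 z = z.1 * fderiv ℝ (J G 0 2) 0 (1, 0) + σ * z.2.1 := by
  have e : z = z.1 • ((1 : ℝ), (0 : Plane)) + ((0 : ℝ), z.2) := by ext <;> simp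
  have key : ∀ L : ℝ × Plane →L[ℝ] ℝ, L z = z.1 * L (1, 0) + L (0, z.2) := by
    intro L
    conv_lhs => rw [e]
    rw [map_add, map_smul]; rfl
  refine ⟨?_, ?_, ?_⟩
  · rw [key, h.smooth.fderiv_J, h.j30, h.j21]; ring
  · rw [key, h.smooth.fderiv_J, h.j21, h.j12]; ring
  · rw [key, h.smooth.fderiv_J, h.j12, h.j03]; ring

theorem NormalFamily.estimate (h : NormalFamily σ G) {η : ℝ} (hη : 0 < η) :
    ∀ᶠ z in 𝓝 (0 : ℝ × Plane),
      |J G 2 0 z - (z.1 * fderiv ℝ (J G 2 0) 0 (1, 0) + z.2.1)| ≤ η * ‖z‖ ∧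
      |J G 1 1 z - (z.1 * fderiv ℝ (J G 1 1) 0 (1, 0) + σ * z.2.2)| ≤ η * ‖z‖ ∧
      |J G 0 2 z - (z.1 * fderiv ℝ (J G 0 2) 0 (1, 0) + σ * z.2.1)| ≤ η * ‖z‖ := by
  have d := fun i j => ((h.smooth.jet i j).differentiable (by simp) 0).hasFDerivAt.isLittleO.def hη
  filter_upwards [d 2 0, d 1 1, d 0 2] with z h1 h2 h3
  simp only [sub_zero, h.j20, h.j11, h.j02, Real.norm_eq_abs, h.fderiv_zero z] at h1 h2 h3
  exact ⟨h1, h2, h3⟩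

/-- To leading order `ν ε = kε`, so that the product is `k²ε²`. -/
theorem eventually_pos_of_hasDerivAt {ν : ℝ → ℝ} {k : ℝ} (hν : HasDerivAt ν k 0) (h0 : ν 0 = 0)
    (hk : k ≠ 0) : ∀ᶠ ε in 𝓝 (0 : ℝ), ε ≠ 0 → 0 < ν ε * ε * k := by
  suffices H : ∀ᶠ ε in 𝓝[≠] (0 : ℝ), 0 < ν ε * ε * k from eventually_nhdsWithin_iff.mp H
  have h1 := (hasDerivAt_iff_tendsto_slope.mp hν).mul_const k
  have h2 : 0 < k * k := mul_self_pos.mpr hk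
  filter_upwards [h1.eventually (lt_mem_nhds h2), self_mem_nhdsWithin] with ε h3 h4
  have h5 : ε ≠ 0 := h4
  rw [slope_def_field, h0, sub_zero, sub_zero] at h3
  have : ν ε * ε * k = (ν ε / ε * k) * ε ^ 2 := by field_simp
  rw [this]; positivity

/-- In a normal family, the points where the quadratic form is proportional to a given one form a
smooth curve `(ε, e ε)`. -/
theorem NormalFamily.exists_ray (h : NormalFamily σ G) {Q₁ Q₂ Q₃ : ℝ × Plane → ℝ}
    (h1 : ContDiff ℝ ∞ Q₁) (h2 : ContDiff ℝ ∞ Q₂) (h3 : ContDiff ℝ ∞ Q₃)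
    (hQ : - Q₁ 0 + σ * Q₃ 0 ≠ 0) :
    ∃ e : ℝ → Plane, ContDiff ℝ ∞ e ∧ e 0 = 0 ∧
      (∀ᶠ ε in 𝓝 (0 : ℝ), ∃ τ : ℝ, J G 2 0 (ε, e ε) = τ * Q₁ (ε, e ε) ∧
        J G 1 1 (ε, e ε) = τ * Q₂ (ε, e ε) ∧ J G 0 2 (ε, e ε) = τ * Q₃ (ε, e ε) ∧
        (ε ≠ 0 → 0 < τ * ε * (speed σ G * (- Q₁ 0 + σ * Q₃ 0)))) ∧
      ∀ᶠ z in 𝓝 (0 : ℝ × Plane), (∃ τ : ℝ, J G 2 0 z = τ * Q₁ z ∧ J G 1 1 z = τ * Q₂ z ∧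
        J G 0 2 z = τ * Q₃ z) → z.2 = e z.1 := by
  have sm := fun i j => h.smooth.jet i j
  have s20 := sm 2 0
  have s11 := sm 1 1
  have s02 := sm 0 2
  -- If the quadratic form is `τ` times `Q`, then `n = τq`, so `τ` is eliminated in the equations
  -- `q·J = n·Q`. The differential of `n` at `0` vanishes along the plane, hence `n` is `speed · ε`
  -- to first order, and the derivative of `(R₁, R₂)` along the plane is `q 0` times an invertible
  -- diagonal map.
  let q : ℝ × Plane → ℝ := fun z => - Q₁ z + σ * Q₃ z
  let n : ℝ × Plane → ℝ := fun z => - J G 2 0 z + σ * J G 0 2 z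
  have hq : ContDiff ℝ ∞ q := h1.neg.add (contDiff_const.mul h3)
  have hn : ContDiff ℝ ∞ n := s20.neg.add (contDiff_const.mul s02)
  let R₁ : ℝ × Plane → ℝ := fun z => q z * J G 2 0 z - n z * Q₁ z
  let R₂ : ℝ × Plane → ℝ := fun z => q z * J G 1 1 z - n z * Q₂ z
  have hR₁ : ContDiff ℝ ∞ R₁ := (hq.mul s20).sub (hn.mul h1)
  have hR₂ : ContDiff ℝ ∞ R₂ := (hq.mul s11).sub (hn.mul h2)
  have hd : ∀ {k : ℝ × Plane → ℝ}, ContDiff ℝ ∞ k → HasFDerivAt k (fderiv ℝ k 0) 0 :=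
    fun hk => (hk.differentiable (by simp) 0).hasFDerivAt
  have n0 : n 0 = 0 := by simp [n, h.j20, h.j02]
  have hσ := h.sq
  have dn : ∀ z : ℝ × Plane, fderiv ℝ n 0 z = z.1 * speed σ G := by
    intro z
    have e : HasFDerivAt n _ 0 := (hd s20).neg.add ((hd s02).const_mul σ)
    rw [e.fderiv]
    simp only [add_apply, neg_apply, smul_apply, smul_eq_mul, h.fderiv_zero z, speed]
    linear_combination z.2.1 * hσ
  have dR₁ : ∀ d : Plane, fderiv ℝ R₁ 0 (0, d) = q 0 * d.1 := by
    intro d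
    have e : HasFDerivAt R₁ _ 0 := ((hd hq).mul (hd s20)).sub ((hd hn).mul (hd h1))
    rw [e.fderiv]
    simp only [sub_apply, add_apply, smul_apply, smul_eq_mul, dn, n0, h.j20, h.fderiv_zero (0, d)]
    ring
  have dR₂ : ∀ d : Plane, fderiv ℝ R₂ 0 (0, d) = q 0 * (σ * d.2) := by
    intro d
    have e : HasFDerivAt R₂ _ 0 := ((hd hq).mul (hd s11)).sub ((hd hn).mul (hd h2))
    rw [e.fderiv]
    simp only [sub_apply, add_apply, smul_apply, smul_eq_mul, dn, n0, h.j11, h.fderiv_zero (0, d)]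
    ring
  have hσ0 : σ ≠ 0 := by rintro rfl; simp at hσ
  obtain ⟨e, he, he0, hev, huniq⟩ := exists_smooth_implicit (R := fun z => (R₁ z, R₂ z))
    (y₀ := 0) (hR₁.prodMk hR₂)
    (by
      have a1 : R₁ 0 = 0 := by simp [R₁, n0, h.j20]
      have a2 : R₂ 0 = 0 := by simp [R₂, n0, h.j11]
      exact Prod.ext a1 a2)
    (by
      intro d hd0
      have e : HasFDerivAt (fun z => (R₁ z, R₂ z)) _ 0 := (hd hR₁).prodMk (hd hR₂)
      have : fderiv ℝ (fun z => (R₁ z, R₂ z)) ((0 : ℝ), (0 : Plane)) (0, d) = (q 0 * d.1, q 0 * (σ * d.2)) := by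
        refine (congrArg (fun L : ℝ × Plane →L[ℝ] Plane => L (0, d)) e.fderiv).trans ?_
        rw [← dR₁, ← dR₂]; rfl
      rw [this] at hd0
      have e1 : q 0 * d.1 = 0 := congrArg Prod.fst hd0
      have e2 : q 0 * (σ * d.2) = 0 := congrArg Prod.snd hd0
      have hq0 : q 0 ≠ 0 := hQ
      ext
      · simpa [hq0] using e1
      · simpa [hq0, hσ0] using e2)
  have hce : ContinuousAt (fun ε : ℝ => (ε, e ε)) 0 := continuousAt_id.prodMk he.continuous.continuousAt
  have hte : Tendsto (fun ε : ℝ => (ε, e ε)) (𝓝 0) (𝓝 (0 : ℝ × Plane)) := by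
    have := hce.tendsto
    rw [he0] at this; exact this
  refine ⟨e, he, he0, ?_, ?_⟩
  · have hν : HasDerivAt (fun ε => n (ε, e ε)) (speed σ G) 0 := by
      have d1 : HasDerivAt (fun ε : ℝ => (ε, e ε)) (1, deriv e 0) 0 :=
        (hasDerivAt_id 0).prodMk (he.differentiable (by simp) 0).hasDerivAt
      have d2 : HasFDerivAt n (fderiv ℝ n 0) ((fun ε : ℝ => (ε, e ε)) 0) := by
        simp only [he0]; exact hd hn
      have := d2.comp_hasDerivAt (0 : ℝ) d1
      rw [dn, one_mul] at this
      exact this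
    have hsign := eventually_pos_of_hasDerivAt hν (by simp only [he0]; exact n0) h.transverse
    have hqpos : ∀ᶠ ε in 𝓝 (0 : ℝ), 0 < q (ε, e ε) * q 0 := by
      have : ContinuousAt (fun z => q z * q 0) 0 := hq.continuous.continuousAt.mul continuousAt_const
      have hq0 : q 0 ≠ 0 := hQ
      exact hte.eventually (this.eventually (lt_mem_nhds (mul_self_pos.mpr hq0)))
    filter_upwards [hev, hsign, hqpos] with ε g1 g2 g3
    have e1 : q (ε, e ε) * J G 2 0 (ε, e ε) - n (ε, e ε) * Q₁ (ε, e ε) = 0 := congrArg Prod.fst g1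
    have e2 : q (ε, e ε) * J G 1 1 (ε, e ε) - n (ε, e ε) * Q₂ (ε, e ε) = 0 := congrArg Prod.snd g1
    have hqz : q (ε, e ε) ≠ 0 := by rintro e; rw [e, zero_mul] at g3; exact lt_irrefl _ g3
    -- The third equation comes for free: the functional `-(·)₁ + σ(·)₃` takes `q·J - n·Q` to `qn -
    -- nq = 0`, and the first component is already zero.
    have e3 : q (ε, e ε) * J G 0 2 (ε, e ε) - n (ε, e ε) * Q₃ (ε, e ε) = 0 := by
      have a1 : q (ε, e ε) = - Q₁ (ε, e ε) + σ * Q₃ (ε, e ε) := rfl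
      have a2 : n (ε, e ε) = - J G 2 0 (ε, e ε) + σ * J G 0 2 (ε, e ε) := rfl
      linear_combination σ * e1 + (n (ε, e ε) * Q₃ (ε, e ε) - q (ε, e ε) * J G 0 2 (ε, e ε)) * hσ
        + σ * n (ε, e ε) * a1 - σ * q (ε, e ε) * a2
    refine ⟨n (ε, e ε) / q (ε, e ε), ?_, ?_, ?_, ?_⟩
    · field_simp; linarith
    · field_simp; linarith
    · field_simp; linarith
    · intro hε
      have g4 := g2 hε
      have : n (ε, e ε) / q (ε, e ε) * ε * (speed σ G * q 0)
          = (n (ε, e ε) * ε * speed σ G) * (q (ε, e ε) * q 0) / q (ε, e ε) ^ 2 := by field_simp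
      change 0 < n (ε, e ε) / q (ε, e ε) * ε * (speed σ G * q 0)
      rw [this]
      positivity
  · filter_upwards [huniq] with z hz
    rintro ⟨τ, a1, a2, a3⟩
    apply hz
    have : n z = τ * q z := by simp only [n, q]; rw [a1, a3]; ring
    ext
    · simp only [R₁]; rw [this, a1]; simp; ring
    · simp only [R₂]; rw [this, a2]; simp; ring

/-- The flat umbilic is isolated in the family. -/
theorem NormalFamily.isolated (h : NormalFamily σ G) : ∀ᶠ z in 𝓝 (0 : ℝ × Plane),
    J G 2 0 z = 0 → J G 1 1 z = 0 → J G 0 2 z = 0 → z = 0 := by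
  -- A flat umbilic lies on every ray, with factor `0`. On this ray the factor is nonzero for `ε ≠
  -- 0`.
  obtain ⟨e, he, he0, h1, h2⟩ := h.exists_ray (Q₁ := fun _ => 1) (Q₂ := fun _ => 0) (Q₃ := fun _ => 0)
    contDiff_const contDiff_const contDiff_const (by simp)
  have ht : Tendsto (fun z : ℝ × Plane => z.1) (𝓝 0) (𝓝 0) := continuous_fst.tendsto _
  filter_upwards [ht.eventually h1, h2] with z g1 g2 a1 a2 a3
  have hz : z.2 = e z.1 := g2 ⟨0, by simp [a1], by simp [a2], by simp [a3]⟩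
  obtain ⟨τ, b1, -, -, b4⟩ := g1
  rw [← hz] at b1
  have hτ : τ = 0 := by
    have : J G 2 0 z = τ * 1 := b1
    rw [a1] at this; linarith
  have hz1 : z.1 = 0 := by
    by_contra hne
    have := b4 hne
    rw [hτ] at this; simp at this
  ext : 1
  · exact hz1
  · rw [hz, hz1, he0]; rfl

/-- A simple root `s₀` of the cubic form continues to a smooth family of roots. -/
theorem NormalFamily.exists_root (h : NormalFamily σ G) {s₀ : ℝ} (h0 : s₀ ^ 3 + 3 * σ * s₀ = 0)
    (h1 : s₀ ^ 2 + σ ≠ 0) : ∃ s : ℝ × Plane → ℝ, ContDiff ℝ ∞ s ∧ s 0 = s₀ ∧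
      ∀ᶠ z in 𝓝 (0 : ℝ × Plane), s z ^ 3 * J G 3 0 z + 3 * s z ^ 2 * J G 2 1 z + 3 * s z * J G 1 2 z
        + J G 0 3 z = 0 := by
  have sm := fun i j => h.smooth.jet i j
  let R : (ℝ × Plane) × ℝ → ℝ := fun w => w.2 ^ 3 * J G 3 0 w.1 + 3 * w.2 ^ 2 * J G 2 1 w.1
    + 3 * w.2 * J G 1 2 w.1 + J G 0 3 w.1
  have hR : ContDiff ℝ ∞ R := by
    have a1 := (sm 3 0).comp (contDiff_fst (E := ℝ × Plane) (F := ℝ))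
    have a2 := (sm 2 1).comp (contDiff_fst (E := ℝ × Plane) (F := ℝ))
    have a3 := (sm 1 2).comp (contDiff_fst (E := ℝ × Plane) (F := ℝ))
    have a4 := (sm 0 3).comp (contDiff_fst (E := ℝ × Plane) (F := ℝ))
    exact ((((contDiff_snd.pow 3).mul a1).add ((contDiff_const.mul (contDiff_snd.pow 2)).mul a2)).add
      ((contDiff_const.mul contDiff_snd).mul a3)).add a4
  obtain ⟨s, hs, hs0, hev, -⟩ := exists_smooth_implicit hR (y₀ := s₀)
    (by simp only [R, h.j30, h.j21, h.j12, h.j03]; linarith)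
    (by
      intro y hy
      have e1 : HasFDerivAt (fun t : ℝ => ((0 : ℝ × Plane), t)) (.inr ℝ (ℝ × Plane) ℝ) s₀ :=
        hasFDerivAt_prodMk_right 0 s₀
      have e2 : HasFDerivAt (fun t : ℝ => R (0, t)) _ s₀ :=
        HasFDerivAt.comp (g := R) (f := fun t : ℝ => ((0 : ℝ × Plane), t)) s₀
          (hR.differentiable (by simp) (0, s₀)).hasFDerivAt e1
      have e3 : HasDerivAt (fun t : ℝ => R (0, t)) (3 * s₀ ^ 2 + 3 * σ) s₀ := by
        have : (fun t : ℝ => R (0, t)) = fun t => t ^ 3 + 3 * σ * t := by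
          funext t; simp only [R, h.j30, h.j21, h.j12, h.j03]; ring
        rw [this]
        have := (hasDerivAt_pow 3 s₀).add ((hasDerivAt_id s₀).const_mul (3 * σ))
        convert! this using 1
        simp
      have e4 := congrArg (fun L : ℝ →L[ℝ] ℝ => L y) (e2.unique e3.hasFDerivAt)
      simp at e4
      rw [hy] at e4
      have h2 : 3 * s₀ ^ 2 + 3 * σ ≠ 0 := by intro hc; apply h1; linarith
      exact (mul_eq_zero.mp e4.symm).resolve_right h2)
  exact ⟨s, hs, hs0, hev⟩

/-- The trilinear and quadrilinear forms of third and fourth derivatives. -/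
theorem SmoothFamily.dd_three_contDiff (hG : SmoothFamily G) {u v w : ℝ × Plane → Plane}
    (hu : ContDiff ℝ ∞ u) (hv : ContDiff ℝ ∞ v) (hw : ContDiff ℝ ∞ w) :
    ContDiff ℝ ∞ (fun z : ℝ × Plane =>
      FlatUmbilic.dd (u z) (FlatUmbilic.dd (v z) (FlatUmbilic.dd (w z) (G z.1))) z.2) := by
  have e : (fun z : ℝ × Plane =>
      FlatUmbilic.dd (u z) (FlatUmbilic.dd (v z) (FlatUmbilic.dd (w z) (G z.1))) z.2) = fun z =>
      (u z).1 * (v z).1 * (w z).1 * J G 3 0 z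
      + ((u z).1 * (v z).1 * (w z).2 + (u z).1 * (v z).2 * (w z).1 + (u z).2 * (v z).1 * (w z).1) * J G 2 1 z
      + ((u z).1 * (v z).2 * (w z).2 + (u z).2 * (v z).1 * (w z).2 + (u z).2 * (v z).2 * (w z).1) * J G 1 2 z
      + (u z).2 * (v z).2 * (w z).2 * J G 0 3 z := by
    funext z; rw [dd_three (hG.slice z.1)]; rfl
  rw [e]
  have a1 := hG.jet 3 0
  have a2 := hG.jet 2 1
  have a3 := hG.jet 1 2
  have a4 := hG.jet 0 3
  fun_prop

theorem SmoothFamily.dd_two_contDiff (hG : SmoothFamily G) {u v : ℝ × Plane → Plane}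
    (hu : ContDiff ℝ ∞ u) (hv : ContDiff ℝ ∞ v) :
    ContDiff ℝ ∞ (fun z : ℝ × Plane => FlatUmbilic.dd (u z) (FlatUmbilic.dd (v z) (G z.1)) z.2) := by
  have e : (fun z : ℝ × Plane => FlatUmbilic.dd (u z) (FlatUmbilic.dd (v z) (G z.1)) z.2) = fun z =>
      (u z).1 * (v z).1 * J G 2 0 z + ((u z).1 * (v z).2 + (u z).2 * (v z).1) * J G 1 1 z
      + (u z).2 * (v z).2 * J G 0 2 z := by
    funext z; rw [dd_two (hG.slice z.1)]; rfl
  rw [e]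
  have a1 := hG.jet 2 0
  have a2 := hG.jet 1 1
  have a3 := hG.jet 0 2
  fun_prop

theorem SmoothFamily.dd_four_contDiff (hG : SmoothFamily G) {t u v w : ℝ × Plane → Plane}
    (ht : ContDiff ℝ ∞ t) (hu : ContDiff ℝ ∞ u) (hv : ContDiff ℝ ∞ v) (hw : ContDiff ℝ ∞ w) :
    ContDiff ℝ ∞ (fun z : ℝ × Plane => FlatUmbilic.dd (t z)
      (FlatUmbilic.dd (u z) (FlatUmbilic.dd (v z) (FlatUmbilic.dd (w z) (G z.1)))) z.2) := by
  have e : (fun z : ℝ × Plane => FlatUmbilic.dd (t z)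
      (FlatUmbilic.dd (u z) (FlatUmbilic.dd (v z) (FlatUmbilic.dd (w z) (G z.1)))) z.2) = fun z =>
      (u z).1 * (v z).1 * (w z).1 * ((t z).1 * J G 4 0 z + (t z).2 * J G 3 1 z)
      + ((u z).1 * (v z).1 * (w z).2 + (u z).1 * (v z).2 * (w z).1 + (u z).2 * (v z).1 * (w z).1) *
        ((t z).1 * J G 3 1 z + (t z).2 * J G 2 2 z)
      + ((u z).1 * (v z).2 * (w z).2 + (u z).2 * (v z).1 * (w z).2 + (u z).2 * (v z).2 * (w z).1) *
        ((t z).1 * J G 2 2 z + (t z).2 * J G 1 3 z)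
      + (u z).2 * (v z).2 * (w z).2 * ((t z).1 * J G 1 3 z + (t z).2 * J G 0 4 z) := by
    funext z; rw [dd_four (hG.slice z.1)]; rfl
  rw [e]
  have a1 := hG.jet 4 0
  have a2 := hG.jet 3 1
  have a3 := hG.jet 2 2
  have a4 := hG.jet 1 3
  have a5 := hG.jet 0 4
  fun_prop

end NormalFamily

/-! ### Godrons and hyperbolic nodes near the umbilic -/

section PointwiseAnalysis

variable {σ : ℝ} {G : ℝ → Plane → ℝ}

/-- For a form of zero determinant, isotropic vectors lie in the kernel: the form multiplied by `a`
is the square of `a v₁ + b v₂`, and similarly for `c`. -/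
theorem parabolic_form {a b c : ℝ} {v : Plane} (hh : a * c - b ^ 2 = 0)
    (hq : v.1 ^ 2 * a + 2 * v.1 * v.2 * b + v.2 ^ 2 * c = 0) :
    a * v.1 + b * v.2 = 0 ∧ b * v.1 + c * v.2 = 0 := by
  constructor
  · have : (a * v.1 + b * v.2) ^ 2 = 0 := by linear_combination a * hq - v.2 ^ 2 * hh
    exact pow_eq_zero_iff two_ne_zero |>.mp this
  · have : (b * v.1 + c * v.2) ^ 2 = 0 := by linear_combination c * hq - v.1 ^ 2 * hh
    exact pow_eq_zero_iff two_ne_zero |>.mp this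

/-- At a godron, the quadratic form is a multiple of the square of a linear factor of the cubic
form. -/
theorem cubic_eq_zero_of_isGodron {f : Plane → ℝ} (hf : ContDiff ℝ ∞ f) {p : Plane}
    (hg : IsGodron f p) : ∃ v : Plane, v ≠ 0 ∧ ddPow 3 v f p = 0 ∧ hess f p = 0 ∧
      jet 2 0 f p * v.1 + jet 1 1 f p * v.2 = 0 ∧ jet 1 1 f p * v.1 + jet 0 2 f p * v.2 = 0 := by
  obtain ⟨v, hv0, huniq, hh, hreg, htan⟩ := hg
  have hq : ddPow 2 v f p = 0 := (huniq v).2 ⟨1, by simp⟩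
  rw [ddPow_two hf] at hq
  have hh' : jet 2 0 f p * jet 0 2 f p - jet 1 1 f p ^ 2 = 0 := hh
  obtain ⟨e1, e2⟩ := parabolic_form hh' hq
  refine ⟨v, hv0, ?_, hh, e1, e2⟩
  rw [fderiv_hess hf] at htan
  have hw : ∃ w : Plane, ddPow 2 w f p ≠ 0 := by
    by_contra! hc
    obtain ⟨c1, h1⟩ := (huniq (1, 0)).1 (hc _)
    obtain ⟨c2, h2⟩ := (huniq (0, 1)).1 (hc _)
    have a1 := congrArg Prod.fst h1
    have a2 := congrArg Prod.snd h1
    have b1 := congrArg Prod.fst h2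
    have b2 := congrArg Prod.snd h2
    simp at a1 a2 b1 b2
    rcases a2 with rfl | a2
    · simp at a1
    · rw [a2] at b2; simp at b2
  rw [ddPow_three hf]
  set a := jet 2 0 f p
  set b := jet 1 1 f p
  set c := jet 0 2 f p
  -- A symmetric matrix with zero trace and zero determinant is zero, and then every line would be
  -- asymptotic.
  have habc : a + c ≠ 0 := by
    intro hac
    obtain ⟨w, hw⟩ := hw
    rw [ddPow_two hf] at hw
    have hh' : a * c - b ^ 2 = 0 := hh
    have hb : b ^ 2 + a ^ 2 = 0 := by linear_combination a * hac - hh'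
    have ha0 : a = 0 := by nlinarith [sq_nonneg a, sq_nonneg b]
    have hb0 : b = 0 := by nlinarith [sq_nonneg a, sq_nonneg b]
    have hc0 : c = 0 := by linarith
    apply hw
    change w.1 ^ 2 * a + 2 * w.1 * w.2 * b + w.2 ^ 2 * c = 0
    rw [ha0, hb0, hc0]; ring
  apply (mul_eq_zero.mp (?_ : (a + c) * (_ : ℝ) = 0)).resolve_left habc
  -- A form with kernel `v` is `(a + c)/|v|²` times the square of the scalar product with `v`
  -- rotated by a right angle. Substituting this, the derivative of the Hessian along `v` becomes a
  -- nonzero multiple of the cubic form at `v`.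
  have k1 : a * (v.1 ^ 2 + v.2 ^ 2) = (a + c) * v.2 ^ 2 := by linear_combination v.1 * e1 - v.2 * e2
  have k2 : b * (v.1 ^ 2 + v.2 ^ 2) = - (a + c) * (v.1 * v.2) := by
    linear_combination v.2 * e1 + v.1 * e2
  have k3 : c * (v.1 ^ 2 + v.2 ^ 2) = (a + c) * v.1 ^ 2 := by linear_combination v.2 * e2 - v.1 * e1
  linear_combination (v.1 ^ 2 + v.2 ^ 2) * htan - k1 * (v.1 * jet 1 2 f p + v.2 * jet 0 3 f p)
    - k3 * (v.1 * jet 3 0 f p + v.2 * jet 2 1 f p) + 2 * k2 * (v.1 * jet 2 1 f p + v.2 * jet 1 2 f p)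

variable {s t : ℝ × Plane → ℝ}

theorem eventually_ne_zero {k : ℝ × Plane → ℝ} (hk : ContDiff ℝ ∞ k) (h0 : k 0 ≠ 0) :
    ∀ᶠ z in 𝓝 (0 : ℝ × Plane), k z ≠ 0 := hk.continuous.continuousAt.eventually_ne h0

theorem eventually_pos {k : ℝ × Plane → ℝ} (hk : ContDiff ℝ ∞ k) (h0 : 0 < k 0) :
    ∀ᶠ z in 𝓝 (0 : ℝ × Plane), 0 < k z := hk.continuous.continuousAt.eventually (lt_mem_nhds h0)

/-- A parabolic point whose asymptotic direction is a root of the cubic form is a negative godron. -/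
theorem NormalFamily.posGodron (h : NormalFamily σ G) (hs : ContDiff ℝ ∞ s) (hs1 : s 0 ^ 2 + σ ≠ 0)
    (hroot : ∀ᶠ z in 𝓝 (0 : ℝ × Plane), s z ^ 3 * J G 3 0 z + 3 * s z ^ 2 * J G 2 1 z
      + 3 * s z * J G 1 2 z + J G 0 3 z = 0) :
    ∀ᶠ z in 𝓝 (0 : ℝ × Plane), ∀ τ : ℝ, τ ≠ 0 → J G 2 0 z = τ * 1 → J G 1 1 z = τ * (- s z) →
      J G 0 2 z = τ * s z ^ 2 → PosGodron (G z.1) z.2 := by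
  have sm := fun i j => h.smooth.jet i j
  have s20 := sm 2 0
  have s30 := sm 3 0
  have s21 := sm 2 1
  have s12 := sm 1 2
  have s40 := sm 4 0
  have s31 := sm 3 1
  have s22 := sm 2 2
  have s13 := sm 1 3
  have s04 := sm 0 4
  let m : ℝ × Plane → ℝ := fun z => s z ^ 2 * J G 3 0 z + 2 * s z * J G 2 1 z + J G 1 2 z
  have hm : ContDiff ℝ ∞ m := by simp only [m]; fun_prop
  have hm0 : m 0 ≠ 0 := by simp only [m, h.j30, h.j21, h.j12]; simpa using hs1
  let D : ℝ × Plane → ℝ := fun z => 3 * m z ^ 2 - J G 2 0 z * (s z ^ 4 * J G 4 0 z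
    + 4 * s z ^ 3 * J G 3 1 z + 6 * s z ^ 2 * J G 2 2 z + 4 * s z * J G 1 3 z + J G 0 4 z)
  have hD : ContDiff ℝ ∞ D := by simp only [D]; fun_prop
  -- At the umbilic `f₂₀ = 0`, so the quartic term drops out and `3 (m 0)²` is left. The sign does
  -- not depend on the fourth derivatives.
  have hD0 : 0 < D 0 := by simp only [D, h.j20]; simp only [zero_mul, sub_zero]; positivity
  filter_upwards [hroot, eventually_ne_zero hm hm0, eventually_pos hD hD0] with z r1 r2 r3 τ hτ e1 e2 e3
  have hf := h.smooth.slice z.1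
  have e1' : jet 2 0 (G z.1) z.2 = τ * 1 := e1
  have e2' : jet 1 1 (G z.1) z.2 = τ * (- s z) := e2
  have e3' : jet 0 2 (G z.1) z.2 = τ * s z ^ 2 := e3
  refine ⟨(s z, 1), (1, 0), ⟨by simp, ?_, ?_, ?_, ?_⟩, ?_, ?_⟩
  · intro w
    rw [ddPow_two hf, e1', e2', e3']
    constructor
    · intro hw
      have : τ * (w.1 - s z * w.2) ^ 2 = 0 := by linear_combination hw
      have h2 : w.1 - s z * w.2 = 0 := by
        rcases mul_eq_zero.mp this with h | h
        · exact absurd h hτ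
        · exact pow_eq_zero_iff two_ne_zero |>.mp h
      refine ⟨w.2, ?_⟩
      ext
      · simp; linarith
      · simp
    · rintro ⟨c, rfl⟩
      simp; ring
  · rw [hess_eq, e1', e2', e3']; ring
  · intro hc
    have := congrArg (fun L : Plane →L[ℝ] ℝ => L (1, 0)) hc
    simp only [zero_apply] at this
    rw [fderiv_hess hf, e1', e2', e3'] at this
    have h2 : τ * m z = 0 := by
      simp only [m, J]; linear_combination this
    rcases mul_eq_zero.mp h2 with h | h
    · exact hτ h
    · exact r2 h
  · rw [fderiv_hess hf, e1', e2', e3']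
    simp only [J] at r1
    linear_combination τ * r1
  · rw [linearIndependent_pair_iff]; simp
  · rw [dd_three hf, ddPow_two hf, ddPow_four hf]
    have : D z = 3 * (s z ^ 2 * jet 3 0 (G z.1) z.2 + 2 * s z * jet 2 1 (G z.1) z.2
      + jet 1 2 (G z.1) z.2) ^ 2 - jet 2 0 (G z.1) z.2 * (s z ^ 4 * jet 4 0 (G z.1) z.2
    + 4 * s z ^ 3 * jet 3 1 (G z.1) z.2 + 6 * s z ^ 2 * jet 2 2 (G z.1) z.2
    + 4 * s z * jet 1 3 (G z.1) z.2 + jet 0 4 (G z.1) z.2) := rfl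
    rw [this] at r3
    simp only
    convert! r3 using 1
    ring

/-- A point where the quadratic form is proportional to the product of two linear factors of the
cubic form is a hyperbonode. -/
theorem NormalFamily.hyperbonode (h : NormalFamily σ G) (hs : ContDiff ℝ ∞ s) (ht : ContDiff ℝ ∞ t)
    (hst : s 0 ≠ t 0) (hst1 : s 0 ^ 2 * t 0 + σ * (2 * s 0 + t 0) ≠ 0)
    (hst2 : t 0 ^ 2 * s 0 + σ * (2 * t 0 + s 0) ≠ 0)
    (hs0 : s 0 ^ 3 + 3 * σ * s 0 = 0)
    (hroots : ∀ᶠ z in 𝓝 (0 : ℝ × Plane), s z ^ 3 * J G 3 0 z + 3 * s z ^ 2 * J G 2 1 z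
      + 3 * s z * J G 1 2 z + J G 0 3 z = 0)
    (hroott : ∀ᶠ z in 𝓝 (0 : ℝ × Plane), t z ^ 3 * J G 3 0 z + 3 * t z ^ 2 * J G 2 1 z
      + 3 * t z * J G 1 2 z + J G 0 3 z = 0) :
    ∀ᶠ z in 𝓝 (0 : ℝ × Plane), ∀ τ : ℝ, τ ≠ 0 → J G 2 0 z = τ * 1 →
      J G 1 1 z = τ * (- ((s z + t z) / 2)) → J G 0 2 z = τ * (s z * t z) →
      IsHyperbonode (G z.1) z.2 ∧ IsNode (G z.1) z.2 := by
  let u : ℝ × Plane → Plane := fun z => (s z, 1)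
  let w : ℝ × Plane → Plane := fun z => (t z, 1)
  have hu : ContDiff ℝ ∞ u := hs.prodMk contDiff_const
  have hw : ContDiff ℝ ∞ w := ht.prodMk contDiff_const
  let E : ℝ × Plane → ℝ := fun z =>
    (2 * dd (u z) (dd (w z) (G z.1)) z.2 * dd (u z) (dd (u z) (dd (u z) (dd (u z) (G z.1)))) z.2
      - 3 * dd (u z) (dd (u z) (dd (w z) (G z.1))) z.2 * dd (u z) (dd (u z) (dd (u z) (G z.1))) z.2) *
    (2 * dd (u z) (dd (w z) (G z.1)) z.2 * dd (w z) (dd (w z) (dd (w z) (dd (w z) (G z.1)))) z.2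
      - 3 * dd (w z) (dd (w z) (dd (u z) (G z.1))) z.2 * dd (w z) (dd (w z) (dd (w z) (G z.1))) z.2) -
    (2 * dd (u z) (dd (w z) (G z.1)) z.2 * dd (w z) (dd (u z) (dd (u z) (dd (u z) (G z.1)))) z.2
      - 3 * dd (u z) (dd (u z) (dd (w z) (G z.1))) z.2 * dd (w z) (dd (u z) (dd (u z) (G z.1))) z.2) *
    (2 * dd (u z) (dd (w z) (G z.1)) z.2 * dd (u z) (dd (w z) (dd (w z) (dd (w z) (G z.1)))) z.2
      - 3 * dd (w z) (dd (w z) (dd (u z) (G z.1))) z.2 * dd (u z) (dd (w z) (dd (w z) (G z.1))) z.2)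
  have hE : ContDiff ℝ ∞ E := by
    have k1 := h.smooth.dd_two_contDiff hu hw
    have k2 := h.smooth.dd_four_contDiff hu hu hu hu
    have k3 := h.smooth.dd_three_contDiff hu hu hw
    have k4 := h.smooth.dd_three_contDiff hu hu hu
    have k5 := h.smooth.dd_four_contDiff hw hw hw hw
    have k6 := h.smooth.dd_three_contDiff hw hw hu
    have k7 := h.smooth.dd_three_contDiff hw hw hw
    have k8 := h.smooth.dd_four_contDiff hw hu hu hu
    have k9 := h.smooth.dd_three_contDiff hw hu hu
    have k10 := h.smooth.dd_four_contDiff hu hw hw hw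
    have k11 := h.smooth.dd_three_contDiff hu hw hw
    exact ((((contDiff_const.mul k1).mul k2).sub ((contDiff_const.mul k3).mul k4)).mul
      (((contDiff_const.mul k1).mul k5).sub ((contDiff_const.mul k6).mul k7))).sub
      ((((contDiff_const.mul k1).mul k8).sub ((contDiff_const.mul k3).mul k9)).mul
      (((contDiff_const.mul k1).mul k10).sub ((contDiff_const.mul k6).mul k11)))
  have hf0 := h.smooth.slice 0
  -- At the umbilic `∂ᵤ∂_w f` and `∂ᵤ³ f` vanish, and the determinant reduces to `-9 (∂ᵤ²∂_w f)²
  -- (∂_w²∂ᵤ f)²`.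
  have E0 : E 0 ≠ 0 := by
    have a20 : jet 2 0 (G 0) 0 = 0 := h.j20
    have a11 : jet 1 1 (G 0) 0 = 0 := h.j11
    have a02 : jet 0 2 (G 0) 0 = 0 := h.j02
    have a30 : jet 3 0 (G 0) 0 = 1 := h.j30
    have a21 : jet 2 1 (G 0) 0 = 0 := h.j21
    have a12 : jet 1 2 (G 0) 0 = σ := h.j12
    have a03 : jet 0 3 (G 0) 0 = 0 := h.j03
    have b0 : dd (u 0) (dd (w 0) (G 0)) 0 = 0 := by simp only [dd_two hf0, a20, a11, a02]; ring
    have c1 : dd (u 0) (dd (u 0) (dd (u 0) (G 0))) 0 = 0 := by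
      simp only [dd_three hf0, a30, a21, a12, a03, u]; linear_combination hs0
    have c2 : dd (u 0) (dd (u 0) (dd (w 0) (G 0))) 0 = s 0 ^ 2 * t 0 + σ * (2 * s 0 + t 0) := by
      simp only [dd_three hf0, a30, a21, a12, a03, u, w]; ring
    have c3 : dd (w 0) (dd (w 0) (dd (u 0) (G 0))) 0 = t 0 ^ 2 * s 0 + σ * (2 * t 0 + s 0) := by
      simp only [dd_three hf0, a30, a21, a12, a03, u, w]; ring
    have c4 : dd (w 0) (dd (u 0) (dd (u 0) (G 0))) 0 = s 0 ^ 2 * t 0 + σ * (2 * s 0 + t 0) := by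
      simp only [dd_three hf0, a30, a21, a12, a03, u, w]; ring
    have c5 : dd (u 0) (dd (w 0) (dd (w 0) (G 0))) 0 = t 0 ^ 2 * s 0 + σ * (2 * t 0 + s 0) := by
      simp only [dd_three hf0, a30, a21, a12, a03, u, w]; ring
    simp only [E, Prod.fst_zero, Prod.snd_zero]
    rw [b0, c1, c2, c3, c4, c5]
    have := mul_ne_zero (pow_ne_zero 2 hst1) (pow_ne_zero 2 hst2)
    intro hc
    apply this
    linear_combination (-1 / 9) * hc
  have hne : ∀ᶠ z in 𝓝 (0 : ℝ × Plane), s z - t z ≠ 0 :=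
    eventually_ne_zero (hs.sub ht) (sub_ne_zero.mpr hst)
  filter_upwards [hroots, hroott, eventually_ne_zero hE E0, hne] with z r1 r2 r3 r4 τ hτ e1 e2 e3
  have hf := h.smooth.slice z.1
  have e1' : jet 2 0 (G z.1) z.2 = τ * 1 := e1
  have e2' : jet 1 1 (G z.1) z.2 = τ * (- ((s z + t z) / 2)) := e2
  have e3' : jet 0 2 (G z.1) z.2 = τ * (s z * t z) := e3
  constructor
  · refine isHyperbonode_of_det hf (u := u z) (w := w z) ?_ ?_ ?_ ?_ ?_ ?_ r3
    · rw [linearIndependent_pair_iff]; simp only [u, w]; intro hc; apply r4; linarith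
    · rw [ddPow_two hf, e1', e2', e3']; simp only [u]; ring
    · rw [ddPow_two hf, e1', e2', e3']; simp only [w]; ring
    · simp only [dd_two hf, e1', e2', e3', u, w]
      have : τ * (s z - t z) ^ 2 ≠ 0 := mul_ne_zero hτ (pow_ne_zero 2 r4)
      intro hc; apply this; linear_combination (-2) * hc
    · rw [ddPow_three hf]; simp only [u]; simp only [J] at r1; linear_combination r1
    · rw [ddPow_three hf]; simp only [w]; simp only [J] at r2; linear_combination r2
  · set a := jet 3 0 (G z.1) z.2 with ha
    set b := jet 2 1 (G z.1) z.2 with hb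
    set c := jet 1 2 (G z.1) z.2 with hc
    set d := jet 0 3 (G z.1) z.2 with hd
    have r1' : s z ^ 3 * a + 3 * s z ^ 2 * b + 3 * s z * c + d = 0 := r1
    have r2' : t z ^ 3 * a + 3 * t z ^ 2 * b + 3 * t z * c + d = 0 := r2
    have c1 : a * (s z ^ 2 + s z * t z + t z ^ 2) + 3 * b * (s z + t z) + 3 * c = 0 := by
      apply (mul_eq_zero.mp (?_ : (s z - t z) * _ = 0)).resolve_left r4
      linear_combination r1' - r2'
    -- The third linear factor of the cubic form: by Vieta its root is `-3b/a - s - t`, and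
    -- multiplying by `a` removes the denominator.
    refine ⟨(1 / τ) • (a • LinearMap.fst ℝ ℝ ℝ + (3 * b + a * (s z + t z)) • LinearMap.snd ℝ ℝ ℝ), ?_⟩
    intro v
    rw [ddPow_two hf, ddPow_three hf, e1', e2', e3', ← ha, ← hb, ← hc, ← hd]
    simp only [LinearMap.smul_apply, LinearMap.add_apply, LinearMap.fst_apply, LinearMap.snd_apply,
      smul_eq_mul]
    field_simp
    linear_combination (v.1 * v.2 ^ 2 - s z * v.2 ^ 3) * c1 + v.2 ^ 3 * r1'

/-- At a hyperbolic node, two asymptotic directions are roots of the cubic form. -/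
theorem cubic_eq_zero_of_hyperbolic_node {f : Plane → ℝ} (hf : ContDiff ℝ ∞ f) {p : Plane}
    (hh : hess f p < 0) (hn : IsNode f p) : ∃ v w : Plane, v.1 * w.2 - v.2 * w.1 ≠ 0 ∧
      ddPow 2 v f p = 0 ∧ ddPow 2 w f p = 0 ∧ ddPow 3 v f p = 0 ∧ ddPow 3 w f p = 0 := by
  obtain ⟨l, hl⟩ := hn
  have key : ∃ v w : Plane, v.1 * w.2 - v.2 * w.1 ≠ 0 ∧
      ddPow 2 v f p = 0 ∧ ddPow 2 w f p = 0 := by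
    rw [hess_eq] at hh
    simp only [ddPow_two hf]
    set a := jet 2 0 f p
    set b := jet 1 1 f p
    set c := jet 0 2 f p
    have hk : 0 < b ^ 2 - a * c := by linarith
    set k := √(b ^ 2 - a * c) with hkd
    have hk2 : k ^ 2 = b ^ 2 - a * c := Real.sq_sqrt hk.le
    have hk0 : 0 < k := Real.sqrt_pos.mpr hk
    by_cases ha : a = 0
    · have hb : b ≠ 0 := by rintro hb; rw [ha, hb] at hk; simp at hk
      refine ⟨(1, 0), (c, -2 * b), ?_, ?_, ?_⟩
      · simpa using hb
      · simp [ha]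
      · simp only [ha]; ring
    · refine ⟨(-b + k, a), (-b - k, a), ?_, ?_, ?_⟩
      · simp only
        have : (-b + k) * a - a * (-b - k) = 2 * k * a := by ring
        rw [this]; positivity
      · simp only; linear_combination a * hk2
      · simp only; linear_combination a * hk2
  obtain ⟨v, w, h1, h2, h3⟩ := key
  exact ⟨v, w, h1, h2, h3, by rw [hl, h2, mul_zero], by rw [hl, h3, mul_zero]⟩

end PointwiseAnalysis

/-! ### The definite factor of the cubic form and ellipnodes -/

section Ellipnode

variable {G : ℝ → Plane → ℝ} {s : ℝ × Plane → ℝ}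

/-- The coefficients of the quadratic factor of the cubic form, complementary to the root `s`. -/
noncomputable def cofactor₂ (G : ℝ → Plane → ℝ) (s : ℝ × Plane → ℝ) (z : ℝ × Plane) : ℝ :=
  (3 * J G 2 1 z + J G 3 0 z * s z) / 2

noncomputable def cofactor₃ (G : ℝ → Plane → ℝ) (s : ℝ × Plane → ℝ) (z : ℝ × Plane) : ℝ :=
  3 * J G 1 2 z + 3 * J G 2 1 z * s z + J G 3 0 z * s z ^ 2

theorem cofactor₂_contDiff (hG : SmoothFamily G) (hs : ContDiff ℝ ∞ s) :
    ContDiff ℝ ∞ (cofactor₂ G s) := by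
  have a1 := hG.jet 2 1
  have a2 := hG.jet 3 0
  unfold cofactor₂; fun_prop

theorem cofactor₃_contDiff (hG : SmoothFamily G) (hs : ContDiff ℝ ∞ s) :
    ContDiff ℝ ∞ (cofactor₃ G s) := by
  have a1 := hG.jet 2 1
  have a2 := hG.jet 3 0
  have a3 := hG.jet 1 2
  unfold cofactor₃; fun_prop

/-- At the umbilic the cofactor of the real root is `x² + 3y²`, and positive definiteness is an open
condition. -/
theorem NormalFamily.cofactor_pos (h : NormalFamily 1 G) (hs : ContDiff ℝ ∞ s) (hs0 : s 0 = 0) :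
    ∀ᶠ z in 𝓝 (0 : ℝ × Plane), 0 < J G 3 0 z ∧
      0 < J G 3 0 z * cofactor₃ G s z - cofactor₂ G s z ^ 2 := by
  have h1 := h.smooth.jet 3 0
  have h2 := cofactor₂_contDiff h.smooth hs
  have h3 := cofactor₃_contDiff h.smooth hs
  have e1 : 0 < J G 3 0 0 := by rw [h.j30]; exact one_pos
  have e2 : 0 < J G 3 0 0 * cofactor₃ G s 0 - cofactor₂ G s 0 ^ 2 := by
    simp only [cofactor₂, cofactor₃, h.j30, h.j21, h.j12, hs0]; norm_num
  exact (eventually_pos h1 e1).and (eventually_pos ((h1.mul h3).sub (h2.pow 2)) e2)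

theorem cubic_factor (hG : SmoothFamily G) {z : ℝ × Plane}
    (hroot : s z ^ 3 * J G 3 0 z + 3 * s z ^ 2 * J G 2 1 z + 3 * s z * J G 1 2 z + J G 0 3 z = 0)
    (v : Plane) : ddPow 3 v (G z.1) z.2 = (v.1 - s z * v.2) *
      (v.1 ^ 2 * J G 3 0 z + 2 * v.1 * v.2 * cofactor₂ G s z + v.2 ^ 2 * cofactor₃ G s z) := by
  rw [cubic_J hG, cofactor₂, cofactor₃]
  linear_combination v.2 ^ 3 * hroot

/-- A point where the quadratic form is proportional to the definite factor of the cubic form is an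
ellipnode. -/
theorem NormalFamily.ellipnode (h : NormalFamily 1 G) (hs : ContDiff ℝ ∞ s) (hs0 : s 0 = 0)
    (hroot : ∀ᶠ z in 𝓝 (0 : ℝ × Plane), s z ^ 3 * J G 3 0 z + 3 * s z ^ 2 * J G 2 1 z
      + 3 * s z * J G 1 2 z + J G 0 3 z = 0) :
    ∀ᶠ z in 𝓝 (0 : ℝ × Plane), ∀ τ : ℝ, τ ≠ 0 → J G 2 0 z = τ * J G 3 0 z →
      J G 1 1 z = τ * cofactor₂ G s z → J G 0 2 z = τ * cofactor₃ G s z →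
      IsEllipnode (G z.1) z.2 ∧ IsNode (G z.1) z.2 := by
  let Δ : ℝ × Plane → ℝ := fun z => J G 3 0 z * cofactor₃ G s z - cofactor₂ G s z ^ 2
  let x : ℝ × Plane → ℝ := fun z => - cofactor₂ G s z / J G 3 0 z
  let y : ℝ × Plane → ℝ := fun z => √(Δ z) / J G 3 0 z
  have h2 := (cofactor₂_contDiff h.smooth hs).continuous
  have h3 := (cofactor₃_contDiff h.smooth hs).continuous
  have sm := fun i j => (h.smooth.jet i j).continuous
  have c30 := (sm 3 0).continuousAt (x := 0)
  have c20 := (sm 2 0).continuousAt (x := 0)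
  have c21 := (sm 2 1).continuousAt (x := 0)
  have c12 := (sm 1 2).continuousAt (x := 0)
  have c40 := (sm 4 0).continuousAt (x := 0)
  have c31 := (sm 3 1).continuousAt (x := 0)
  have c22 := (sm 2 2).continuousAt (x := 0)
  have c13 := (sm 1 3).continuousAt (x := 0)
  have c04 := (sm 0 4).continuousAt (x := 0)
  have c03 := (sm 0 3).continuousAt (x := 0)
  have hΔ0 : Δ 0 = 3 := by
    simp only [Δ, cofactor₂, cofactor₃, h.j30, h.j21, h.j12, hs0]; norm_num
  have hx : ContinuousAt x 0 := h2.continuousAt.neg.div c30 (by rw [h.j30]; exact one_ne_zero)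
  have hΔ : Continuous Δ := ((sm 3 0).mul h3).sub (h2.pow 2)
  have hy : ContinuousAt y 0 := hΔ.continuousAt.sqrt.div c30 (by rw [h.j30]; exact one_ne_zero)
  have hx0 : x 0 = 0 := by simp [x, cofactor₂, h.j21, hs0]
  have hy0 : y 0 = √3 := by simp only [y, hΔ0, h.j30, div_one]
  let E : ℝ × Plane → ℝ := fun z => ellRe (G z.1) z.2 (x z) (y z) (1, 0) * ellIm (G z.1) z.2 (x z) (y z) (0, 1)
      - ellRe (G z.1) z.2 (x z) (y z) (0, 1) * ellIm (G z.1) z.2 (x z) (y z) (1, 0)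
  have eRe : ∀ z d, ellRe (G z.1) z.2 (x z) (y z) d =
    2 * J G 2 0 z * y z * ((x z ^ 3 - 3 * x z * y z ^ 2) * (d.1 * J G 4 0 z + d.2 * J G 3 1 z)
    + 3 * (x z ^ 2 - y z ^ 2) * (d.1 * J G 3 1 z + d.2 * J G 2 2 z) + 3 * x z * (d.1 * J G 2 2 z + d.2 * J G 1 3 z)
      + (d.1 * J G 1 3 z + d.2 * J G 0 4 z))
    - 3 * (((x z ^ 2 - y z ^ 2) * J G 3 0 z + 2 * x z * J G 2 1 z + J G 1 2 z) *
      (2 * x z * y z * (d.1 * J G 3 0 z + d.2 * J G 2 1 z) + 2 * y z * (d.1 * J G 2 1 z + d.2 * J G 1 2 z))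
    + (2 * x z * y z * J G 3 0 z + 2 * y z * J G 2 1 z) *
      ((x z ^ 2 - y z ^ 2) * (d.1 * J G 3 0 z + d.2 * J G 2 1 z) + 2 * x z * (d.1 * J G 2 1 z + d.2 * J G 1 2 z)
        + (d.1 * J G 1 2 z + d.2 * J G 0 3 z))) := by
    intro z d
    have hf := h.smooth.slice z.1
    simp only [ellRe, dd_jet hf]; rfl
  have eIm : ∀ z d, ellIm (G z.1) z.2 (x z) (y z) d =
    2 * J G 2 0 z * y z * ((3 * x z ^ 2 * y z - y z ^ 3) * (d.1 * J G 4 0 z + d.2 * J G 3 1 z)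
    + 6 * x z * y z * (d.1 * J G 3 1 z + d.2 * J G 2 2 z) + 3 * y z * (d.1 * J G 2 2 z + d.2 * J G 1 3 z))
    + 3 * (((x z ^ 2 - y z ^ 2) * J G 3 0 z + 2 * x z * J G 2 1 z + J G 1 2 z) *
      ((x z ^ 2 - y z ^ 2) * (d.1 * J G 3 0 z + d.2 * J G 2 1 z) + 2 * x z * (d.1 * J G 2 1 z + d.2 * J G 1 2 z)
        + (d.1 * J G 1 2 z + d.2 * J G 0 3 z))
    - (2 * x z * y z * J G 3 0 z + 2 * y z * J G 2 1 z) *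
      (2 * x z * y z * (d.1 * J G 3 0 z + d.2 * J G 2 1 z) + 2 * y z * (d.1 * J G 2 1 z + d.2 * J G 1 2 z))) := by
    intro z d
    have hf := h.smooth.slice z.1
    simp only [ellIm, dd_jet hf]; rfl
  have cRe : ∀ d, ContinuousAt (fun z => ellRe (G z.1) z.2 (x z) (y z) d) 0 := by
    intro d; simp only [eRe]; fun_prop
  have cIm : ∀ d, ContinuousAt (fun z => ellIm (G z.1) z.2 (x z) (y z) d) 0 := by
    intro d; simp only [eIm]; fun_prop
  have hE : ContinuousAt E 0 := ((cRe _).mul (cIm _)).sub ((cRe _).mul (cIm _))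
  -- At the umbilic the complex root is `i√3` and all terms with `f₂₀` vanish. The two differentials
  -- are `12√3 dy` and `12 dx`, so `E 0 = -144√3`.
  have E0 : E 0 ≠ 0 := by
    have h3' : √3 ^ 2 = (3 : ℝ) := Real.sq_sqrt (by norm_num)
    simp only [E, eRe, eIm, h.j20, h.j30, h.j21, h.j12, h.j03, hx0, hy0]
    ring_nf
    rw [show √3 ^ 3 = √3 * √3 ^ 2 by ring, show √3 ^ 5 = √3 * (√3 ^ 2) ^ 2 by ring,
      show √3 ^ 7 = √3 * (√3 ^ 2) ^ 3 by ring, h3']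
    have : (0 : ℝ) < √3 := by positivity
    intro hc
    ring_nf at hc
    linarith
  filter_upwards [hroot, h.cofactor_pos hs hs0, hE.eventually_ne E0] with z r1 r2 r3 τ hτ e1 e2 e3
  have hf := h.smooth.slice z.1
  have hq1 := r2.1.ne'
  have hΔz : √(Δ z) ^ 2 = J G 3 0 z * cofactor₃ G s z - cofactor₂ G s z ^ 2 := Real.sq_sqrt r2.2.le
  have hΔpos : 0 < √(Δ z) := Real.sqrt_pos.mpr r2.2
  have ex : J G 3 0 z * x z = - cofactor₂ G s z := by simp only [x]; field_simp
  have ey : J G 3 0 z ^ 2 * y z ^ 2 = J G 3 0 z * cofactor₃ G s z - cofactor₂ G s z ^ 2 := by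
    rw [← hΔz]; simp only [y]; field_simp
  -- `w1` and `w2` are the real and imaginary parts of the definite factor at `x + iy`. Multiplied
  -- by `x + iy - s` they give the vanishing of the cubic form required below.
  have w1 : (x z ^ 2 - y z ^ 2) * J G 3 0 z + 2 * x z * cofactor₂ G s z + cofactor₃ G s z = 0 := by
    apply mul_left_cancel₀ hq1
    linear_combination (J G 3 0 z * x z + cofactor₂ G s z) * ex - ey
  have w2 : 2 * x z * y z * J G 3 0 z + 2 * cofactor₂ G s z * y z = 0 := by
    linear_combination 2 * y z * ex
  have hy1 : y z ≠ 0 := by simp only [y]; positivity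
  have d2 : 2 * cofactor₂ G s z = 3 * J G 2 1 z + J G 3 0 z * s z := by rw [cofactor₂]; ring
  have d3 : cofactor₃ G s z = 3 * J G 1 2 z + 3 * J G 2 1 z * s z + J G 3 0 z * s z ^ 2 := rfl
  constructor
  · refine isEllipnode_of_det hf (x₀ := x z) (y₀ := y z) ?_ hy1 ?_ ?_ ?_ ?_ r3
    · change J G 2 0 z ≠ 0; rw [e1]; exact mul_ne_zero hτ hq1
    · change J G 2 0 z * x z + J G 1 1 z = 0; rw [e1, e2]; linear_combination τ * ex
    · rw [hess_J]; change J G 2 0 z ^ 2 * y z ^ 2 = _; rw [e1, e2, e3]; linear_combination τ ^ 2 * ey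
    · change (x z ^ 3 - 3 * x z * y z ^ 2) * J G 3 0 z + 3 * (x z ^ 2 - y z ^ 2) * J G 2 1 z
        + 3 * x z * J G 1 2 z + J G 0 3 z = 0
      linear_combination (x z - s z) * w1 - y z * w2 + r1 - (x z ^ 2 - y z ^ 2 - s z * x z) * d2
        - (x z - s z) * d3
    · change (3 * x z ^ 2 * y z - y z ^ 3) * J G 3 0 z + 6 * x z * y z * J G 2 1 z
        + 3 * y z * J G 1 2 z = 0
      linear_combination y z * w1 + (x z - s z) * w2 - (2 * x z * y z - s z * y z) * d2 - y z * d3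
  · refine ⟨(1 / τ) • (LinearMap.fst ℝ ℝ ℝ - s z • LinearMap.snd ℝ ℝ ℝ), ?_⟩
    intro v
    rw [cubic_factor h.smooth r1, quad_J h.smooth, e1, e2, e3]
    simp only [LinearMap.smul_apply, LinearMap.sub_apply, LinearMap.fst_apply, LinearMap.snd_apply,
      smul_eq_mul]
    field_simp

/-- At an elliptic node, the quadratic form is proportional to the definite factor of the cubic
form. -/
theorem proportional_of_elliptic_node (hG : SmoothFamily G) {z : ℝ × Plane}
    (hroot : s z ^ 3 * J G 3 0 z + 3 * s z ^ 2 * J G 2 1 z + 3 * s z * J G 1 2 z + J G 0 3 z = 0)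
    (hpos : 0 < J G 3 0 z ∧ 0 < J G 3 0 z * cofactor₃ G s z - cofactor₂ G s z ^ 2)
    (hn : IsNode (G z.1) z.2) : ∃ τ : ℝ, J G 2 0 z = τ * J G 3 0 z ∧
      J G 1 1 z = τ * cofactor₂ G s z ∧ J G 0 2 z = τ * cofactor₃ G s z := by
  obtain ⟨l, hl⟩ := hn
  have key : ∀ a b : ℝ, (a - s z * b) *
      (a ^ 2 * J G 3 0 z + 2 * a * b * cofactor₂ G s z + b ^ 2 * cofactor₃ G s z)
      = (a * l (1, 0) + b * l (0, 1)) * (a ^ 2 * J G 2 0 z + 2 * a * b * J G 1 1 z + b ^ 2 * J G 0 2 z) := by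
    intro a b
    have := hl (a, b)
    rw [cubic_factor hG hroot, quad_J hG] at this
    have e : l (a, b) = a * l (1, 0) + b * l (0, 1) := by
      have : ((a, b) : Plane) = a • ((1, 0) : Plane) + b • ((0, 1) : Plane) := by ext <;> simp
      rw [this, map_add, map_smul, map_smul]; rfl
    rw [e] at this; exact this
  set l1 := l (1, 0)
  set l2 := l (0, 1)
  set q1 := J G 3 0 z
  set q2 := cofactor₂ G s z
  set q3 := cofactor₃ G s z
  set A := J G 2 0 z
  set B := J G 1 1 z
  set C := J G 0 2 z
  set σ := s z
  have k1 : q1 = l1 * A := by have := key 1 0; linear_combination this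
  have k4 : - σ * q3 = l2 * C := by have := key 0 1; linear_combination this
  have k2 : 2 * q2 - σ * q1 = 2 * l1 * B + l2 * A := by
    linear_combination (1 / 2) * key 1 1 + (1 / 2) * key (-1) 1 - k4
  have k3 : q3 - 2 * σ * q2 = l1 * C + 2 * l2 * B := by
    linear_combination (1 / 2) * key 1 1 - (1 / 2) * key (-1) 1 - k1
  have hl1 : l1 ≠ 0 := by rintro h0; rw [h0, zero_mul] at k1; linarith [hpos.1]
  -- the linear factors agree
  have hroot2 : ∀ b : ℝ, b = l2 + σ * l1 → b = 0 := by
    intro b hb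
    -- The vector `(-l2, l1)` spans the kernel of `l`. The definite factor is positive there, so the
    -- linear factor `v₁ - s v₂` vanishes on it and is proportional to `l`.
    have h1 := key (-l2) l1
    have e : (-l2 - σ * l1) * (l2 ^ 2 * q1 - 2 * l1 * l2 * q2 + l1 ^ 2 * q3) = 0 := by
      linear_combination h1
    have hp : 0 < l2 ^ 2 * q1 - 2 * l1 * l2 * q2 + l1 ^ 2 * q3 := by
      have := quad_pos hpos.1 hpos.2 (v := (-l2, l1)) (by
        intro hc; exact hl1 (congrArg Prod.snd hc))
      simp only at this; linarith
    have := (mul_eq_zero.mp e).resolve_right hp.ne'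
    linarith
  have hl2 : l2 = - σ * l1 := by linarith [hroot2 _ rfl]
  refine ⟨1 / l1, ?_, ?_, ?_⟩
  · rw [k1]; field_simp
  · have : q2 = l1 * B := by rw [hl2] at k2; linear_combination (1 / 2) * k2 + (1 / 2) * σ * k1
    rw [this]; field_simp
  · have h2 : q2 = l1 * B := by rw [hl2] at k2; linear_combination (1 / 2) * k2 + (1 / 2) * σ * k1
    have : q3 = l1 * C := by rw [hl2] at k3; linear_combination k3 + 2 * σ * h2
    rw [this]; field_simp

end Ellipnode

/-! ### From germs to boxes; arcs across a box -/

section Boxes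

/-- Points of `box r` have norm less than `4r`, so radius `r < R/4` keeps the box, and all `|ε| <
r`, inside the ball where `P` holds. -/
theorem eventually_box {P : ℝ × Plane → Prop} (h : ∀ᶠ z in 𝓝 (0 : ℝ × Plane), P z) :
    ∀ᶠ r in 𝓝[>] (0 : ℝ), ∀ ε : ℝ, ∀ p : Plane, |ε| < r → p ∈ box r → P (ε, p) := by
  obtain ⟨R, hR, hball⟩ := Metric.eventually_nhds_iff_ball.mp h
  filter_upwards [Ioo_mem_nhdsGT (show (0 : ℝ) < R / 4 by positivity)] with r hr ε p hε hp
  apply hball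
  rw [mem_ball_zero_iff, Prod.norm_def, max_lt_iff, Real.norm_eq_abs]
  have := norm_lt_of_mem_box hp
  simp only [mem_Ioo] at hr
  constructor
  · simp only; linarith
  · simp only; linarith

theorem eventually_box_subset {V : Set Plane} (hV : V ∈ 𝓝 (0 : Plane)) :
    ∀ᶠ r in 𝓝[>] (0 : ℝ), box r ⊆ V := by
  have h : ∀ᶠ z in 𝓝 (0 : ℝ × Plane), z.2 ∈ V := continuous_snd.continuousAt.eventually hV
  filter_upwards [eventually_box h, self_mem_nhdsWithin] with r hr hr0 p hp
  exact hr 0 p (by simpa using hr0) hp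

/-- After division by `k` the function is increasing in `x`, with linear part `x - cy`. On the lines
`x = ±3r` this linear part has absolute value at least `3r - 2r = r`, while the error is at most
`3r/4`. Hence the zero set is a graph over `y` crossing the box from bottom to top; the proportions
of `box` are chosen for slopes below `2`. -/
theorem eventually_isSmoothArc {φ : Plane → ℝ} (hφ : ContDiff ℝ ∞ φ) (h0 : φ 0 = 0) {c k : ℝ}
    (hc : |c| < 2) (hk : k ≠ 0) (hd : ∀ d : Plane, fderiv ℝ φ 0 d = k * (d.1 - c * d.2)) :
    ∀ᶠ r in 𝓝[>] (0 : ℝ), ∀ d : Plane, d ≠ 0 → d.1 = c * d.2 →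
      IsSmoothArc {p ∈ box r | φ p = 0} (box r) d := by
  let g : Plane → ℝ := fun p => k⁻¹ * φ p
  have hg : ContDiff ℝ ∞ g := contDiff_const.mul hφ
  have hgd : ∀ p d, fderiv ℝ g p d = k⁻¹ * fderiv ℝ φ p d := by
    intro p d
    have := ((hφ.differentiable (by simp) p).hasFDerivAt.const_mul k⁻¹).fderiv
    simp only [g]
    rw [this]; simp
  have hg0 : ∀ d : Plane, fderiv ℝ g 0 d = d.1 - c * d.2 := by
    intro d; rw [hgd, hd]; field_simp
  have c1 : ∀ᶠ z in 𝓝 (0 : ℝ × Plane), 0 < fderiv ℝ g z.2 (1, 0) := by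
    have hc : Continuous (fun z : ℝ × Plane => fderiv ℝ g z.2 (1, 0)) := by
      have := hg.continuous_fderiv (by simp)
      fun_prop
    exact hc.continuousAt.eventually (lt_mem_nhds (by simp [hg0]))
  have c2 : ∀ᶠ z in 𝓝 (0 : ℝ × Plane), |g z.2 - (z.2.1 - c * z.2.2)| ≤ 1 / 4 * ‖z.2‖ := by
    have := (hg.differentiable (by simp) 0).hasFDerivAt.isLittleO.def
      (show (0 : ℝ) < 1 / 4 by norm_num)
    have h2 : Tendsto (fun z : ℝ × Plane => z.2) (𝓝 0) (𝓝 0) := continuous_snd.tendsto _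
    filter_upwards [h2.eventually this] with z hz
    simpa [hg0, g, h0] using hz
  filter_upwards [eventually_box c1, eventually_box c2, self_mem_nhdsWithin] with r h1 h2 hr d hd0 hdc
  have hr0 : (0 : ℝ) < r := hr
  have hr1 : |(0 : ℝ)| < r := by simpa using hr0
  have hzero : ∀ p, φ p = 0 ↔ g p = 0 := by
    intro p; simp [g, hk]
  have hmono : ∀ x x' y, (x, y) ∈ box r → (x', y) ∈ box r → x < x' → g (x, y) < g (x', y) := by
    intro x x' y hx hx' hxx
    have hd : ∀ t, HasDerivAt (fun t => g (t, y)) (fderiv ℝ g (t, y) (1, 0)) t := by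
      intro t
      have e1 : HasDerivAt (fun t : ℝ => (t, y)) ((1 : ℝ), (0 : ℝ)) t :=
        (hasDerivAt_id t).prodMk (hasDerivAt_const t y)
      exact (hg.differentiable (by simp) (t, y)).hasFDerivAt.comp_hasDerivAt t e1
    have hm : StrictMonoOn (fun t => g (t, y)) (Icc x x') := by
      apply strictMonoOn_of_deriv_pos (convex_Icc _ _)
      · exact fun t _ => (hd t).continuousAt.continuousWithinAt
      · intro t ht
        rw [interior_Icc] at ht
        rw [(hd t).deriv]
        refine h1 0 (t, y) hr1 ⟨⟨?_, ?_⟩, hx.2⟩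
        · exact hx.1.1.trans ht.1
        · exact ht.2.trans hx'.1.2
    exact hm (left_mem_Icc.mpr hxx.le) (right_mem_Icc.mpr hxx.le) hxx
  have hcb : ∀ y ∈ Ioo (-r) r, |c * y| ≤ 2 * r := by
    intro y hy
    rw [abs_mul]
    have : |y| ≤ r := (abs_lt.mpr hy).le
    have := abs_nonneg y
    have := abs_nonneg c
    nlinarith
  have hnorm : ∀ y ∈ Ioo (-r) r, ∀ x : ℝ, |x| = 3 * r → ‖((x, y) : Plane)‖ ≤ 3 * r := by
    intro y hy x hx
    rw [Prod.norm_def, max_le_iff, Real.norm_eq_abs, Real.norm_eq_abs]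
    exact ⟨hx.le, by simp only; linarith [(abs_lt.mpr hy)]⟩
  have a3 : |3 * r| = 3 * r := abs_of_pos (by positivity)
  obtain ⟨α, hα, hb, hgr⟩ := exists_graph (r := r) (g := g) hg.continuous.continuousOn
    (fun x x' y hx hx' hxx h => h.trans_lt (hmono x x' y hx hx' hxx))
    (by
      intro y hy
      have := h2 0 (-(3 * r), y) hr1 ⟨⟨by simp only; linarith, by simp only; linarith⟩, hy⟩
      have h3 := hnorm y hy (-(3 * r)) (by rw [abs_neg, a3])
      have h4 := abs_le.mp (hcb y hy)
      have h5 := abs_le.mp this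
      simp only at h5
      linarith)
    (by
      intro y hy
      have := h2 0 (3 * r, y) hr1 ⟨⟨by simp only; linarith, by simp only; linarith⟩, hy⟩
      have h3 := hnorm y hy (3 * r) a3
      have h4 := abs_le.mp (hcb y hy)
      have h5 := abs_le.mp this
      simp only at h5
      linarith)
  refine ⟨hd0, φ, hφ.contDiffOn, rfl, ?_, ?_, ?_, ?_⟩
  · rintro q ⟨hq, _⟩ hc
    have := h1 0 q hr1 hq
    rw [hgd] at this
    simp [hc] at this
  · apply graph_homeomorph_real hr0 hα hb
    ext p
    simp only [mem_ofPred_eq]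
    refine and_congr_right fun hp => ?_
    rw [hzero]; exact (hgr p hp).1
  · exact ⟨zero_mem_box hr0, h0⟩
  · rw [hd, hdc]; simp

theorem pos_of_isPreconnected {S : Set Plane} (hS : IsPreconnected S) {f : Plane → ℝ}
    (hf : Continuous f) (hne : ∀ p ∈ S, f p ≠ 0) {q : Plane} (hq : q ∈ S) (hpos : 0 < f q)
    {p : Plane} (hp : p ∈ S) : 0 < f p := by
  by_contra! hc
  obtain ⟨x, hx, h0⟩ := hS.intermediate_value hp hq hf.continuousOn ⟨hc, hpos.le⟩
  exact hne x hx h0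

end Boxes

/-! ### Flecnodal points, biflecnodes and godrons in terms of roots -/

section Flecnodal

variable {σ : ℝ} {G : ℝ → Plane → ℝ} {ι : Type*} {s : ι → ℝ × Plane → ℝ} {z : ℝ × Plane}

/-- The value of the quadratic form on the root `(s, 1)` of the cubic form. -/
noncomputable def rootQuad (G : ℝ → Plane → ℝ) (s : ℝ × Plane → ℝ) (z : ℝ × Plane) : ℝ :=
  s z ^ 2 * J G 2 0 z + 2 * s z * J G 1 1 z + J G 0 2 z

/-- The index type consists of one element for `D₄⁺` and of three for `D₄⁻`. In both cases the roots
`s i` exhaust the real zeros of the cubic form, so the flecnodal set is the union of the zero sets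
of the functions `rootQuad`. -/
theorem isFlecnodal_iff (hG : SmoothFamily G)
    (hroot : ∀ i, s i z ^ 3 * J G 3 0 z + 3 * s i z ^ 2 * J G 2 1 z
      + 3 * s i z * J G 1 2 z + J G 0 3 z = 0)
    (hcomp : ∀ v, ddPow 3 v (G z.1) z.2 = 0 → ∃ i, v.1 = s i z * v.2) :
    IsFlecnodal (G z.1) z.2 ↔ ∃ i, rootQuad G (s i) z = 0 := by
  constructor
  · rintro ⟨v, hv, h2, h3⟩
    obtain ⟨i, hi⟩ := hcomp v h3
    refine ⟨i, ?_⟩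
    rw [quad_J hG, hi] at h2
    have h4 : v.2 ≠ 0 := by
      intro h; apply hv; ext
      · rw [hi, h]; simp
      · exact h
    apply (mul_eq_zero.mp (?_ : v.2 ^ 2 * rootQuad G (s i) z = 0)).resolve_left (pow_ne_zero 2 h4)
    rw [rootQuad]; linear_combination h2
  · rintro ⟨i, hi⟩
    refine ⟨(s i z, 1), by simp, ?_, ?_⟩
    · rw [quad_J hG]; rw [rootQuad] at hi; simp only; linear_combination hi
    · rw [cubic_J hG]; simp only; linear_combination hroot i

theorem not_isBiflecnode
    (hcomp : ∀ v, ddPow 3 v (G z.1) z.2 = 0 → ∃ i, v.1 = s i z * v.2) (hG : SmoothFamily G)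
    (hq : ∀ i, ddPow 4 (s i z, 1) (G z.1) z.2 ≠ 0) : ¬ IsBiflecnode (G z.1) z.2 := by
  rintro ⟨v, hv, -, h3, h4⟩
  obtain ⟨i, hi⟩ := hcomp v h3
  have h5 : v.2 ≠ 0 := by
    intro h; apply hv; ext
    · rw [hi, h]; simp
    · exact h
  apply hq i
  rw [quartic_J hG] at h4 ⊢
  rw [hi] at h4
  apply (mul_eq_zero.mp (?_ : v.2 ^ 4 * _ = 0)).resolve_left (pow_ne_zero 4 h5)
  simp only
  linear_combination h4

/-- The kernel of the quadratic form at a godron is spanned by some `(s i, 1)`, and a form with this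
kernel is a multiple of the square of `v₁ - s i v₂`. -/
theorem ray_of_isGodron (hG : SmoothFamily G)
    (hcomp : ∀ v, ddPow 3 v (G z.1) z.2 = 0 → ∃ i, v.1 = s i z * v.2)
    (hg : IsGodron (G z.1) z.2) : ∃ i, ∃ τ : ℝ, J G 2 0 z = τ * 1 ∧ J G 1 1 z = τ * (- s i z) ∧
      J G 0 2 z = τ * s i z ^ 2 := by
  obtain ⟨v, hv, h3, -, e1, e2⟩ := cubic_eq_zero_of_isGodron (hG.slice z.1) hg
  obtain ⟨i, hi⟩ := hcomp v h3
  have h5 : v.2 ≠ 0 := by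
    intro h; apply hv; ext
    · rw [hi, h]; simp
    · exact h
  have f1 : J G 2 0 z * v.1 + J G 1 1 z * v.2 = 0 := e1
  have f2 : J G 1 1 z * v.1 + J G 0 2 z * v.2 = 0 := e2
  have g1 : J G 1 1 z = J G 2 0 z * (- s i z) := by
    apply mul_right_cancel₀ h5; linear_combination f1 - J G 2 0 z * hi
  refine ⟨i, J G 2 0 z, by ring, g1, ?_⟩
  apply mul_right_cancel₀ h5
  linear_combination f2 - J G 1 1 z * hi - s i z * v.2 * g1

theorem PosGodron.isGodron {f : Plane → ℝ} {p : Plane} (h : PosGodron f p) : IsGodron f p := by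
  obtain ⟨v, w, hv, -⟩ := h
  exact ⟨v, hv⟩

variable {t : ℝ × Plane → ℝ}

theorem NormalFamily.eventually_quartic_ne (h : NormalFamily σ G) (ht : ContDiff ℝ ∞ t)
    (h0 : ddPow 4 (t 0, 1) (G 0) 0 ≠ 0) :
    ∀ᶠ z in 𝓝 (0 : ℝ × Plane), ddPow 4 (t z, 1) (G z.1) z.2 ≠ 0 := by
  have sm := fun i j => h.smooth.jet i j
  have s40 := sm 4 0
  have s31 := sm 3 1
  have s22 := sm 2 2
  have s13 := sm 1 3
  have s04 := sm 0 4
  have hc : ContDiff ℝ ∞ (fun z : ℝ × Plane => ddPow 4 (t z, 1) (G z.1) z.2) := by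
    simp only [quartic_J h.smooth]
    fun_prop
  exact eventually_ne_zero hc h0

/-- The quadratic form vanishes at the umbilic, so the derivative of the root does not contribute
and the differential is `(t² + σ)x + 2σty`, with `t` the value at `0`. By `t³ + 3σt = 0` it equals
`(t² + σ)(x - ty)`: the arc is tangent to the root direction itself. -/
theorem NormalFamily.eventually_flecnodal_arc (h : NormalFamily σ G) (ht : ContDiff ℝ ∞ t)
    (ht0 : t 0 ^ 3 + 3 * σ * t 0 = 0) (ht1 : t 0 ^ 2 + σ ≠ 0) (ht2 : |t 0| < 2) :
    ∀ᶠ r in 𝓝[>] (0 : ℝ), ∀ d : Plane, d ≠ 0 → d.1 = t 0 * d.2 →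
      IsSmoothArc {p ∈ box r | rootQuad G t (0, p) = 0} (box r) d := by
  have sm := fun i j => h.smooth.jet i j
  have s20 := sm 2 0
  have s11 := sm 1 1
  have s02 := sm 0 2
  have hc : ContDiff ℝ ∞ (rootQuad G t) := by unfold rootQuad; fun_prop
  have hd : ∀ z, fderiv ℝ (rootQuad G t) 0 z = t 0 ^ 2 * fderiv ℝ (J G 2 0) 0 z
      + 2 * t 0 * fderiv ℝ (J G 1 1) 0 z + fderiv ℝ (J G 0 2) 0 z := by
    intro z
    have d := fun i j => ((h.smooth.jet i j).differentiable (by simp) 0).hasFDerivAt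
    have dt := (ht.differentiable (by simp) 0).hasFDerivAt
    have := ((((dt.pow 2).mul (d 2 0)).add ((dt.const_mul 2).mul (d 1 1))).add (d 0 2)).fderiv
    have e : rootQuad G t = ((fun z => t z ^ 2) * J G 2 0 + (fun z => 2 * t z) * J G 1 1) + J G 0 2 := by
      ext z; simp [rootQuad]
    rw [e]
    erw [this]
    simp [h.j20, h.j11]
  refine eventually_isSmoothArc (φ := fun p => rootQuad G t (0, p)) (c := t 0) (k := t 0 ^ 2 + σ)
    (hc.comp (contDiff_const.prodMk contDiff_id)) ?_ ht2 ht1 ?_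
  · change rootQuad G t 0 = 0
    simp [rootQuad, h.j20, h.j11, h.j02]
  · intro d
    have := fderiv_slice (H := rootQuad G t) (z := 0) (hc.differentiable (by simp) 0) d
    simp only [Prod.fst_zero, Prod.snd_zero] at this
    rw [this, hd, (h.fderiv_zero _).1, (h.fderiv_zero _).2.1, (h.fderiv_zero _).2.2]
    simp only
    linear_combination d.2 * ht0

end Flecnodal

/-! ### Eigenvalues of symmetric matrices -/

section Spread

/-- The difference of the eigenvalues of the symmetric matrix with rows `(a, b)`, `(b, c)`. -/
noncomputable def spread (a b c : ℝ) : ℝ := ‖(⟨a - c, 2 * b⟩ : ℂ)‖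

theorem spread_nonneg (a b c : ℝ) : 0 ≤ spread a b c := norm_nonneg _

theorem spread_sq (a b c : ℝ) : spread a b c ^ 2 = (a - c) ^ 2 + 4 * b ^ 2 := by
  rw [spread, Complex.sq_norm, Complex.normSq_apply]; ring

theorem spread_neg (a b c : ℝ) : spread (-a) (-b) (-c) = spread a b c := by
  rw [spread, spread, ← norm_neg]; congr 1; apply Complex.ext <;> simp; ring

/-- The spread is the norm of a linear function of the matrix. Its subadditivity is the source of
the monotonicity of both eigenvalues. -/
theorem spread_add_le (a b c a' b' c' : ℝ) :
    spread (a + a') (b + b') (c + c') ≤ spread a b c + spread a' b' c' := by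
  rw [spread, spread, spread]
  convert! norm_add_le (⟨a - c, 2 * b⟩ : ℂ) ⟨a' - c', 2 * b'⟩ using 2
  apply Complex.ext <;> simp <;> ring

theorem spread_eq_zero {a b c : ℝ} (h : spread a b c = 0) : a = c ∧ b = 0 := by
  have := spread_sq a b c
  rw [h] at this
  constructor <;> nlinarith [sq_nonneg (a - c), sq_nonneg b]

theorem continuous_spread : Continuous (fun p : ℝ × ℝ × ℝ => spread p.1 p.2.1 p.2.2) := by
  have : (fun p : ℝ × ℝ × ℝ => spread p.1 p.2.1 p.2.2) =
      fun p => ‖((p.1 - p.2.2 : ℝ) : ℂ) + ((2 * p.2.1 : ℝ) : ℂ) * Complex.I‖ := by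
    ext p
    rw [spread]; congr 1
    apply Complex.ext <;> simp
  rw [this]
  fun_prop

/-- Twice the smaller eigenvalue. -/
noncomputable def eigMin (a b c : ℝ) : ℝ := a + c - spread a b c

/-- Twice the larger eigenvalue. -/
noncomputable def eigMax (a b c : ℝ) : ℝ := a + c + spread a b c

theorem eigMin_mul_eigMax (a b c : ℝ) : eigMin a b c * eigMax a b c = 4 * (a * c - b ^ 2) := by
  rw [eigMin, eigMax]; linear_combination - spread_sq a b c

theorem eigMin_le_eigMax (a b c : ℝ) : eigMin a b c ≤ eigMax a b c := by
  rw [eigMin, eigMax]; linarith [spread_nonneg a b c]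

theorem eigMin_pos_iff {a b c : ℝ} : 0 < eigMin a b c ↔ 0 < a ∧ 0 < a * c - b ^ 2 := by
  have h1 := eigMin_mul_eigMax a b c
  have h2 := eigMin_le_eigMax a b c
  have h3 := spread_nonneg a b c
  constructor
  · intro h
    have h4 : 0 < eigMin a b c * eigMax a b c := mul_pos h (h.trans_le h2)
    have h5 : 0 < a * c - b ^ 2 := by linarith
    have h6 : 0 < a + c := by rw [eigMin] at h; linarith
    refine ⟨?_, h5⟩
    by_contra! ha
    nlinarith [sq_nonneg b]
  · rintro ⟨ha, hd⟩
    have hc : 0 < c := by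
      by_contra! hc
      nlinarith [sq_nonneg b]
    have h6 : 0 < eigMax a b c := by rw [eigMax]; linarith
    exact (pos_iff_pos_of_mul_pos (show 0 < eigMin a b c * eigMax a b c by linarith)).2 h6

theorem eigMin_neg (a b c : ℝ) : eigMin (-a) (-b) (-c) = - eigMax a b c := by
  rw [eigMax, eigMin, spread_neg]; ring

theorem eigMax_neg_iff {a b c : ℝ} : eigMax a b c < 0 ↔ a < 0 ∧ 0 < a * c - b ^ 2 := by
  have := eigMin_pos_iff (a := -a) (b := -b) (c := -c)
  rw [eigMin_neg] at this
  constructor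
  · intro h
    have := this.1 (by linarith)
    exact ⟨by linarith, by linarith [this.2]⟩
  · rintro ⟨h1, h2⟩
    have := this.2 ⟨by linarith, by linarith⟩
    linarith

/-- The spread grows by at most that of the increment, and for a positive definite increment this is
less than the growth of the trace. -/
theorem eigMin_add_lt {a b c a' b' c' : ℝ} (h : 0 < a' ∧ 0 < a' * c' - b' ^ 2) :
    eigMin a b c < eigMin (a + a') (b + b') (c + c') := by
  have := eigMin_pos_iff.2 h
  have := spread_add_le a b c a' b' c'
  simp only [eigMin] at *
  linarith

theorem eigMax_add_lt {a b c a' b' c' : ℝ} (h : 0 < a' ∧ 0 < a' * c' - b' ^ 2) :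
    eigMax a b c < eigMax (a + a') (b + b') (c + c') := by
  have h1 := eigMin_pos_iff.2 h
  have h2 := spread_add_le (a + a') (b + b') (c + c') (-a') (-b') (-c')
  rw [spread_neg] at h2
  simp only [add_neg_cancel_right] at h2
  simp only [eigMax, eigMin] at *
  linarith

/-- Diagonal dominance: both diagonal entries are at least `x - δ`, which exceeds `y + δ ≥ |b|`. -/
theorem eigMin_pos_of_close {a b c x y δ : ℝ} (ha : |a - x| ≤ δ) (hb : |b| ≤ y + δ)
    (hc : |c - x| ≤ δ) (hy : y + 2 * δ < x) : 0 < eigMin a b c := by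
  rw [abs_le] at ha hc
  have h0 := abs_nonneg b
  rw [eigMin_pos_iff]
  constructor
  · linarith
  · have h1 : |b| ^ 2 = b ^ 2 := sq_abs b
    nlinarith

theorem posDef_of_quad_pos {a b c : ℝ}
    (h : ∀ v : Plane, v ≠ 0 → 0 < v.1 ^ 2 * a + 2 * v.1 * v.2 * b + v.2 ^ 2 * c) :
    0 < a ∧ 0 < a * c - b ^ 2 := by
  have ha : 0 < a := by simpa using h (1, 0) (by simp)
  refine ⟨ha, ?_⟩
  have := h (b, -a) (by
    intro hc
    have := congrArg Prod.snd hc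
    simp at this; exact ha.ne' this)
  simp only at this
  have h2 : 0 < a * (a * c - b ^ 2) := by linarith
  exact (pos_iff_pos_of_mul_pos h2).1 ha

end Spread

/-! ### The case `D₄⁺`: monotone eigenvalues and the parabolic branches -/

section DFourPlus

variable {G : ℝ → Plane → ℝ}

/-- Twice the smaller eigenvalue of the second differential. -/
noncomputable def hessMin (G : ℝ → Plane → ℝ) (z : ℝ × Plane) : ℝ :=
  eigMin (J G 2 0 z) (J G 1 1 z) (J G 0 2 z)

/-- Twice the larger eigenvalue of the second differential. -/
noncomputable def hessMax (G : ℝ → Plane → ℝ) (z : ℝ × Plane) : ℝ :=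
  eigMax (J G 2 0 z) (J G 1 1 z) (J G 0 2 z)

theorem continuous_hessMin (hG : SmoothFamily G) : Continuous (hessMin G) := by
  have c := fun i j => (hG.jet i j).continuous
  have c1 := c 2 0
  have c2 := c 1 1
  have c3 := c 0 2
  have := continuous_spread.comp (c1.prodMk (c2.prodMk c3))
  exact (c1.add c3).sub this

theorem continuous_hessMax (hG : SmoothFamily G) : Continuous (hessMax G) := by
  have c := fun i j => (hG.jet i j).continuous
  have c1 := c 2 0
  have c2 := c 1 1
  have c3 := c 0 2
  have := continuous_spread.comp (c1.prodMk (c2.prodMk c3))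
  exact (c1.add c3).add this

/-- For `σ = 1` the `x`-derivative of the Hessian matrix is the identity at the umbilic, hence
positive definite nearby. -/
theorem NormalFamily.eventually_increasing (h : NormalFamily 1 G) :
    ∀ᶠ z in 𝓝 (0 : ℝ × Plane), 0 < J G 3 0 z ∧ 0 < J G 3 0 z * J G 1 2 z - J G 2 1 z ^ 2 := by
  have h1 := h.smooth.jet 3 0
  have h2 := h.smooth.jet 2 1
  have h3 := h.smooth.jet 1 2
  exact (eventually_pos h1 (by rw [h.j30]; exact one_pos)).and
    (eventually_pos ((h1.mul h3).sub (h2.pow 2)) (by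
      simp only [h.j30, h.j21, h.j12]; norm_num))

/-- The second differential increases along a segment on which its derivative is positive. -/
theorem posDef_increment (hG : SmoothFamily G) {ε x x' y : ℝ} (hx : x < x')
    (hinc : ∀ t ∈ Icc x x', 0 < J G 3 0 (ε, (t, y)) ∧
      0 < J G 3 0 (ε, (t, y)) * J G 1 2 (ε, (t, y)) - J G 2 1 (ε, (t, y)) ^ 2) :
    0 < J G 2 0 (ε, (x', y)) - J G 2 0 (ε, (x, y)) ∧
    0 < (J G 2 0 (ε, (x', y)) - J G 2 0 (ε, (x, y))) * (J G 0 2 (ε, (x', y)) - J G 0 2 (ε, (x, y)))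
      - (J G 1 1 (ε, (x', y)) - J G 1 1 (ε, (x, y))) ^ 2 := by
  apply posDef_of_quad_pos
  intro v hv
  have hd : ∀ i j t, HasDerivAt (fun t => J G i j (ε, (t, y))) (J G (i + 1) j (ε, (t, y))) t := by
    intro i j t
    have e1 : HasDerivAt (fun t : ℝ => ((ε, (t, y)) : ℝ × Plane)) ((0 : ℝ), ((1 : ℝ), (0 : ℝ))) t :=
      (hasDerivAt_const t ε).prodMk ((hasDerivAt_id t).prodMk (hasDerivAt_const t y))
    have := ((hG.jet i j).differentiable (by simp) (ε, (t, y))).hasFDerivAt.comp_hasDerivAt t e1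
    rw [hG.fderiv_J] at this
    simp only [one_mul, zero_mul, add_zero] at this
    exact this
  let q : ℝ → ℝ := fun t => v.1 ^ 2 * J G 2 0 (ε, (t, y)) + 2 * v.1 * v.2 * J G 1 1 (ε, (t, y))
    + v.2 ^ 2 * J G 0 2 (ε, (t, y))
  have hq : ∀ t, HasDerivAt q (v.1 ^ 2 * J G 3 0 (ε, (t, y)) + 2 * v.1 * v.2 * J G 2 1 (ε, (t, y))
    + v.2 ^ 2 * J G 1 2 (ε, (t, y))) t := fun t =>
    (((hd 2 0 t).const_mul (v.1 ^ 2)).add ((hd 1 1 t).const_mul (2 * v.1 * v.2))).add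
      ((hd 0 2 t).const_mul (v.2 ^ 2))
  have hm : StrictMonoOn q (Icc x x') := by
    apply strictMonoOn_of_deriv_pos (convex_Icc _ _)
    · exact fun t _ => (hq t).continuousAt.continuousWithinAt
    · intro t ht
      rw [interior_Icc] at ht
      rw [(hq t).deriv]
      have := hinc t (Ioo_subset_Icc_self ht)
      exact quad_pos this.1 this.2 hv
  have := hm (left_mem_Icc.mpr hx.le) (right_mem_Icc.mpr hx.le) hx
  simp only [q] at this
  linarith

/-- The description of the curves, where one of the eigenvalues of the second differential
vanishes, as graphs. -/
structure EigenGraphs (G : ℝ → Plane → ℝ) (r ε : ℝ) (α β : ℝ → ℝ) : Prop where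
  cont_min : ContinuousOn α (Ioo (-r) r)
  cont_max : ContinuousOn β (Ioo (-r) r)
  bound_min : ∀ y ∈ Ioo (-r) r, -(3 * r) < α y ∧ α y < 3 * r
  bound_max : ∀ y ∈ Ioo (-r) r, -(3 * r) < β y ∧ β y < 3 * r
  min_iff : ∀ p ∈ box r, (hessMin G (ε, p) = 0 ↔ p.1 = α p.2) ∧
    (0 < hessMin G (ε, p) ↔ α p.2 < p.1) ∧ (hessMin G (ε, p) < 0 ↔ p.1 < α p.2)
  max_iff : ∀ p ∈ box r, (hessMax G (ε, p) = 0 ↔ p.1 = β p.2) ∧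
    (0 < hessMax G (ε, p) ↔ β p.2 < p.1) ∧ (hessMax G (ε, p) < 0 ↔ p.1 < β p.2)

/-- Both eigenvalues increase with `x`. On the lines `x = ±3r` the norm is at most `3r`, so `η =
1/12` makes the Taylor error at most `r/4`, and `|ε| < r/(4K)` makes the terms linear in `ε` at most
`r/4`. The Hessian matrix is then within `r/2` of the one with diagonal `±3r` and off-diagonal entry
`y`, `|y| < r`, so both eigenvalues have the sign of `x` there. -/
theorem NormalFamily.eventually_graphs (h : NormalFamily 1 G) :
    ∀ᶠ r in 𝓝[>] (0 : ℝ), ∀ᶠ ε in 𝓝 (0 : ℝ), ∃ α β : ℝ → ℝ, EigenGraphs G r ε α β := by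
  filter_upwards [eventually_box h.eventually_increasing,
    eventually_box (h.estimate (η := 1 / 12) (by norm_num)), self_mem_nhdsWithin] with r hinc hest hr
  have hr0 : (0 : ℝ) < r := hr
  set a := fderiv ℝ (J G 2 0) 0 (1, 0)
  set b := fderiv ℝ (J G 1 1) 0 (1, 0)
  set c := fderiv ℝ (J G 0 2) 0 (1, 0)
  set K := |a| + |b| + |c| + 1 with hK
  have ha0 := abs_nonneg a
  have hb0 := abs_nonneg b
  have hc0 := abs_nonneg c
  have hKpos : 0 < K := by positivity
  have hsmall : ∀ᶠ ε in 𝓝 (0 : ℝ), |ε| < min r (r / (4 * K)) := by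
    have : Tendsto (fun ε : ℝ => |ε|) (𝓝 0) (𝓝 0) := by
      simpa using (continuous_abs.tendsto (0 : ℝ))
    exact this.eventually (gt_mem_nhds (by positivity))
  filter_upwards [hsmall] with ε hε
  obtain ⟨hεr, hεK⟩ := lt_min_iff.mp hε
  rw [lt_div_iff₀ (by positivity)] at hεK
  have hmono : ∀ x x' y, (x, y) ∈ box r → (x', y) ∈ box r → x < x' →
      hessMin G (ε, (x, y)) < hessMin G (ε, (x', y)) ∧
      hessMax G (ε, (x, y)) < hessMax G (ε, (x', y)) := by
    intro x x' y hx hx' hxx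
    have hp := posDef_increment h.smooth (ε := ε) (y := y) hxx (fun t ht => hinc ε (t, y) hεr
      ⟨⟨hx.1.1.trans_le ht.1, ht.2.trans_lt hx'.1.2⟩, hx.2⟩)
    have k1 := eigMin_add_lt (a := J G 2 0 (ε, (x, y))) (b := J G 1 1 (ε, (x, y)))
      (c := J G 0 2 (ε, (x, y))) hp
    have k2 := eigMax_add_lt (a := J G 2 0 (ε, (x, y))) (b := J G 1 1 (ε, (x, y)))
      (c := J G 0 2 (ε, (x, y))) hp
    simp only [add_sub_cancel] at k1 k2
    exact ⟨k1, k2⟩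
  have hnorm : ∀ y ∈ Ioo (-r) r, ∀ x : ℝ, |x| = 3 * r → ‖((ε, (x, y)) : ℝ × Plane)‖ ≤ 3 * r := by
    intro y hy x hx
    rw [Prod.norm_def, max_le_iff, Prod.norm_def, max_le_iff, Real.norm_eq_abs, Real.norm_eq_abs,
      Real.norm_eq_abs]
    refine ⟨?_, hx.le, ?_⟩
    · simp only; linarith
    · simp only; linarith [(abs_lt.mpr hy)]
  have a3 : |3 * r| = 3 * r := abs_of_pos (by positivity)
  have hmul : ∀ k : ℝ, |k| ≤ K → |ε * k| ≤ r / 4 := by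
    intro k hk
    rw [abs_mul]
    have := mul_le_mul_of_nonneg_left hk (abs_nonneg ε)
    linarith
  have ma := abs_le.mp (hmul a (by linarith))
  have mb := abs_le.mp (hmul b (by linarith))
  have mc := abs_le.mp (hmul c (by linarith))
  have hright : ∀ y ∈ Ioo (-r) r, 0 < hessMin G (ε, (3 * r, y)) := by
    intro y hy
    have hest' := hest ε (3 * r, y) hεr ⟨⟨by simp only; linarith, by simp only; linarith⟩, hy⟩
    have hn := hnorm y hy (3 * r) a3
    simp only at hest'
    obtain ⟨e1, e2, e3⟩ := hest'
    rw [abs_le] at e1 e2 e3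
    apply eigMin_pos_of_close (x := 3 * r) (y := r) (δ := r / 2) _ _ _ (by linarith)
    · rw [abs_le]; constructor <;> linarith
    · rw [abs_le]; constructor <;> linarith [hy.1, hy.2]
    · rw [abs_le]; constructor <;> linarith
  have hleft : ∀ y ∈ Ioo (-r) r, hessMax G (ε, (-(3 * r), y)) < 0 := by
    intro y hy
    have hest' := hest ε (-(3 * r), y) hεr ⟨⟨by simp only; linarith, by simp only; linarith⟩, hy⟩
    have hn := hnorm y hy (-(3 * r)) (by rw [abs_neg, a3])
    simp only at hest'
    obtain ⟨e1, e2, e3⟩ := hest'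
    rw [abs_le] at e1 e2 e3
    rw [← neg_pos, hessMax, ← eigMin_neg]
    apply eigMin_pos_of_close (x := 3 * r) (y := r) (δ := r / 2) _ _ _ (by linarith)
    · rw [abs_le]; constructor <;> linarith
    · rw [abs_le]; constructor <;> linarith [hy.1, hy.2]
    · rw [abs_le]; constructor <;> linarith
  have cc : Continuous fun p : Plane => ((ε, p) : ℝ × Plane) := by fun_prop
  obtain ⟨α, hα, hbα, hgα⟩ := exists_graph (r := r) (g := fun p => hessMin G (ε, p))
    ((continuous_hessMin h.smooth).comp cc).continuousOn
    (fun x x' y hx hx' hxx h => h.trans_lt (hmono x x' y hx hx' hxx).1)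
    (fun y hy => (eigMin_le_eigMax _ _ _).trans_lt (hleft y hy)) hright
  obtain ⟨β, hβ, hbβ, hgβ⟩ := exists_graph (r := r) (g := fun p => hessMax G (ε, p))
    ((continuous_hessMax h.smooth).comp cc).continuousOn
    (fun x x' y hx hx' hxx h => h.trans_lt (hmono x x' y hx hx' hxx).2)
    hleft (fun y hy => (hright y hy).trans_le (eigMin_le_eigMax _ _ _))
  exact ⟨α, β, hα, hβ, hbα, hbβ, hgα, hgβ⟩

/-- The slopes of the branches of the parabolic curve at the umbilic. -/
theorem NormalFamily.exists_parabolic_branch (h : NormalFamily 1 G) {c : ℝ} (hc : c ^ 2 = 1) :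
    ∃ s : ℝ → ℝ, ContDiff ℝ ∞ s ∧ s 0 = c ∧ ∀ᶠ y in 𝓝 (0 : ℝ), hess (G 0) (y * s y, y) = 0 := by
  -- The blow-up `x = sy`: each second derivative is divisible by `y`, and the quotient at `y = 0`
  -- is its derivative in the direction `(s, 1)`.
  have key : ∀ i j, J G i j 0 = 0 → ∃ m : ℝ × ℝ → ℝ, ContDiff ℝ ∞ m ∧
      (∀ s y, J G i j (0, (s * y, y)) = y * m (s, y)) ∧
      ∀ s, m (s, 0) = s * J G (i + 1) j 0 + J G i (j + 1) 0 := by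
    intro i j h0
    have hsm : ContDiff ℝ ∞ (fun q : ℝ × ℝ => J G i j (0, (q.1 * q.2, q.2))) :=
      (h.smooth.jet i j).comp (f := fun q : ℝ × ℝ => ((0 : ℝ), (q.1 * q.2, q.2))) (by fun_prop)
    obtain ⟨m, h1, h2, h3⟩ := exists_smooth_div hsm (by intro s; simp only [mul_zero]; exact h0)
    refine ⟨m, h1, h2, ?_⟩
    intro s
    rw [h3]
    have e1 : HasDerivAt (fun y : ℝ => (s, y)) ((0 : ℝ), (1 : ℝ)) 0 :=
      (hasDerivAt_const 0 s).prodMk (hasDerivAt_id 0)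
    have k1 := (hsm.differentiable (by simp) (s, 0)).hasFDerivAt.comp_hasDerivAt 0 e1
    have e2 : HasDerivAt (fun y : ℝ => ((0 : ℝ), ((s * y, y) : Plane))) ((0 : ℝ), ((s, 1) : Plane)) 0 := by
      have := (hasDerivAt_id (0 : ℝ)).const_mul s
      simp only [mul_one] at this
      exact (hasDerivAt_const 0 (0 : ℝ)).prodMk (this.prodMk (hasDerivAt_id 0))
    have hJ : HasFDerivAt (J G i j) (fderiv ℝ (J G i j) 0) ((0 : ℝ), ((s * 0, 0) : Plane)) := by
      have e0 : ((0 : ℝ), ((s * 0, 0) : Plane)) = 0 := Prod.ext rfl (Prod.ext (mul_zero s) rfl)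
      rw [e0]
      exact ((h.smooth.jet i j).differentiable (by simp) 0).hasFDerivAt
    have k2 := hJ.comp_hasDerivAt 0 e2
    rw [k1.unique k2, h.smooth.fderiv_J]
    simp
  obtain ⟨m1, a1, a2, a3⟩ := key 2 0 h.j20
  obtain ⟨m2, b1, b2, b3⟩ := key 1 1 h.j11
  obtain ⟨m3, c1, c2, c3⟩ := key 0 2 h.j02
  have a3' : ∀ s, m1 (s, 0) = s := by intro s; simp [a3, h.j30, h.j21]
  have b3' : ∀ s, m2 (s, 0) = 1 := by intro s; simp [b3, h.j21, h.j12]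
  have c3' : ∀ s, m3 (s, 0) = s := by intro s; simp [c3, h.j12, h.j03]
  let R : ℝ × ℝ → ℝ := fun q => m1 (q.2, q.1) * m3 (q.2, q.1) - m2 (q.2, q.1) ^ 2
  have hswap : ContDiff ℝ ∞ (fun q : ℝ × ℝ => (q.2, q.1)) := by fun_prop
  have hR : ContDiff ℝ ∞ R := ((a1.comp hswap).mul (c1.comp hswap)).sub ((b1.comp hswap).pow 2)
  -- The Hessian divided by `y²` restricts to `s² - 1` on `y = 0`; its simple roots `±1` continue to
  -- the two branches.
  have hR0 : ∀ s, R (0, s) = s ^ 2 - 1 := by intro s; simp only [R, a3', b3', c3']; ring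
  have hdR : fderiv ℝ R (0, c) (0, 1) = 2 * c := by
    have e1 : HasDerivAt (fun s : ℝ => ((0 : ℝ), s)) ((0 : ℝ), (1 : ℝ)) c :=
      (hasDerivAt_const c 0).prodMk (hasDerivAt_id c)
    have k1 := (hR.differentiable (by simp) (0, c)).hasFDerivAt.comp_hasDerivAt c e1
    have k2 : HasDerivAt (R ∘ fun s : ℝ => ((0 : ℝ), s)) (2 * c) c := by
      have e : (R ∘ fun s : ℝ => ((0 : ℝ), s)) = fun s => s ^ 2 - 1 := by
        ext s; exact hR0 s
      rw [e]
      simpa using (hasDerivAt_pow 2 c).sub_const 1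
    exact k1.unique k2
  have hc0 : c ≠ 0 := by rintro rfl; norm_num at hc
  obtain ⟨s, hs, hs0, hs1, -⟩ := exists_smooth_implicit hR (y₀ := c) (by rw [hR0, hc]; ring) (by
    intro y hy
    have : ((0 : ℝ), y) = y • ((0 : ℝ), (1 : ℝ)) := by ext <;> simp
    rw [this, map_smul, hdR, smul_eq_mul] at hy
    simpa [hc0] using hy)
  refine ⟨s, hs, hs0, ?_⟩
  filter_upwards [hs1] with y hy
  have := hess_J G (0, (y * s y, y))
  simp only at this
  rw [this, mul_comm y (s y), a2, b2, c2]
  simp only [R] at hy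
  linear_combination y ^ 2 * hy

end DFourPlus

/-! ### The case `D₄⁺`: the elliptic domains as sides of graphs -/

section DFourPlusTransition

variable {G : ℝ → Plane → ℝ} {r ε : ℝ} {α β : ℝ → ℝ}

theorem eventually_forall_abs_lt {P : ℝ → Prop} (h : ∀ᶠ ε in 𝓝 (0 : ℝ), P ε) :
    ∀ᶠ ε₀ in 𝓝[>] (0 : ℝ), ∀ ε, |ε| < ε₀ → P ε := by
  obtain ⟨R, hR, hball⟩ := Metric.eventually_nhds_iff_ball.mp h
  filter_upwards [Ioo_mem_nhdsGT hR] with ε₀ h0 ε hε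
  apply hball
  rw [mem_ball_zero_iff, Real.norm_eq_abs]
  exact hε.trans h0.2

theorem jet_ne_zero_of_hess_pos {f : Plane → ℝ} {p : Plane} (h : 0 < hess f p) :
    jet 2 0 f p ≠ 0 := by
  intro h0
  rw [hess_eq, h0] at h
  nlinarith [sq_nonneg (jet 1 1 f p)]

theorem ellipticSet_eq_union {f : Plane → ℝ} (hf : ContDiff ℝ ∞ f) (U : Set Plane) :
    ellipticSet f U = ellipticUp f U ∪ ellipticDown f U := by
  ext p
  constructor
  · intro hp
    rcases lt_or_gt_of_ne (jet_ne_zero_of_hess_pos hp.2) with h | h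
    · exact Or.inr ⟨hp, (coorientedDown_iff hf hp.2).2 h⟩
    · exact Or.inl ⟨hp, (coorientedUp_iff hf hp.2).2 h⟩
  · rintro (h | h) <;> exact h.1

theorem EigenGraphs.ellipticUp_eq (hG : SmoothFamily G) (h : EigenGraphs G r ε α β) :
    ellipticUp (G ε) (box r) = {p ∈ box r | α p.2 < p.1} := by
  ext p
  simp only [ellipticUp, ellipticSet, mem_ofPred_eq]
  constructor
  · rintro ⟨⟨hp, h1⟩, h2⟩
    refine ⟨hp, (h.min_iff p hp).2.1.1 ?_⟩
    exact eigMin_pos_iff.2 ⟨(coorientedUp_iff (hG.slice ε) h1).1 h2, h1⟩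
  · rintro ⟨hp, h1⟩
    have := eigMin_pos_iff.1 ((h.min_iff p hp).2.1.2 h1)
    exact ⟨⟨hp, this.2⟩, (coorientedUp_iff (hG.slice ε) this.2).2 this.1⟩

theorem EigenGraphs.ellipticDown_eq (hG : SmoothFamily G) (h : EigenGraphs G r ε α β) :
    ellipticDown (G ε) (box r) = {p ∈ box r | p.1 < β p.2} := by
  ext p
  simp only [ellipticDown, ellipticSet, mem_ofPred_eq]
  constructor
  · rintro ⟨⟨hp, h1⟩, h2⟩
    refine ⟨hp, (h.max_iff p hp).2.2.1 ?_⟩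
    exact eigMax_neg_iff.2 ⟨(coorientedDown_iff (hG.slice ε) h1).1 h2, h1⟩
  · rintro ⟨hp, h1⟩
    have := eigMax_neg_iff.1 ((h.max_iff p hp).2.2.2 h1)
    exact ⟨⟨hp, this.2⟩, (coorientedDown_iff (hG.slice ε) this.2).2 this.1⟩

theorem EigenGraphs.hess_eq_zero_iff (h : EigenGraphs G r ε α β) {p : Plane} (hp : p ∈ box r) :
    hess (G ε) p = 0 ↔ p.1 = α p.2 ∨ p.1 = β p.2 := by
  rw [← (h.min_iff p hp).1, ← (h.max_iff p hp).1, ← mul_eq_zero, hessMin, hessMax,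
    eigMin_mul_eigMax, ← hess_J]
  simp

/-- At a common point of the closures the smaller eigenvalue is at least `0` and the larger one at
most `0`, so the second differential is zero. -/
theorem EigenGraphs.inter_closures_eq (hG : SmoothFamily G) (h : EigenGraphs G r ε α β) :
    box r ∩ (closure (ellipticUp (G ε) (box r)) ∩ closure (ellipticDown (G ε) (box r))) =
      {p ∈ box r | J G 2 0 (ε, p) = 0 ∧ J G 1 1 (ε, p) = 0 ∧ J G 0 2 (ε, p) = 0} := by
  rw [h.ellipticUp_eq hG, h.ellipticDown_eq hG, inter_inter_distrib_left,
    box_inter_closure_above h.cont_min, box_inter_closure_below h.cont_max]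
  ext p
  constructor
  · rintro ⟨⟨hp, h1⟩, -, h2⟩
    refine ⟨hp, ?_⟩
    have k1 : 0 ≤ hessMin G (ε, p) := not_lt.1 fun hc => h1.not_gt ((h.min_iff p hp).2.2.1 hc)
    have k2 : hessMax G (ε, p) ≤ 0 := not_lt.1 fun hc => h2.not_gt ((h.max_iff p hp).2.1.1 hc)
    rw [hessMin, eigMin] at k1
    rw [hessMax, eigMax] at k2
    have k3 := spread_nonneg (J G 2 0 (ε, p)) (J G 1 1 (ε, p)) (J G 0 2 (ε, p))
    obtain ⟨k4, k5⟩ := spread_eq_zero (le_antisymm (by linarith) k3)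
    exact ⟨by linarith, k5, by linarith⟩
  · rintro ⟨hp, h1, h2, h3⟩
    have k : spread 0 0 0 = 0 := by
      have := spread_sq 0 0 0
      exact pow_eq_zero_iff two_ne_zero |>.1 (by rw [this]; norm_num)
    have k1 : hessMin G (ε, p) = 0 := by rw [hessMin, eigMin, h1, h2, h3, k]; norm_num
    have k2 : hessMax G (ε, p) = 0 := by rw [hessMax, eigMax, h1, h2, h3, k]; norm_num
    exact ⟨⟨hp, ((h.min_iff p hp).1.1 k1).ge⟩, hp, ((h.max_iff p hp).1.1 k2).le⟩

/-- The parabolic curve is regular outside of the flat umbilics, where the second differential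
increases. -/
theorem fderiv_hess_ne_zero (hG : SmoothFamily G) {z : ℝ × Plane} (h1 : 0 < J G 3 0 z)
    (h2 : 0 < J G 3 0 z * J G 1 2 z - J G 2 1 z ^ 2) (h3 : hess (G z.1) z.2 = 0)
    (h4 : ¬ (J G 2 0 z = 0 ∧ J G 1 1 z = 0 ∧ J G 0 2 z = 0)) :
    fderiv ℝ (hess (G z.1)) z.2 ≠ 0 := by
  intro hc
  have h5 : fderiv ℝ (hess (G z.1)) z.2 (1, 0) = 0 := by rw [hc]; rfl
  rw [fderiv_hess (hG.slice z.1)] at h5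
  have h6 : J G 2 0 z * J G 1 2 z + J G 0 2 z * J G 3 0 z - 2 * J G 1 1 z * J G 2 1 z = 0 := by
    simp only [J]; linear_combination h5
  rw [hess_J] at h3
  -- Modulo `hess = 0`, the `x`-derivative of the Hessian multiplied by `f₂₀f₃₀` is a positive
  -- definite form in `f₂₀, f₁₁`.
  have h7 : J G 2 0 z ^ 2 * (J G 3 0 z * J G 1 2 z - J G 2 1 z ^ 2)
      + (J G 2 0 z * J G 2 1 z - J G 1 1 z * J G 3 0 z) ^ 2 = 0 := by
    linear_combination J G 2 0 z * J G 3 0 z * h6 - J G 3 0 z ^ 2 * h3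
  have h8 : J G 2 0 z = 0 := by
    by_contra h0
    have : 0 < J G 2 0 z ^ 2 := by positivity
    nlinarith [sq_nonneg (J G 2 0 z * J G 2 1 z - J G 1 1 z * J G 3 0 z), mul_pos this h2]
  have h9 : J G 1 1 z = 0 := by
    rw [h8] at h3
    exact pow_eq_zero_iff two_ne_zero |>.1 (by linarith)
  refine h4 ⟨h8, h9, ?_⟩
  rw [h8, h9] at h6
  exact (mul_eq_zero.1 (by linarith : J G 0 2 z * J G 3 0 z = 0)).resolve_right h1.ne'

theorem eventually_graph_isSmoothArc {s : ℝ → ℝ} (hs : ContDiff ℝ ∞ s) (hs0 : |s 0| < 2) :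
    ∀ᶠ r in 𝓝[>] (0 : ℝ), ∀ d : Plane, d ≠ 0 → d.1 = s 0 * d.2 →
      IsSmoothArc {p ∈ box r | p.1 - p.2 * s p.2 = 0} (box r) d := by
  have hφ : ContDiff ℝ ∞ (fun p : Plane => p.1 - p.2 * s p.2) := by fun_prop
  refine eventually_isSmoothArc (k := 1) hφ (by simp) hs0 one_ne_zero ?_
  intro d
  have e1 : HasDerivAt (fun t : ℝ => t • d) d 0 := by
    simpa using (hasDerivAt_id (0 : ℝ)).smul_const d
  have h0 : HasFDerivAt (fun p : Plane => p.1 - p.2 * s p.2)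
      (fderiv ℝ (fun p : Plane => p.1 - p.2 * s p.2) 0) ((0 : ℝ) • d) := by
    rw [zero_smul]; exact (hφ.differentiable (by simp) 0).hasFDerivAt
  have k1 := h0.comp_hasDerivAt 0 e1
  have k2 : HasDerivAt ((fun p : Plane => p.1 - p.2 * s p.2) ∘ fun t : ℝ => t • d)
      (d.1 - s 0 * d.2) 0 := by
    have a1 : HasDerivAt (fun t : ℝ => t * d.1) d.1 0 := by
      simpa using (hasDerivAt_id (0 : ℝ)).mul_const d.1
    have a2 : HasDerivAt (fun t : ℝ => t * d.2) d.2 0 := by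
      simpa using (hasDerivAt_id (0 : ℝ)).mul_const d.2
    have hs' : HasDerivAt s (deriv s 0) (0 * d.2) := by
      rw [zero_mul]; exact (hs.differentiable (by simp) 0).hasDerivAt
    have a3 := hs'.comp 0 a2
    have := a1.sub (a2.mul a3)
    convert! this using 1
    simp; ring
  rw [k1.unique k2]; ring

end DFourPlusTransition

/-! ### The case `D₄⁺`: the transition -/

section DFourPlusTransition

variable {G : ℝ → Plane → ℝ} {r : ℝ} {α β : ℝ → ℝ}

/-- If the smaller and the larger eigenvalue vanish along graphs, two distinct curves in the
parabolic set exhaust it. -/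
theorem EigenGraphs.parabolicSet_eq (h : EigenGraphs G r 0 α β) (hr : 0 < r)
    (h0 : J G 2 0 0 = 0 ∧ J G 1 1 0 = 0 ∧ J G 0 2 0 = 0) {s t : ℝ → ℝ}
    (hs : ∀ y ∈ Ioo (-r) r, |s y| < 2 ∧ |t y| < 2 ∧ s y ≠ t y ∧ hess (G 0) (y * s y, y) = 0 ∧
      hess (G 0) (y * t y, y) = 0) :
    parabolicSet (G 0) (box r) =
      {p ∈ box r | p.1 - p.2 * s p.2 = 0} ∪ {p ∈ box r | p.1 - p.2 * t p.2 = 0} := by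
  have hmem : ∀ y ∈ Ioo (-r) r, ∀ c : ℝ, |c| < 2 → ((y * c, y) : Plane) ∈ box r := by
    intro y hy c hc
    have h1 : |y * c| ≤ 2 * r := by
      rw [abs_mul]
      have := abs_lt.2 hy
      have := abs_nonneg y
      have := abs_nonneg c
      nlinarith
    rw [abs_le] at h1
    exact ⟨⟨by simp only; linarith, by simp only; linarith⟩, hy⟩
  have k : spread 0 0 0 = 0 := by
    have := spread_sq 0 0 0
    exact pow_eq_zero_iff two_ne_zero |>.1 (by rw [this]; norm_num)
  have hm0 := zero_mem_box hr
  have hα0 : α 0 = 0 := by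
    have := (h.min_iff 0 hm0).1.1 (by
      change eigMin (J G 2 0 0) (J G 1 1 0) (J G 0 2 0) = 0
      rw [h0.1, h0.2.1, h0.2.2, eigMin, k]; norm_num)
    exact this.symm
  have hβ0 : β 0 = 0 := by
    have := (h.max_iff 0 hm0).1.1 (by
      change eigMax (J G 2 0 0) (J G 1 1 0) (J G 0 2 0) = 0
      rw [h0.1, h0.2.1, h0.2.2, eigMax, k]; norm_num)
    exact this.symm
  ext p
  constructor
  · rintro ⟨hp, h1⟩
    have h2 := hs p.2 hp.2
    obtain ⟨b1, b2, b3, b4, b5⟩ := h2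
    have c1 := (h.hess_eq_zero_iff (hmem _ hp.2 _ b1)).1 b4
    have c2 := (h.hess_eq_zero_iff (hmem _ hp.2 _ b2)).1 b5
    have c3 := (h.hess_eq_zero_iff hp).1 h1
    simp only at c1 c2
    suffices H : p.1 = p.2 * s p.2 ∨ p.1 = p.2 * t p.2 by
      rcases H with H | H
      · exact Or.inl ⟨hp, by linarith⟩
      · exact Or.inr ⟨hp, by linarith⟩
    by_cases hy : p.2 = 0
    · left
      rw [hy, hα0, hβ0] at c3
      rw [hy, zero_mul]
      simpa using c3
    -- At a height `y ≠ 0` only `x = α y` and `x = β y` are parabolic, so the two distinct points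
    -- `ys` and `yt` are exactly these.
    · have hne : p.2 * s p.2 ≠ p.2 * t p.2 := fun hc => b3 (mul_left_cancel₀ hy hc)
      rcases c1 with c1 | c1 <;> rcases c2 with c2 | c2 <;> rcases c3 with c3 | c3
      · exact absurd (c1.trans c2.symm) hne
      · exact absurd (c1.trans c2.symm) hne
      · left; rw [c3, c1]
      · right; rw [c3, c2]
      · right; rw [c3, c2]
      · left; rw [c3, c1]
      · exact absurd (c1.trans c2.symm) hne
      · exact absurd (c1.trans c2.symm) hne
  · rintro (⟨hp, h1⟩ | ⟨hp, h1⟩)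
    · refine ⟨hp, ?_⟩
      have := (hs p.2 hp.2).2.2.2.1
      rwa [show p.2 * s p.2 = p.1 by linarith] at this
    · refine ⟨hp, ?_⟩
      have := (hs p.2 hp.2).2.2.2.2
      rwa [show p.2 * t p.2 = p.1 by linarith] at this

/-- The parabolic branches have directions `(±1, 1)` and the flecnodal arc has direction `(0, 1)`. A
point both parabolic and flecnodal has a quadratic form with kernel `(s, 1)`, so it lies on the
godron ray, which for `ε = 0` is at the umbilic. -/
theorem NormalFamily.eventually_curves_zero (h : NormalFamily 1 G) {s : ℝ × Plane → ℝ}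
    (hs : ContDiff ℝ ∞ s) (hs0 : s 0 = 0)
    (hflec : ∀ᶠ z in 𝓝 (0 : ℝ × Plane), IsFlecnodal (G z.1) z.2 ↔ rootQuad G s z = 0)
    {u : Plane} (hu : u ≠ 0) (hu1 : u.1 = 0) :
    ∀ᶠ r in 𝓝[>] (0 : ℝ), ∃ (d₁ d₂ : Plane) (P₁ P₂ : Set Plane),
    IsSmoothArc (flecnodalSet (G 0) (box r)) (box r) u ∧ IsSmoothArc P₁ (box r) d₁ ∧
    IsSmoothArc P₂ (box r) d₂ ∧
    parabolicSet (G 0) (box r) = P₁ ∪ P₂ ∧ P₁ ∩ P₂ = {0} ∧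
    flecnodalSet (G 0) (box r) ∩ parabolicSet (G 0) (box r) = {0} ∧
    LinearIndependent ℝ ![d₁, d₂] ∧ LinearIndependent ℝ ![u, d₁] ∧ LinearIndependent ℝ ![u, d₂] := by
  obtain ⟨s₁, k1, k2, k3⟩ := h.exists_parabolic_branch (c := 1) (by norm_num)
  obtain ⟨s₂, l1, l2, l3⟩ := h.exists_parabolic_branch (c := -1) (by norm_num)
  have hy : Tendsto (fun z : ℝ × Plane => z.2.2) (𝓝 0) (𝓝 0) := by
    have : Continuous (fun z : ℝ × Plane => z.2.2) := by fun_prop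
    exact this.tendsto 0
  have hb : ∀ᶠ y in 𝓝 (0 : ℝ), |s₁ y| < 2 ∧ |s₂ y| < 2 ∧ s₁ y ≠ s₂ y ∧
      hess (G 0) (y * s₁ y, y) = 0 ∧ hess (G 0) (y * s₂ y, y) = 0 := by
    have c1 : ∀ᶠ y in 𝓝 (0 : ℝ), |s₁ y| < 2 :=
      k1.continuous.abs.continuousAt.eventually (gt_mem_nhds (by simp only [k2]; norm_num))
    have c2 : ∀ᶠ y in 𝓝 (0 : ℝ), |s₂ y| < 2 :=
      l1.continuous.abs.continuousAt.eventually (gt_mem_nhds (by simp only [l2]; norm_num))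
    have c3 : ∀ᶠ y in 𝓝 (0 : ℝ), s₁ y - s₂ y ≠ 0 :=
      (k1.continuous.sub l1.continuous).continuousAt.eventually_ne
        (show s₁ 0 - s₂ 0 ≠ 0 by rw [k2, l2]; norm_num)
    filter_upwards [c1, c2, c3, k3, l3] with y a b c d e
    exact ⟨a, b, sub_ne_zero.1 c, d, e⟩
  obtain ⟨e, -, e0, -, he⟩ := h.exists_ray (Q₁ := fun _ => 1) (Q₂ := fun z => - s z)
    (Q₃ := fun z => s z ^ 2) contDiff_const hs.neg (hs.pow 2) (by simp [hs0])
  filter_upwards [eventually_box (hy.eventually hb), h.eventually_graphs, eventually_box he,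
    h.eventually_flecnodal_arc hs (by rw [hs0]; norm_num) (by rw [hs0]; norm_num)
      (by rw [hs0]; norm_num), eventually_graph_isSmoothArc k1 (by rw [k2]; norm_num),
    eventually_graph_isSmoothArc l1 (by rw [l2]; norm_num), eventually_box hflec,
    self_mem_nhdsWithin] with r a1 a2 a3 a4 a5 a6 a7 hr
  have hr0 : (0 : ℝ) < r := hr
  have hr1 : |(0 : ℝ)| < r := by simpa using hr0
  obtain ⟨α, β, hg⟩ := a2.self_of_nhds
  have a1' : ∀ y ∈ Ioo (-r) r, _ := fun y hy => a1 0 (0, y) hr1 ⟨⟨by simp only; linarith,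
    by simp only; linarith⟩, hy⟩
  have hpar := hg.parabolicSet_eq hr0 ⟨h.j20, h.j11, h.j02⟩ a1'
  have hfl : flecnodalSet (G 0) (box r) = {p ∈ box r | rootQuad G s (0, p) = 0} := by
    ext p
    simp only [flecnodalSet, mem_ofPred_eq]
    exact and_congr_right fun hp => a7 0 p hr1 hp
  have h0f : rootQuad G s (0, 0) = 0 := by
    change rootQuad G s 0 = 0
    simp [rootQuad, h.j20, h.j11, h.j02]
  have hu2 : u.2 ≠ 0 := fun hc => hu (Prod.ext hu1 hc)
  refine ⟨(1, 1), (-1, 1), _, _, ?_, a5 (1, 1) (by simp) (by simp [k2]), a6 (-1, 1) (by simp)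
    (by simp [l2]), hpar, ?_, ?_, ?_, ?_, ?_⟩
  · rw [hfl]; exact a4 u hu (by rw [hs0, hu1]; simp)
  · ext p
    simp only [mem_inter_iff, mem_ofPred_eq, mem_singleton_iff]
    constructor
    · rintro ⟨⟨hp, h1⟩, -, h2⟩
      have h3 := (a1' p.2 hp.2).2.2.1
      have h4 : p.2 * (s₁ p.2 - s₂ p.2) = 0 := by linear_combination h2 - h1
      have h5 := (mul_eq_zero.1 h4).resolve_right (sub_ne_zero.2 h3)
      rw [h5] at h1
      exact Prod.ext (by simpa using h1) h5
    · rintro rfl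
      exact ⟨⟨zero_mem_box hr0, by simp⟩, zero_mem_box hr0, by simp⟩
  · rw [hfl]
    ext p
    simp only [parabolicSet, mem_inter_iff, mem_ofPred_eq, mem_singleton_iff]
    constructor
    · rintro ⟨⟨hp, h1⟩, -, h2⟩
      have h3 : J G 2 0 (0, p) * J G 0 2 (0, p) - J G 1 1 (0, p) ^ 2 = 0 := h2
      obtain ⟨h4, h5⟩ := parabolic_form (v := (s (0, p), 1)) h3 (by
        rw [rootQuad] at h1; simp only; linear_combination h1)
      simp only at h4 h5
      have := a3 0 p hr1 hp ⟨J G 2 0 (0, p), by ring, by linear_combination h4,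
        by linear_combination h5 - s (0, p) * h4⟩
      simpa [e0] using this
    · rintro rfl
      refine ⟨⟨zero_mem_box hr0, h0f⟩, zero_mem_box hr0, ?_⟩
      have := hess_J G 0
      simp only [Prod.fst_zero, Prod.snd_zero] at this
      rw [this, h.j20, h.j11]; norm_num
  · rw [linearIndependent_pair_iff]; norm_num
  · rw [linearIndependent_pair_iff]; simp [hu1, hu2]
  · rw [linearIndependent_pair_iff]; simp [hu1, hu2]

/-- The ellipnode is the ray of the definite factor and the godron is the ray of the square of the
real factor. The functional `-Q₁ + Q₃` is `2` on the first and `-1` on the second, so their factors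
have opposite signs for each `ε ≠ 0`. The second conjunct is retained because `PosGodron`, unlike
negativity, is visibly invariant under linear maps. -/
theorem NormalFamily.eventually_dFourPlusTransition (h : NormalFamily 1 G) {u : Plane} (hu : u ≠ 0)
    (hu3 : ddPow 3 u (G 0) 0 = 0) (hu4 : ddPow 4 u (G 0) 0 ≠ 0) :
    ∀ᶠ r in 𝓝[>] (0 : ℝ), ∀ᶠ ε₀ in 𝓝[>] (0 : ℝ), DFourPlusTransition G u (box r) ε₀ ∧
      ∀ ε, |ε| < ε₀ → ε ≠ 0 → ∀ p ∈ box r, IsGodron (G ε) p → PosGodron (G ε) p := by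
  have hG := h.smooth
  obtain ⟨s, hs, hs0, hroot⟩ := h.exists_root (s₀ := 0) (by norm_num) (by norm_num)
  have hcof := h.cofactor_pos hs hs0
  have hcomp : ∀ᶠ z in 𝓝 (0 : ℝ × Plane), ∀ v, ddPow 3 v (G z.1) z.2 = 0 →
      ∃ _ : Unit, v.1 = s z * v.2 := by
    filter_upwards [hroot, hcof] with z h1 h2 v hv
    refine ⟨(), ?_⟩
    by_cases hv0 : v = 0
    · rw [hv0]; simp
    · rw [cubic_factor hG h1] at hv
      have := (mul_eq_zero.1 hv).resolve_right (quad_pos h2.1 h2.2 hv0).ne'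
      linarith
  have hu1 : u.1 = 0 := by
    obtain ⟨-, h1⟩ := hcomp.self_of_nhds u hu3
    simpa [hs0] using h1
  have hu2 : u.2 ≠ 0 := fun hc => hu (Prod.ext hu1 hc)
  have hq : ddPow 4 (s 0, 1) (G 0) 0 ≠ 0 := by
    have e1 := quartic_J hG 0 u
    have e2 := quartic_J hG 0 (s 0, 1)
    simp only [Prod.fst_zero, Prod.snd_zero] at e1 e2
    rw [e1, hu1] at hu4
    rw [e2, hs0]
    intro hc
    apply hu4
    linear_combination u.2 ^ 4 * hc
  have hquart := h.eventually_quartic_ne hs hq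
  have hflec : ∀ᶠ z in 𝓝 (0 : ℝ × Plane), IsFlecnodal (G z.1) z.2 ↔ rootQuad G s z = 0 := by
    filter_upwards [hroot, hcomp] with z h1 h2
    rw [isFlecnodal_iff hG (fun _ : Unit => h1) h2]
    simp
  obtain ⟨e, ce, e0, e1, e2⟩ := h.exists_ray (hG.jet 3 0) (cofactor₂_contDiff hG hs)
    (cofactor₃_contDiff hG hs) (by
      simp only [cofactor₃, h.j30, h.j21, h.j12, hs0]; norm_num)
  obtain ⟨g, cg, g0, g1, g2⟩ := h.exists_ray (Q₁ := fun _ => 1) (Q₂ := fun z => - s z)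
    (Q₃ := fun z => s z ^ 2) contDiff_const hs.neg (hs.pow 2) (by simp [hs0])
  have hpg := h.posGodron hs (by rw [hs0]; norm_num) hroot
  have hen := h.ellipnode hs hs0 hroot
  filter_upwards [h.eventually_curves_zero hs hs0 hflec hu hu1, h.eventually_graphs,
    eventually_box h.eventually_increasing, eventually_box h.isolated, eventually_box hcomp,
    eventually_box hquart, eventually_box e2, eventually_box g2, eventually_box hpg,
    eventually_box hen, eventually_box hroot, eventually_box hcof, self_mem_nhdsWithin]
    with r a1 a2 a3 a4 a5 a6 a7 a8 a9 a10 a11 a12 hr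
  have hr0 : (0 : ℝ) < r := hr
  have hbox : ∀ k : ℝ → Plane, ContDiff ℝ ∞ k → k 0 = 0 → ∀ᶠ ε in 𝓝 (0 : ℝ), k ε ∈ box r := by
    intro k hk hk0
    exact hk.continuous.continuousAt.eventually
      ((isOpen_box r).mem_nhds (by rw [hk0]; exact zero_mem_box hr0))
  filter_upwards [eventually_forall_abs_lt a2, eventually_forall_abs_lt e1,
    eventually_forall_abs_lt g1, eventually_forall_abs_lt (hbox e ce e0),
    eventually_forall_abs_lt (hbox g cg g0), Ioo_mem_nhdsGT hr0] with ε₀ b1 b2 b3 b4 b5 b6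
  have hlt : ∀ ε, |ε| < ε₀ → |ε| < r := fun ε hε => hε.trans b6.2
  -- the points of the two rays
  have gpt : ∀ ε, |ε| < ε₀ → ε ≠ 0 → PosGodron (G ε) (g ε) ∧
      ∃ τ : ℝ, J G 2 0 (ε, g ε) = τ * 1 ∧ J G 1 1 (ε, g ε) = τ * (- s (ε, g ε)) ∧
        J G 0 2 (ε, g ε) = τ * s (ε, g ε) ^ 2 ∧ 0 < τ * ε * (speed 1 G * (-1)) := by
    intro ε hε hε0
    obtain ⟨τ, t1, t2, t3, t4⟩ := b3 ε hε
    have t4 := t4 hε0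
    simp only [hs0] at t4
    norm_num at t4
    have hτ : τ ≠ 0 := by rintro rfl; simp at t4
    exact ⟨a9 ε (g ε) (hlt ε hε) (b5 ε hε) τ hτ t1 t2 t3, τ, t1, t2, t3, by simpa using t4⟩
  have ept : ∀ ε, |ε| < ε₀ → ε ≠ 0 → IsEllipnode (G ε) (e ε) ∧ IsNode (G ε) (e ε) ∧
      0 < J G 2 0 (ε, e ε) * ε * speed 1 G := by
    intro ε hε hε0
    obtain ⟨τ, t1, t2, t3, t4⟩ := b2 ε hε
    have t4 := t4 hε0
    have hk : -J G 3 0 0 + 1 * cofactor₃ G s 0 = 2 := by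
      simp only [cofactor₃, h.j30, h.j21, h.j12, hs0]; norm_num
    rw [hk] at t4
    have hτ : τ ≠ 0 := by rintro rfl; simp at t4
    have h1 := a10 ε (e ε) (hlt ε hε) (b4 ε hε) τ hτ t1 t2 t3
    refine ⟨h1.1, h1.2, ?_⟩
    rw [t1]
    have := mul_pos t4 (a12 ε (e ε) (hlt ε hε) (b4 ε hε)).1
    linarith
  have hgod : ∀ ε, |ε| < ε₀ → ∀ p ∈ box r, IsGodron (G ε) p → p = g ε := by
    intro ε hε p hp hgp
    obtain ⟨-, τ, t1, t2, t3⟩ := ray_of_isGodron hG (z := (ε, p)) (a5 ε p (hlt ε hε) hp) hgp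
    exact a8 ε p (hlt ε hε) hp ⟨τ, t1, t2, t3⟩
  refine ⟨?_, ?_⟩
  swap
  · intro ε hε hε0 p hp hgp
    rw [hgod ε hε p hp hgp]; exact (gpt ε hε hε0).1
  have hdom : ∀ ε, |ε| < ε₀ → IsConnected (ellipticUp (G ε) (box r)) ∧
      IsConnected (ellipticDown (G ε) (box r)) ∧ ellipticSet (G ε) (box r) =
        ellipticUp (G ε) (box r) ∪ ellipticDown (G ε) (box r) := by
    intro ε hε
    obtain ⟨α, β, hg⟩ := b1 ε hε
    refine ⟨?_, ?_, ellipticSet_eq_union (hG.slice ε) _⟩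
    · rw [hg.ellipticUp_eq hG]; exact isConnected_above hr0 hg.cont_min hg.bound_min
    · rw [hg.ellipticDown_eq hG]; exact isConnected_below hr0 hg.cont_max hg.bound_max
  have hiso : ∀ ε, |ε| < ε₀ → ∀ p ∈ box r, J G 2 0 (ε, p) = 0 → J G 1 1 (ε, p) = 0 →
      J G 0 2 (ε, p) = 0 → ε = 0 ∧ p = 0 := by
    intro ε hε p hp t1 t2 t3
    have := a4 ε p (hlt ε hε) hp t1 t2 t3
    exact ⟨congrArg Prod.fst this, congrArg Prod.snd this⟩
  have h00 : |(0 : ℝ)| < ε₀ := by simpa using b6.1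
  refine ⟨a1, hdom, ?_, ?_, ?_, ?_⟩
  · obtain ⟨α, β, hg⟩ := b1 0 h00
    rw [hg.inter_closures_eq hG]
    ext p
    simp only [mem_ofPred_eq, mem_singleton_iff]
    constructor
    · rintro ⟨hp, t1, t2, t3⟩; exact (hiso 0 h00 p hp t1 t2 t3).2
    · rintro rfl; exact ⟨zero_mem_box hr0, h.j20, h.j11, h.j02⟩
  · intro ε hε hε0
    obtain ⟨α, β, hg⟩ := b1 ε hε
    refine ⟨?_, ?_, ?_, ?_, ?_⟩
    · rw [hg.inter_closures_eq hG]
      ext p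
      simp only [mem_ofPred_eq, mem_empty_iff_false, iff_false]
      rintro ⟨hp, t1, t2, t3⟩; exact hε0 (hiso ε hε p hp t1 t2 t3).1
    · rw [hg.ellipticUp_eq hG, hg.ellipticDown_eq hG, box_inter_frontier_above hg.cont_min,
        box_inter_frontier_below hg.cont_max]
      ext p
      simp only [parabolicSet, mem_ofPred_eq, mem_union]
      constructor
      · rintro ⟨hp, h1⟩
        rcases (hg.hess_eq_zero_iff hp).1 h1 with h2 | h2
        · exact Or.inl ⟨hp, h2⟩
        · exact Or.inr ⟨hp, h2⟩
      · rintro (⟨hp, h2⟩ | ⟨hp, h2⟩)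
        · exact ⟨hp, (hg.hess_eq_zero_iff hp).2 (Or.inl h2)⟩
        · exact ⟨hp, (hg.hess_eq_zero_iff hp).2 (Or.inr h2)⟩
    · rw [hg.ellipticUp_eq hG, box_inter_frontier_above hg.cont_min]
      exact graph_homeomorph_real hr0 hg.cont_min hg.bound_min rfl
    · rw [hg.ellipticDown_eq hG, box_inter_frontier_below hg.cont_max]
      exact graph_homeomorph_real hr0 hg.cont_max hg.bound_max rfl
    · rintro p ⟨hp, h1⟩
      have h2 := a3 ε p (hlt ε hε) hp
      exact fderiv_hess_ne_zero hG (z := (ε, p)) h2.1 h2.2 h1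
        fun hc => hε0 (hiso ε hε p hp hc.1 hc.2.1 hc.2.2).1
  · have hsp : speed 1 G ≠ 0 := h.transverse
    obtain ⟨sg, hsg, hsg2⟩ : ∃ sg : ℝ, (sg = 1 ∨ sg = -1) ∧ 0 < sg * speed 1 G := by
      rcases lt_or_gt_of_ne hsp with h1 | h1
      · exact ⟨-1, Or.inr rfl, by linarith⟩
      · exact ⟨1, Or.inl rfl, by linarith⟩
    have hsg1 : sg * sg = 1 := by rcases hsg with rfl | rfl <;> norm_num
    refine ⟨sg, e, g, hsg, ce.continuous.continuousOn, e0, cg.continuous.continuousOn, g0, ?_⟩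
    intro ε hε hε0
    obtain ⟨p1, p2, p3⟩ := ept ε hε hε0
    obtain ⟨q1, τ, t1, t2, t3, t4⟩ := gpt ε hε hε0
    obtain ⟨α, β, hg⟩ := b1 ε hε
    have hgh : hess (G ε) (g ε) = 0 := by
      have := hess_J G (ε, g ε)
      simp only at this
      rw [this, t1, t2, t3]; ring
    have hfr := box_inter_frontier_above hg.cont_min
    have hfr2 := box_inter_frontier_below hg.cont_max
    have hmul : eigMin (J G 2 0 (ε, g ε)) (J G 1 1 (ε, g ε)) (J G 0 2 (ε, g ε)) *
        eigMax (J G 2 0 (ε, g ε)) (J G 1 1 (ε, g ε)) (J G 0 2 (ε, g ε)) = 0 := by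
      rw [eigMin_mul_eigMax, t1, t2, t3]; ring
    have hspr := spread_nonneg (J G 2 0 (ε, g ε)) (J G 1 1 (ε, g ε)) (J G 0 2 (ε, g ε))
    have htr : J G 2 0 (ε, g ε) + J G 0 2 (ε, g ε) = τ * (1 + s (ε, g ε) ^ 2) := by
      rw [t1, t3]; ring
    have hpos1 : 0 < 1 + s (ε, g ε) ^ 2 := by positivity
    refine ⟨?_, p1, ?_, q1.isNegativeGodron (hG.slice ε), ?_, ?_⟩
    · ext p
      simp only [mem_ofPred_eq, mem_singleton_iff]
      constructor
      · rintro ⟨hp, -, hn⟩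
        exact a7 ε p (hlt ε hε) hp (proportional_of_elliptic_node hG (z := (ε, p))
          (a11 ε p (hlt ε hε) hp) (a12 ε p (hlt ε hε) hp) hn)
      · rintro rfl; exact ⟨b4 ε hε, p1.1, p2⟩
    · ext p
      simp only [mem_ofPred_eq, mem_singleton_iff]
      constructor
      · rintro ⟨hp, hn⟩; exact hgod ε hε p hp hn
      · rintro rfl; exact ⟨b5 ε hε, q1.isGodron⟩
    · intro hsε
      have hse : 0 < ε * speed 1 G := by
        have := mul_pos hsε hsg2
        have e : sg * ε * (sg * speed 1 G) = sg * sg * (ε * speed 1 G) := by ring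
        rw [e, hsg1, one_mul] at this; exact this
      constructor
      · refine ⟨⟨b4 ε hε, p1.1⟩, (coorientedUp_iff (hG.slice ε) p1.1).2 ?_⟩
        change 0 < J G 2 0 (ε, e ε)
        exact (pos_iff_pos_of_mul_pos (by linarith : 0 < J G 2 0 (ε, e ε) * (ε * speed 1 G))).2 hse
      -- The form at `g ε` is then nonzero and negative semidefinite: its trace is negative, so the
      -- vanishing eigenvalue is the larger one and `g ε` lies on the graph of `β`.
      · have hτ : τ < 0 := by
          by_contra! hc
          have := mul_nonneg hc hse.le
          linarith
        rw [hg.ellipticDown_eq hG]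
        suffices H : g ε ∈ {p ∈ box r | p.1 = β p.2} by rw [← hfr2] at H; exact H.2
        refine ⟨b5 ε hε, (hg.max_iff _ (b5 ε hε)).1.1 ?_⟩
        refine (mul_eq_zero.1 hmul).resolve_left ?_
        have : τ * (1 + s (ε, g ε) ^ 2) < 0 := mul_neg_of_neg_of_pos hτ hpos1
        rw [eigMin]; linarith
    · intro hsε
      have hse : ε * speed 1 G < 0 := by
        have := mul_neg_of_neg_of_pos hsε hsg2
        have e : sg * ε * (sg * speed 1 G) = sg * sg * (ε * speed 1 G) := by ring
        rw [e, hsg1, one_mul] at this; exact this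
      constructor
      · refine ⟨⟨b4 ε hε, p1.1⟩, (coorientedDown_iff (hG.slice ε) p1.1).2 ?_⟩
        change J G 2 0 (ε, e ε) < 0
        by_contra! hc
        have := mul_nonpos_of_nonneg_of_nonpos hc hse.le
        linarith
      · have hτ : 0 < τ := by
          by_contra! hc
          have := mul_nonneg_of_nonpos_of_nonpos hc hse.le
          linarith
        rw [hg.ellipticUp_eq hG]
        suffices H : g ε ∈ {p ∈ box r | p.1 = α p.2} by rw [← hfr] at H; exact H.2
        refine ⟨b5 ε hε, (hg.min_iff _ (b5 ε hε)).1.1 ?_⟩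
        refine (mul_eq_zero.1 hmul).resolve_right ?_
        have : 0 < τ * (1 + s (ε, g ε) ^ 2) := mul_pos hτ hpos1
        rw [eigMax]; linarith
  · intro ε hε p hp
    exact not_isBiflecnode (a5 ε p (hlt ε hε) hp) hG (z := (ε, p))
      (fun _ => a6 ε p (hlt ε hε) hp)

end DFourPlusTransition

/-! ### Sublevel sets of strictly convex functions -/

section Disc

variable {k : Plane → ℝ} {r ρ : ℝ}

/-- Average of the tangent plane inequalities at the intermediate point, where the linear terms
cancel. -/
theorem convex_sublevel (hk : ContDiff ℝ ∞ k)
    (hpos : ∀ p ∈ box r, ∀ v : Plane, v ≠ 0 → 0 < ddPow 2 v k p) {p q : Plane} (hp : p ∈ box r)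
    (hq : q ∈ box r) {a b : ℝ} (ha : 0 ≤ a) (hb : 0 ≤ b) (hab : a + b = 1) :
    k (a • p + b • q) ≤ a * k p + b * k q := by
  set m := a • p + b • q with hm
  have hmb : m ∈ box r := convex_box r hp hq ha hb hab
  have key : ∀ x ∈ box r, k m + fderiv ℝ k m (x - m) ≤ k x := by
    intro x hx
    by_cases h : x = m
    · rw [h]; simp
    · exact (tangent_lt_of_posDef hk (convex_box r) hpos hmb hx h).le
  have h1 := mul_le_mul_of_nonneg_left (key p hp) ha
  have h2 := mul_le_mul_of_nonneg_left (key q hq) hb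
  have h3 : a * fderiv ℝ k m (p - m) + b * fderiv ℝ k m (q - m) = 0 := by
    rw [← smul_eq_mul, ← smul_eq_mul, ← map_smul, ← map_smul, ← map_add]
    have : a • (p - m) + b • (q - m) = 0 := by
      have e : a • (p - m) + b • (q - m) = (a • p + b • q) - (a + b) • m := by
        rw [smul_sub, smul_sub, add_smul]; abel
      rw [e, hab, one_smul, ← hm, sub_self]
    rw [this, map_zero]
  have h4 : k m = a * k m + b * k m := by rw [← add_mul, hab, one_mul]
  linarith

/-- A compact component of a sublevel set of a strictly convex function is a disc. -/
theorem exists_homeomorph_sublevel (hk : ContDiff ℝ ∞ k)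
    (hpos : ∀ p ∈ box r, ∀ v : Plane, v ≠ 0 → 0 < ddPow 2 v k p)
    (hρ : ρ < r) (hbd : ∀ p ∈ box r, k p ≤ 0 → ‖p‖ ≤ ρ) (hne : ∃ p ∈ box r, k p < 0) :
    IsPreconnected {p ∈ box r | k p < 0} ∧ (∃ Φ : Plane ≃ₜ Plane,
      Φ '' {q | q.1 ^ 2 + q.2 ^ 2 < 1} = {p ∈ box r | k p < 0} ∧
      Φ '' {q | q.1 ^ 2 + q.2 ^ 2 = 1} = {p ∈ box r | k p = 0}) ∧
    ∀ p ∈ box r, k p = 0 → fderiv ℝ k p ≠ 0 := by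
  obtain ⟨c, hc, hkc⟩ := hne
  set S := {p ∈ box r | k p < 0} with hS
  have hconv : Convex ℝ S := by
    rintro p ⟨hp, hp2⟩ q ⟨hq, hq2⟩ a b ha hb hab
    refine ⟨convex_box r hp hq ha hb hab, ?_⟩
    refine (convex_sublevel hk hpos hp hq ha hb hab).trans_lt ?_
    rcases ha.eq_or_lt with rfl | ha'
    · have : b = 1 := by linarith
      rw [this]; linarith
    · nlinarith
  have hopen : IsOpen S := (isOpen_box r).inter (isOpen_lt hk.continuous continuous_const)
  have hsub : S ⊆ Metric.closedBall 0 ρ := fun p hp =>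
    mem_closedBall_zero_iff.2 (hbd p hp.1 hp.2.le)
  obtain ⟨Φ, h1, h2⟩ := exists_homeomorph_disc hconv hopen ⟨c, hc, hkc⟩
    (Metric.isBounded_closedBall.subset hsub)
  refine ⟨hconv.isPreconnected, ⟨Φ, h1, ?_⟩, ?_⟩
  · rw [h2, hopen.frontier_eq]
    ext p
    constructor
    · rintro ⟨hp, hpS⟩
      -- The bound `ρ < r` keeps the closure of the sublevel set inside the box, so that its
      -- frontier is the zero level only.
      have hb : p ∈ box r := mem_box_of_norm_lt
        ((mem_closedBall_zero_iff.1 (closure_minimal hsub Metric.isClosed_closedBall hp)).trans_lt hρ)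
      refine ⟨hb, le_antisymm ?_ (not_lt.1 fun h => hpS ⟨hb, h⟩)⟩
      exact closure_minimal (fun q hq => hq.2.le) (isClosed_le hk.continuous continuous_const) hp
    · rintro ⟨hp, hp0⟩
      refine ⟨?_, fun h => h.2.ne hp0⟩
      have ht : Tendsto (fun t : ℝ => (1 - t) • p + t • c) (𝓝[>] 0) (𝓝 p) := by
        have : Continuous (fun t : ℝ => (1 - t) • p + t • c) := by fun_prop
        have := this.tendsto 0
        simp only [sub_zero, one_smul, zero_smul, add_zero] at this
        exact this.mono_left nhdsWithin_le_nhds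
      apply mem_closure_of_tendsto ht
      filter_upwards [Ioo_mem_nhdsGT (zero_lt_one' ℝ)] with t ht
      have ht' : 0 ≤ 1 - t := by linarith [ht.2]
      refine ⟨convex_box r hp hc ht' ht.1.le (by ring), ?_⟩
      refine (convex_sublevel hk hpos hp hc ht' ht.1.le (by ring)).trans_lt ?_
      rw [hp0, mul_zero, zero_add]
      exact mul_neg_of_pos_of_neg ht.1 hkc
  -- A critical point of a strictly convex function is its minimum, which contradicts `k c < 0`.
  · intro p hp hp0 hd
    have hne : c ≠ p := by rintro rfl; exact hkc.ne hp0
    have := tangent_lt_of_posDef hk (convex_box r) hpos hp hc hne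
    rw [hp0, hd] at this
    simp only [zero_apply, add_zero] at this
    linarith

end Disc

/-! ### The case `D₄⁻`: size and convexity of the elliptic set -/

section DFourMinus

variable {G : ℝ → Plane → ℝ}

/-- The matrix with entries `x, -y, -x` has determinant `-(x² + y²) ≤ -N²`. Entrywise errors up to
`E` raise it by at most `4NE + E²`, which is not enough when `N > 5E`. -/
theorem le_five_mul_of_near_saddle {x y a b c N E : ℝ} (hE : 0 ≤ E) (hN : 0 ≤ N) (hx : |x| ≤ N)
    (hy : |y| ≤ N) (hxy : N ^ 2 ≤ x ^ 2 + y ^ 2) (ha : |a - x| ≤ E) (hb : |b + y| ≤ E)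
    (hc : |c + x| ≤ E) (h : b ^ 2 ≤ a * c) : N ≤ 5 * E := by
  obtain ⟨p, rfl⟩ : ∃ p, a = p + x := ⟨a - x, by ring⟩
  obtain ⟨q, rfl⟩ : ∃ q, b = q - y := ⟨b + y, by ring⟩
  obtain ⟨s, rfl⟩ : ∃ s, c = s - x := ⟨c + x, by ring⟩
  simp only [add_sub_cancel_right, sub_add_cancel] at ha hb hc
  have b1 : x * (s - p) ≤ N * (2 * E) := by
    refine (le_abs_self _).trans ?_
    rw [abs_mul]
    exact mul_le_mul hx (by linarith [abs_sub s p]) (abs_nonneg _) hN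
  have b2 : p * s ≤ E * E := by
    refine (le_abs_self _).trans ?_
    rw [abs_mul]
    exact mul_le_mul ha hc (abs_nonneg _) hE
  have b3 : y * q ≤ N * E := by
    refine (le_abs_self _).trans ?_
    rw [abs_mul]
    exact mul_le_mul hy hb (abs_nonneg _) hN
  have b4 : N ^ 2 ≤ 4 * (N * E) + E * E := by linarith [sq_nonneg q]
  by_contra! hlt
  have c1 : 0 < N * (N - 5 * E) := mul_pos (by linarith) (by linarith)
  have c2 : 0 ≤ E * (N - E) := mul_nonneg hE (by linarith)
  linarith

/-- With `N = ‖(x, y)‖` the second derivatives are within `E = K|ε| + N/10` of those of the saddle.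
The inequality `N ≤ 5E` absorbs `N/2` and leaves `N ≤ 10K|ε|`. -/
theorem NormalFamily.exists_bound (h : NormalFamily (-1) G) : ∃ C : ℝ, 0 < C ∧
    ∀ᶠ z in 𝓝 (0 : ℝ × Plane), 0 ≤ hess (G z.1) z.2 → ‖z.2‖ ≤ C * |z.1| := by
  set a := fderiv ℝ (J G 2 0) 0 (1, 0)
  set b := fderiv ℝ (J G 1 1) 0 (1, 0)
  set c := fderiv ℝ (J G 0 2) 0 (1, 0)
  set K := |a| + |b| + |c| + 1 with hK
  have ha0 := abs_nonneg a
  have hb0 := abs_nonneg b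
  have hc0 := abs_nonneg c
  have hKpos : 0 < K := by positivity
  refine ⟨10 * K, by positivity, ?_⟩
  filter_upwards [h.estimate (η := 1 / 10) (by norm_num)] with z hz hh
  rw [hess_J] at hh
  obtain ⟨h1, h2, h3⟩ := hz
  set N := ‖z.2‖ with hN
  have hN0 : 0 ≤ N := norm_nonneg _
  have hn : ‖z‖ ≤ |z.1| + N := by
    rw [Prod.norm_def, Real.norm_eq_abs]
    exact max_le (by linarith) (by linarith [abs_nonneg z.1])
  have hmul : ∀ k : ℝ, |k| ≤ K - 1 → |z.1 * k| ≤ |z.1| * (K - 1) := by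
    intro k hk
    rw [abs_mul]
    exact mul_le_mul_of_nonneg_left hk (abs_nonneg _)
  have ma := abs_le.1 (hmul a (by linarith))
  have mb := abs_le.1 (hmul b (by linarith))
  have mc := abs_le.1 (hmul c (by linarith))
  set E := |z.1| * K + 1 / 10 * N with hE
  have hE0 : 0 ≤ E := by positivity
  rw [abs_le] at h1 h2 h3
  have hz0 := abs_nonneg z.1
  have e1 : |J G 2 0 z - z.2.1| ≤ E := by rw [abs_le]; constructor <;> linarith
  have e2 : |J G 1 1 z + z.2.2| ≤ E := by rw [abs_le]; constructor <;> linarith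
  have e3 : |J G 0 2 z + z.2.1| ≤ E := by rw [abs_le]; constructor <;> linarith
  set x := z.2.1
  set y := z.2.2
  have hx : |x| ≤ N := by rw [hN, Prod.norm_def]; exact le_max_left _ _
  have hy : |y| ≤ N := by rw [hN, Prod.norm_def]; exact le_max_right _ _
  have hNsq : N ^ 2 ≤ x ^ 2 + y ^ 2 := by
    rw [hN, Prod.norm_def]
    rcases max_choice ‖z.2.1‖ ‖z.2.2‖ with h | h <;> rw [h, Real.norm_eq_abs, sq_abs]
    · linarith [sq_nonneg y]
    · linarith [sq_nonneg x]
  have hN5 := le_five_mul_of_near_saddle hE0 hN0 hx hy hNsq e1 e2 e3 (by linarith)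
  linarith

theorem smoothFamily_neg_hess (hG : SmoothFamily G) : SmoothFamily (fun ε p => - hess (G ε) p) := by
  have := ((hG.jet 2 0).mul (hG.jet 0 2)).sub ((hG.jet 1 1).pow 2)
  exact this.neg

/-- For `ε = 0` the Hessian is `-(x² + y²)` to second order, so `-hess` has second differential
twice the identity at the origin. -/
theorem NormalFamily.eventually_hess_concave (h : NormalFamily (-1) G) :
    ∀ᶠ z in 𝓝 (0 : ℝ × Plane), ∀ v : Plane, v ≠ 0 → 0 < ddPow 2 v (fun p => - hess (G z.1) p) z.2 := by
  set H : ℝ → Plane → ℝ := fun ε p => - hess (G ε) p with hH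
  have hs : SmoothFamily H := smoothFamily_neg_hess h.smooth
  have sm := fun i j => h.smooth.jet i j
  -- Each term of `∂_d hess` contains a second derivative, which vanishes at the origin; only the
  -- derivatives of these factors survive there.
  have key : ∀ d : Plane, ∀ A : ℝ × Plane → ℝ, (∀ z, A z = dd d (H z.1) z.2) →
      ∀ e : Plane, fderiv ℝ A 0 (0, e) = 2 * (d.1 * e.1 + d.2 * e.2) := by
    intro d A hA e
    have hA' : A = -(J G 2 0 * (fun z => d.1 * J G 1 2 z + d.2 * J G 0 3 z)
        + J G 0 2 * (fun z => d.1 * J G 3 0 z + d.2 * J G 2 1 z)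
        - (fun z => 2 * J G 1 1 z) * (fun z => d.1 * J G 2 1 z + d.2 * J G 1 2 z)) := by
      ext z
      have hf := h.smooth.slice z.1
      have e1 : dd d (H z.1) z.2 = - fderiv ℝ (hess (G z.1)) z.2 d := by
        simp only [dd, H]
        rw [fderiv_fun_neg]; rfl
      rw [hA, e1, fderiv_hess hf]
      rfl
    have D := fun i j => ((sm i j).differentiable (by simp) 0).hasFDerivAt
    have := ((((D 2 0).mul (((D 1 2).const_mul d.1).add ((D 0 3).const_mul d.2))).add
      ((D 0 2).mul (((D 3 0).const_mul d.1).add ((D 2 1).const_mul d.2)))).sub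
      (((D 1 1).const_mul 2).mul (((D 2 1).const_mul d.1).add ((D 1 2).const_mul d.2)))).neg.fderiv
    rw [hA']
    erw [this]
    simp [h.j20, h.j11, h.j02, h.j30, h.j21, h.j12, h.j03, h.smooth.fderiv_J]
    ring
  have s20 := hs.jet 2 0
  have s11 := hs.jet 1 1
  have s02 := hs.jet 0 2
  have d10 : ∀ z, J H 1 0 z = dd (1, 0) (H z.1) z.2 := fun z => rfl
  have d01 : ∀ z, J H 0 1 z = dd (0, 1) (H z.1) z.2 := fun z => rfl
  have v20 : J H 2 0 0 = 2 := by
    have := hs.fderiv_J 1 0 0 (1, 0)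
    rw [key _ _ d10] at this
    simpa using this.symm
  have v11 : J H 1 1 0 = 0 := by
    have := hs.fderiv_J 1 0 0 (0, 1)
    rw [key _ _ d10] at this
    simpa using this.symm
  have v02 : J H 0 2 0 = 2 := by
    have := hs.fderiv_J 0 1 0 (0, 1)
    rw [key _ _ d01] at this
    simpa using this.symm
  filter_upwards [eventually_pos s20 (by rw [v20]; norm_num),
    eventually_pos ((s20.mul s02).sub (s11.pow 2)) (by simp only [v20, v11, v02]; norm_num)]
    with z h1 h2 v hv
  have := quad_J hs z v
  simp only [H] at this
  rw [this]
  exact quad_pos h1 h2 hv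

end DFourMinus

/-! ### Cubic forms with three real roots -/

section CubicRoots

/-- Divided differences of the root equations give Vieta's relations `F` and `F2`, and hence the
factorisation into three linear factors. -/
theorem exists_eq_root_mul {a b c d : ℝ} {s : Fin 3 → ℝ} (hs : ∀ i j, i ≠ j → s i ≠ s j)
    (ha : a ≠ 0) (hroot : ∀ i, s i ^ 3 * a + 3 * s i ^ 2 * b + 3 * s i * c + d = 0) {v : Plane}
    (hv : v.1 ^ 3 * a + 3 * v.1 ^ 2 * v.2 * b + 3 * v.1 * v.2 ^ 2 * c + v.2 ^ 3 * d = 0) :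
    ∃ i, v.1 = s i * v.2 := by
  have r0 := hroot 0
  have r1 := hroot 1
  have r2 := hroot 2
  have h01 := sub_ne_zero.2 (hs 0 1 (by decide))
  have h02 := sub_ne_zero.2 (hs 0 2 (by decide))
  have h12 := sub_ne_zero.2 (hs 1 2 (by decide))
  have E1 : a * (s 0 ^ 2 + s 0 * s 1 + s 1 ^ 2) + 3 * b * (s 0 + s 1) + 3 * c = 0 := by
    apply (mul_eq_zero.1 (?_ : (s 0 - s 1) * _ = 0)).resolve_left h01
    linear_combination r0 - r1
  have E2 : a * (s 0 ^ 2 + s 0 * s 2 + s 2 ^ 2) + 3 * b * (s 0 + s 2) + 3 * c = 0 := by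
    apply (mul_eq_zero.1 (?_ : (s 0 - s 2) * _ = 0)).resolve_left h02
    linear_combination r0 - r2
  have F : a * (s 0 + s 1 + s 2) + 3 * b = 0 := by
    apply (mul_eq_zero.1 (?_ : (s 1 - s 2) * _ = 0)).resolve_left h12
    linear_combination E1 - E2
  have F2 : 3 * c - a * (s 0 * s 1 + s 0 * s 2 + s 1 * s 2) = 0 := by
    linear_combination E1 - (s 0 + s 1) * F
  have key : a * ((v.1 - s 0 * v.2) * (v.1 - s 1 * v.2) * (v.1 - s 2 * v.2)) = 0 := by
    linear_combination hv - v.1 ^ 2 * v.2 * F - v.1 * v.2 ^ 2 * F2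
      - v.2 ^ 3 * (r0 - s 0 * F2 - s 0 ^ 2 * F)
  rcases mul_eq_zero.1 ((mul_eq_zero.1 key).resolve_left ha) with h | h
  · rcases mul_eq_zero.1 h with h | h
    · exact ⟨0, sub_eq_zero.1 h⟩
    · exact ⟨1, sub_eq_zero.1 h⟩
  · exact ⟨2, sub_eq_zero.1 h⟩

theorem eq_zero_or_sq_eq_three {s : ℝ} (h : s ^ 3 + 3 * (-1) * s = 0) : s = 0 ∨ s ^ 2 = 3 := by
  have : s * (s ^ 2 - 3) = 0 := by linear_combination h
  rcases mul_eq_zero.1 this with h | h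
  · exact Or.inl h
  · exact Or.inr (by linarith)

/-- The roots are `0` and `±√3`. The three quantities are the transversality condition of
`NormalFamily.exists_ray` for the product of two factors and the two conditions of
`NormalFamily.hyperbonode`. -/
theorem root_pair_ne_zero {s t : ℝ} (hs : s ^ 3 + 3 * (-1) * s = 0) (ht : t ^ 3 + 3 * (-1) * t = 0)
    (hst : s ≠ t) : -1 + -1 * (s * t) ≠ 0 ∧ s ^ 2 * t + -1 * (2 * s + t) ≠ 0 ∧
      t ^ 2 * s + -1 * (2 * t + s) ≠ 0 := by
  rcases eq_zero_or_sq_eq_three hs with rfl | h1 <;> rcases eq_zero_or_sq_eq_three ht with rfl | h2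
  · exact absurd rfl hst
  · have : t ≠ 0 := by rintro rfl; norm_num at h2
    refine ⟨by norm_num, by simpa using this, by simpa using this⟩
  · have : s ≠ 0 := by rintro rfl; norm_num at h1
    refine ⟨by norm_num, by simpa using this, by simpa using this⟩
  · have h3 : s = -t := by
      have : (s - t) * (s + t) = 0 := by linear_combination h1 - h2
      have := (mul_eq_zero.1 this).resolve_left (sub_ne_zero.2 hst)
      linarith
    have h4 : t ≠ 0 := by rintro rfl; norm_num at h2
    subst h3
    refine ⟨?_, ?_, ?_⟩ <;> intro hc
    · have : t ^ 2 = 1 := by linear_combination hc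
      rw [h2] at this; norm_num at this
    · apply h4; linear_combination (1 / 4) * hc - (1 / 4) * t * h2
    · apply h4; linear_combination (-1 / 4) * hc - (1 / 4) * t * h2

/-- A pair of roots is labelled by the omitted index `k` and is then `k + 1, k + 2` modulo `3`. -/
theorem exists_complement_index : ∀ i j : Fin 3, i ≠ j →
    ∃ k : Fin 3, (i = k + 1 ∧ j = k + 2) ∨ (i = k + 2 ∧ j = k + 1) := by decide

theorem self_ne_succ : ∀ k : Fin 3, k ≠ k + 1 := by decide

theorem succ_ne_succ_succ : ∀ k : Fin 3, k + 1 ≠ k + 2 := by decide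

end CubicRoots

/-! ### The case `D₄⁻`: the transition -/

section DFourMinusTransition

variable {G : ℝ → Plane → ℝ}

/-- The godrons are the rays of the three squares of linear factors, and the hyperbonodes are the
rays of the three products of two of them. -/
theorem NormalFamily.eventually_dFourMinusTransition (h : NormalFamily (-1) G) {u : Fin 3 → Plane}
    (hu : ∀ i j, i ≠ j → LinearIndependent ℝ ![u i, u j])
    (hu3 : ∀ i, ddPow 3 (u i) (G 0) 0 = 0) (hu4 : ∀ i, ddPow 4 (u i) (G 0) 0 ≠ 0) :
    ∀ᶠ r in 𝓝[>] (0 : ℝ), ∀ᶠ ε₀ in 𝓝[>] (0 : ℝ), DFourMinusTransition G u (box r) ε₀ ∧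
      ∀ ε, |ε| < ε₀ → ε ≠ 0 → ∀ p ∈ box r, IsGodron (G ε) p → PosGodron (G ε) p := by
  have hG := h.smooth
  have hu0 : ∀ i, u i ≠ 0 := by
    intro i hc
    have := (linearIndependent_pair_iff _ _).1 (hu i (i + 1) (self_ne_succ i))
    simp [hc] at this
  have hcub : ∀ i, (u i).1 ^ 3 - 3 * (u i).1 * (u i).2 ^ 2 = 0 := by
    intro i
    have e := cubic_J hG 0 (u i)
    simp only [Prod.fst_zero, Prod.snd_zero] at e
    have := hu3 i
    rw [e, h.j30, h.j21, h.j12, h.j03] at this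
    linear_combination this
  have hu2 : ∀ i, (u i).2 ≠ 0 := by
    intro i hc
    have := hcub i
    rw [hc] at this
    exact hu0 i (Prod.ext (pow_eq_zero_iff three_ne_zero |>.1 (by linear_combination this)) hc)
  have hroot0 : ∀ i, ((u i).1 / (u i).2) ^ 3 + 3 * (-1) * ((u i).1 / (u i).2) = 0 := by
    intro i
    have := hu2 i
    field_simp
    linear_combination hcub i
  have hsimple : ∀ i, ((u i).1 / (u i).2) ^ 2 + (-1) ≠ 0 := by
    intro i
    rcases eq_zero_or_sq_eq_three (hroot0 i) with h1 | h1 <;> rw [h1] <;> norm_num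
  choose s hs hs0 hroot using fun i => h.exists_root (hroot0 i) (hsimple i)
  have hus : ∀ i, (u i).1 = s i 0 * (u i).2 := by
    intro i; rw [hs0, div_mul_cancel₀ _ (hu2 i)]
  have hne0 : ∀ i j, i ≠ j → s i 0 ≠ s j 0 := by
    intro i j hij hc
    apply (linearIndependent_pair_iff _ _).1 (hu i j hij)
    rw [hus i, hus j, hc]; ring
  have hr0' : ∀ i, s i 0 ^ 3 + 3 * (-1) * s i 0 = 0 := fun i => by rw [hs0]; exact hroot0 i
  have hs1' : ∀ i, s i 0 ^ 2 + (-1) ≠ 0 := fun i => by rw [hs0]; exact hsimple i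
  have habs : ∀ i, |s i 0| < 2 := by
    intro i
    apply abs_lt_of_sq_lt_sq _ (by norm_num)
    rcases eq_zero_or_sq_eq_three (hr0' i) with h1 | h1 <;> rw [h1] <;> norm_num
  have hrootall : ∀ᶠ z in 𝓝 (0 : ℝ × Plane), ∀ i, s i z ^ 3 * J G 3 0 z
      + 3 * s i z ^ 2 * J G 2 1 z + 3 * s i z * J G 1 2 z + J G 0 3 z = 0 := eventually_all.2 hroot
  have hdist : ∀ᶠ z in 𝓝 (0 : ℝ × Plane), ∀ i j, i ≠ j → s i z ≠ s j z := by
    refine eventually_all.2 fun i => eventually_all.2 fun j => ?_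
    by_cases hij : i = j
    · exact Eventually.of_forall fun z hc => absurd hij hc
    · filter_upwards [eventually_ne_zero ((hs i).sub (hs j)) (sub_ne_zero.2 (hne0 i j hij))] with z hz _
      exact sub_ne_zero.1 hz
  have hcomp : ∀ᶠ z in 𝓝 (0 : ℝ × Plane), ∀ v, ddPow 3 v (G z.1) z.2 = 0 →
      ∃ i, v.1 = s i z * v.2 := by
    filter_upwards [hrootall, hdist, eventually_ne_zero (hG.jet 3 0) (by rw [h.j30]; exact one_ne_zero)]
      with z h1 h2 h3 v hv
    rw [cubic_J hG] at hv
    exact exists_eq_root_mul (s := fun i => s i z) h2 h3 h1 hv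
  have hquart : ∀ᶠ z in 𝓝 (0 : ℝ × Plane), ∀ i, ddPow 4 (s i z, 1) (G z.1) z.2 ≠ 0 := by
    refine eventually_all.2 fun i => h.eventually_quartic_ne (hs i) ?_
    have e1 := quartic_J hG 0 (u i)
    have e2 := quartic_J hG 0 (s i 0, 1)
    simp only [Prod.fst_zero, Prod.snd_zero] at e1 e2
    have := hu4 i
    rw [e1, hus i] at this
    rw [e2]
    intro hc
    apply this
    linear_combination (u i).2 ^ 4 * hc
  choose g cg g0 g1 g2 using fun i => h.exists_ray (Q₁ := fun _ => 1) (Q₂ := fun z => - s i z)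
    (Q₃ := fun z => s i z ^ 2) contDiff_const (hs i).neg ((hs i).pow 2) (by
      have := sq_nonneg (s i 0)
      intro hc; linarith)
  have hpair := fun k : Fin 3 => root_pair_ne_zero (hr0' (k + 1)) (hr0' (k + 2))
    (hne0 _ _ (succ_ne_succ_succ k))
  choose e ce e0 e1 e2 using fun k : Fin 3 => h.exists_ray (Q₁ := fun _ => 1)
    (Q₂ := fun z => - ((s (k + 1) z + s (k + 2) z) / 2)) (Q₃ := fun z => s (k + 1) z * s (k + 2) z)
    contDiff_const (((hs (k + 1)).add (hs (k + 2))).div_const 2).neg ((hs (k + 1)).mul (hs (k + 2)))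
    (hpair k).1
  -- The form `x² + y²` is definite, so for `ε ≠ 0` this ray is in the elliptic set. It proves that
  -- the set is nonempty, and its sign determines the co-orientation.
  obtain ⟨c, cc, c0, c1, -⟩ := h.exists_ray (Q₁ := fun _ => 1) (Q₂ := fun _ => 0) (Q₃ := fun _ => 1)
    contDiff_const contDiff_const contDiff_const (by norm_num)
  have hpg : ∀ᶠ z in 𝓝 (0 : ℝ × Plane), ∀ i, _ :=
    eventually_all.2 fun i => h.posGodron (hs i) (hs1' i) (hroot i)
  have hhb : ∀ᶠ z in 𝓝 (0 : ℝ × Plane), ∀ k : Fin 3, _ :=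
    eventually_all.2 fun k => h.hyperbonode (hs (k + 1)) (hs (k + 2)) (hne0 _ _ (succ_ne_succ_succ k))
      (hpair k).2.1 (hpair k).2.2 (hr0' _) (hroot _) (hroot _)
  have harc : ∀ᶠ r in 𝓝[>] (0 : ℝ), ∀ i, ∀ d : Plane, d ≠ 0 → d.1 = s i 0 * d.2 →
      IsSmoothArc {p ∈ box r | rootQuad G (s i) (0, p) = 0} (box r) d :=
    eventually_all.2 fun i => h.eventually_flecnodal_arc (hs i) (hr0' i) (hs1' i) (habs i)
  obtain ⟨C, hC, hbound⟩ := h.exists_bound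
  have hsp : speed (-1) G ≠ 0 := h.transverse
  filter_upwards [harc, eventually_box hrootall, eventually_box hdist, eventually_box hcomp,
    eventually_box hquart, eventually_box hpg, eventually_box hhb, eventually_box hbound,
    eventually_box h.eventually_hess_concave, eventually_box (eventually_all.2 g2),
    eventually_box (eventually_all.2 e2), self_mem_nhdsWithin]
    with r aarc aroot adist acomp aquart apg ahb abound aconc ag2 ae2 hr
  have hr0 : (0 : ℝ) < r := hr
  have hr1 : |(0 : ℝ)| < r := by simpa using hr0
  have hbox : ∀ k : ℝ → Plane, ContDiff ℝ ∞ k → k 0 = 0 → ∀ᶠ ε in 𝓝 (0 : ℝ), k ε ∈ box r := by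
    intro k hk hk0
    exact hk.continuous.continuousAt.eventually
      ((isOpen_box r).mem_nhds (by rw [hk0]; exact zero_mem_box hr0))
  have hCt : Tendsto (fun ε : ℝ => C * |ε|) (𝓝 0) (𝓝 0) := by
    have : Continuous (fun ε : ℝ => C * |ε|) := by fun_prop
    simpa using this.tendsto 0
  filter_upwards [eventually_forall_abs_lt (eventually_all.2 g1),
    eventually_forall_abs_lt (eventually_all.2 e1), eventually_forall_abs_lt c1,
    eventually_forall_abs_lt (eventually_all.2 fun i => hbox (g i) (cg i) (g0 i)),
    eventually_forall_abs_lt (eventually_all.2 fun i => hbox (e i) (ce i) (e0 i)),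
    eventually_forall_abs_lt (hbox c cc c0),
    eventually_forall_abs_lt (hCt.eventually (gt_mem_nhds hr0)), Ioo_mem_nhdsGT hr0]
    with ε₀ b1 b2 b3 b4 b5 b6 b7 b8
  have hlt : ∀ ε, |ε| < ε₀ → |ε| < r := fun ε hε => hε.trans b8.2
  have gpt : ∀ ε, |ε| < ε₀ → ε ≠ 0 → ∀ i, PosGodron (G ε) (g i ε) ∧
      ∃ τ : ℝ, τ ≠ 0 ∧ J G 2 0 (ε, g i ε) = τ ∧ J G 1 1 (ε, g i ε) = τ * (- s i (ε, g i ε)) := by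
    intro ε hε hε0 i
    obtain ⟨τ, t1, t2, t3, t4⟩ := b1 ε hε i
    have hτ : τ ≠ 0 := by rintro rfl; simpa using t4 hε0
    exact ⟨apg ε (g i ε) (hlt ε hε) (b4 ε hε i) i τ hτ t1 t2 t3, τ, hτ, by rw [t1, mul_one], t2⟩
  have ept : ∀ ε, |ε| < ε₀ → ε ≠ 0 → ∀ k : Fin 3, IsHyperbonode (G ε) (e k ε) ∧
      IsNode (G ε) (e k ε) ∧ ∃ τ : ℝ, τ ≠ 0 ∧ J G 2 0 (ε, e k ε) = τ ∧
      J G 1 1 (ε, e k ε) = τ * (- ((s (k + 1) (ε, e k ε) + s (k + 2) (ε, e k ε)) / 2)) := by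
    intro ε hε hε0 k
    obtain ⟨τ, t1, t2, t3, t4⟩ := b2 ε hε k
    have hτ : τ ≠ 0 := by rintro rfl; simpa using t4 hε0
    have := ahb ε (e k ε) (hlt ε hε) (b5 ε hε k) k τ hτ t1 t2 t3
    exact ⟨this.1, this.2, τ, hτ, by rw [t1, mul_one], t2⟩
  have hgod : ∀ ε, |ε| < ε₀ → ∀ p ∈ box r, IsGodron (G ε) p → ∃ i, g i ε = p := by
    intro ε hε p hp hgp
    obtain ⟨i, τ, t1, t2, t3⟩ := ray_of_isGodron hG (z := (ε, p)) (acomp ε p (hlt ε hε) hp) hgp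
    exact ⟨i, (ag2 ε p (hlt ε hε) hp i ⟨τ, t1, t2, t3⟩).symm⟩
  -- A quadratic form vanishing on two root directions is a multiple of the product of the two
  -- factors. This serves both for the intersections of the flecnodal arcs at `ε = 0` and for the
  -- uniqueness of hyperbolic nodes.
  have hray : ∀ ε, |ε| < ε₀ → ∀ p ∈ box r, ∀ i j, i ≠ j → rootQuad G (s i) (ε, p) = 0 →
      rootQuad G (s j) (ε, p) = 0 → ∃ k, e k ε = p := by
    intro ε hε p hp i j hij h1 h2
    have h3 := sub_ne_zero.2 (adist ε p (hlt ε hε) hp i j hij)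
    rw [rootQuad] at h1 h2
    have h4 : J G 1 1 (ε, p) = J G 2 0 (ε, p) * (- ((s i (ε, p) + s j (ε, p)) / 2)) := by
      apply mul_left_cancel₀ h3
      linear_combination (1 / 2) * h1 - (1 / 2) * h2
    have h5 : J G 0 2 (ε, p) = J G 2 0 (ε, p) * (s i (ε, p) * s j (ε, p)) := by
      linear_combination h1 - 2 * s i (ε, p) * h4
    obtain ⟨k, ⟨rfl, rfl⟩ | ⟨rfl, rfl⟩⟩ := exists_complement_index i j hij
    · exact ⟨k, (ae2 ε p (hlt ε hε) hp k ⟨J G 2 0 (ε, p), by ring, h4, h5⟩).symm⟩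
    · exact ⟨k, (ae2 ε p (hlt ε hε) hp k ⟨J G 2 0 (ε, p), by ring, by rw [h4]; ring,
        by rw [h5]; ring⟩).symm⟩
  have h00 : |(0 : ℝ)| < ε₀ := by simpa using b8.1
  have hh0 : hess (G 0) 0 = 0 := by
    have := hess_J G 0
    simp only [Prod.fst_zero, Prod.snd_zero] at this
    rw [this, h.j20, h.j11]; norm_num
  have hzero : ∀ p ∈ box r, 0 ≤ hess (G 0) p → p = 0 := by
    intro p hp hh
    have := abound 0 p hr1 hp hh
    simpa using this
  -- the elliptic disc
  have hcpt : ∀ ε, |ε| < ε₀ → ε ≠ 0 → 0 < hess (G ε) (c ε) ∧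
      J G 2 0 (ε, c ε) * ε * speed (-1) G < 0 := by
    intro ε hε hε0
    obtain ⟨τ, t1, t2, t3, t4⟩ := b3 ε hε
    have t4 := t4 hε0
    norm_num at t4
    have hτ : τ ≠ 0 := by rintro rfl; simp at t4
    constructor
    · have := hess_J G (ε, c ε)
      simp only at this
      rw [this, t1, t2, t3]
      have : 0 < τ ^ 2 := by positivity
      linarith
    · rw [t1]; linarith
  have hdisc : ∀ ε, |ε| < ε₀ → ε ≠ 0 → _ := fun ε hε hε0 =>
    exists_homeomorph_sublevel (k := fun p => - hess (G ε) p) (r := r) (ρ := C * |ε|)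
      ((smoothFamily_neg_hess hG).slice ε) (fun p hp => aconc ε p (hlt ε hε) hp) (b7 ε hε)
      (fun p hp hk => abound ε p (hlt ε hε) hp (by linarith))
      ⟨c ε, b6 ε hε, by simpa using (hcpt ε hε hε0).1⟩
  have hell : ∀ ε, ellipticSet (G ε) (box r) = {p ∈ box r | - hess (G ε) p < 0} := by
    intro ε; ext p; simp [ellipticSet]
  have hpar : ∀ ε, parabolicSet (G ε) (box r) = {p ∈ box r | - hess (G ε) p = 0} := by
    intro ε; ext p; simp [parabolicSet]
  refine ⟨⟨?_, ?_, ?_, ?_, ?_, ?_, ?_, ?_, ?_⟩, ?_⟩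
  · refine ⟨fun i => {p ∈ box r | rootQuad G (s i) (0, p) = 0}, fun i => aarc i (u i) (hu0 i) (hus i),
      ?_, ?_⟩
    · intro i j hij
      ext p
      simp only [mem_inter_iff, mem_ofPred_eq, mem_singleton_iff]
      constructor
      · rintro ⟨⟨hp, h1⟩, -, h2⟩
        obtain ⟨k, hk⟩ := hray 0 h00 p hp i j hij h1 h2
        rw [← hk, e0]
      · rintro rfl
        have : ∀ i, rootQuad G (s i) (0, 0) = 0 := by
          intro i
          change rootQuad G (s i) 0 = 0
          simp [rootQuad, h.j20, h.j11, h.j02]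
        exact ⟨⟨zero_mem_box hr0, this i⟩, zero_mem_box hr0, this j⟩
    · ext p
      simp only [flecnodalSet, mem_ofPred_eq, mem_iUnion]
      constructor
      · rintro ⟨hp, h1⟩
        obtain ⟨i, hi⟩ := (isFlecnodal_iff hG (z := (0, p)) (aroot 0 p hr1 hp)
          (acomp 0 p hr1 hp)).1 h1
        exact ⟨i, hp, hi⟩
      · rintro ⟨i, hp, hi⟩
        exact ⟨hp, (isFlecnodal_iff hG (z := (0, p)) (aroot 0 p hr1 hp)
          (acomp 0 p hr1 hp)).2 ⟨i, hi⟩⟩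
  · ext p
    simp only [ellipticSet, mem_ofPred_eq, mem_empty_iff_false, iff_false]
    rintro ⟨hp, h1⟩
    rw [hzero p hp h1.le, hh0] at h1
    exact lt_irrefl _ h1
  · ext p
    simp only [parabolicSet, mem_ofPred_eq, mem_singleton_iff]
    constructor
    · rintro ⟨hp, h1⟩; exact hzero p hp h1.ge
    · rintro rfl; exact ⟨zero_mem_box hr0, hh0⟩
  · intro ε hε hε0
    obtain ⟨-, h2, h3⟩ := hdisc ε hε hε0
    rw [hell, hpar]
    refine ⟨h2, ?_⟩
    rintro p ⟨hp, h4⟩ hc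
    apply h3 p hp h4
    rw [fderiv_fun_neg, hc, neg_zero]
  · intro N hN
    obtain ⟨ρ, hρ, hball⟩ := Metric.mem_nhds_iff.1 hN
    have hab : ∀ᶠ ε in 𝓝 (0 : ℝ), |ε| < r := by
      have : Tendsto (fun ε : ℝ => |ε|) (𝓝 0) (𝓝 0) := by simpa using continuous_abs.tendsto (0 : ℝ)
      exact this.eventually (gt_mem_nhds hr0)
    filter_upwards [hCt.eventually (gt_mem_nhds hρ), hab] with ε h1 h2 p hp
    apply hball
    rw [mem_ball_zero_iff]
    rcases hp with hp | hp
    · exact (abound ε p h2 hp.1 hp.2.le).trans_lt h1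
    · exact (abound ε p h2 hp.1 hp.2.ge).trans_lt h1
  · obtain ⟨sg, hsg, hsg2⟩ : ∃ sg : ℝ, (sg = 1 ∨ sg = -1) ∧ sg * speed (-1) G < 0 := by
      rcases lt_or_gt_of_ne hsp with h1 | h1
      · exact ⟨1, Or.inl rfl, by linarith⟩
      · exact ⟨-1, Or.inr rfl, by linarith⟩
    have hsg1 : sg * sg = 1 := by rcases hsg with rfl | rfl <;> norm_num
    refine ⟨sg, hsg, fun ε hε p hp => ?_⟩
    have hcontJ : Continuous (fun p => jet 2 0 (G ε) p) := (jet_contDiff (hG.slice ε) 2 0).continuous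
    have hmul : sg * ε * (sg * speed (-1) G) = ε * speed (-1) G := by
      linear_combination ε * speed (-1) G * hsg1
    -- `f₂₀` has no zeros on the connected elliptic set, so its sign at `c ε` is its sign everywhere
    -- on it.
    have hnz : ∀ q ∈ {p ∈ box r | - hess (G ε) p < 0}, jet 2 0 (G ε) q ≠ 0 := fun q hq =>
      jet_ne_zero_of_hess_pos (neg_lt_zero.1 hq.2)
    have hp' : p ∈ {p ∈ box r | - hess (G ε) p < 0} := by rwa [← hell]
    constructor
    · intro hsε
      have hε0 : ε ≠ 0 := by rintro rfl; simp at hsε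
      obtain ⟨h2, h3⟩ := hcpt ε hε hε0
      have h4 := mul_neg_of_pos_of_neg hsε hsg2
      rw [hmul] at h4
      have h5 : 0 < jet 2 0 (G ε) (c ε) := by
        change 0 < J G 2 0 (ε, c ε)
        by_contra! hc
        have := mul_nonneg_of_nonpos_of_nonpos hc h4.le
        linarith
      exact (coorientedUp_iff (hG.slice ε) hp.2).2 (pos_of_isPreconnected (hdisc ε hε hε0).1 hcontJ
        hnz ⟨b6 ε hε, neg_lt_zero.2 h2⟩ h5 hp')
    · intro hsε
      have hε0 : ε ≠ 0 := by rintro rfl; simp at hsε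
      obtain ⟨h2, h3⟩ := hcpt ε hε hε0
      have h4 := mul_pos_of_neg_of_neg hsε hsg2
      rw [hmul] at h4
      have h5 : 0 < - jet 2 0 (G ε) (c ε) := by
        change 0 < - J G 2 0 (ε, c ε)
        by_contra! hc
        have := mul_nonneg (neg_nonpos.1 hc) h4.le
        linarith
      refine (coorientedDown_iff (hG.slice ε) hp.2).2 (neg_pos.1 ?_)
      exact pos_of_isPreconnected (f := fun p => - jet 2 0 (G ε) p) (hdisc ε hε hε0).1 hcontJ.neg
        (fun q hq => neg_ne_zero.2 (hnz q hq)) ⟨b6 ε hε, neg_lt_zero.2 h2⟩ h5 hp'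
  · refine ⟨g, fun i => ⟨(cg i).continuous.continuousOn, g0 i⟩, fun ε hε hε0 => ⟨?_, ?_, ?_⟩⟩
    -- Two coinciding godrons would make one nonzero quadratic form proportional to two different
    -- squares.
    · intro i j hij
      by_contra hne
      simp only at hij
      obtain ⟨-, τ, t1, t2, t3⟩ := gpt ε hε hε0 i
      obtain ⟨-, τ', t1', t2', t3'⟩ := gpt ε hε hε0 j
      rw [hij] at t2 t3
      have hττ : τ = τ' := t2.symm.trans t2'
      rw [t3, hττ] at t3'
      exact adist ε (g j ε) (hlt ε hε) (b4 ε hε j) i j hne (neg_inj.1 (mul_left_cancel₀ t1' t3'))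
    · ext p
      simp only [mem_ofPred_eq, mem_range]
      constructor
      · rintro ⟨hp, h1⟩; exact hgod ε hε p hp h1
      · rintro ⟨i, rfl⟩; exact ⟨b4 ε hε i, (gpt ε hε hε0 i).1.isGodron⟩
    · exact fun i => (gpt ε hε hε0 i).1.isNegativeGodron (hG.slice ε)
  · refine ⟨e, fun i => ⟨(ce i).continuous.continuousOn, e0 i⟩, fun ε hε hε0 => ⟨?_, ?_, ?_⟩⟩
    -- Two different pairs among three roots share one root, so equal half-sums would force the
    -- other two roots to coincide.
    · intro i j hij
      by_contra hne
      simp only at hij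
      obtain ⟨-, -, τ, t1, t2, t3⟩ := ept ε hε hε0 i
      obtain ⟨-, -, τ', t1', t2', t3'⟩ := ept ε hε hε0 j
      rw [hij] at t2 t3
      have hττ : τ = τ' := t2.symm.trans t2'
      rw [t3, hττ] at t3'
      have t4 := mul_left_cancel₀ t1' t3'
      have hd := adist ε (e j ε) (hlt ε hε) (b5 ε hε j)
      have hd10 := hd 1 0 (by decide)
      have hd20 := hd 2 0 (by decide)
      have hd21 := hd 2 1 (by decide)
      have f1 : (1 : Fin 3) + 1 = 2 := by decide
      have f2 : (1 : Fin 3) + 2 = 0 := by decide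
      have f3 : (2 : Fin 3) + 1 = 0 := by decide
      have f4 : (2 : Fin 3) + 2 = 1 := by decide
      fin_cases i <;> fin_cases j <;>
        simp only [Fin.zero_eta, Fin.mk_one, Fin.reduceFinMk, zero_add, f1, f2, f3, f4, ne_eq,
          not_true_eq_false] at t4 hne hd10 hd20 hd21
      · exact hd10 (by linarith)
      · exact hd20 (by linarith)
      · exact hd10 (by linarith)
      · exact hd21 (by linarith)
      · exact hd20 (by linarith)
      · exact hd21 (by linarith)
    · ext p
      simp only [mem_ofPred_eq, mem_range]
      constructor
      · rintro ⟨hp, h1, h2⟩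
        obtain ⟨v, w, hvw, q1, q2, k1, k2⟩ := cubic_eq_zero_of_hyperbolic_node (hG.slice ε) h1 h2
        have hpt := acomp ε p (hlt ε hε) hp
        obtain ⟨i, hi⟩ := hpt v k1
        obtain ⟨j, hj⟩ := hpt w k2
        have hij : i ≠ j := by
          rintro rfl
          apply hvw
          rw [hi, hj]; ring
        have hrq : ∀ (x : Plane) (i : Fin 3), x.1 = s i (ε, p) * x.2 → x ≠ 0 → ddPow 2 x (G ε) p = 0 →
            rootQuad G (s i) (ε, p) = 0 := by
          intro x i hx hx0 hxq
          have hx2 : x.2 ≠ 0 := fun hc => hx0 (Prod.ext (by rw [hx, hc]; simp) hc)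
          have := quad_J hG (ε, p) x
          simp only at this
          rw [this, hx] at hxq
          apply (mul_eq_zero.1 (?_ : x.2 ^ 2 * rootQuad G (s i) (ε, p) = 0)).resolve_left
            (pow_ne_zero 2 hx2)
          rw [rootQuad]; linear_combination hxq
        refine hray ε hε p hp i j hij (hrq v i hi ?_ q1) (hrq w j hj ?_ q2)
        · rintro rfl; simp at hvw
        · rintro rfl; simp at hvw
      · rintro ⟨k, rfl⟩
        have := ept ε hε hε0 k
        exact ⟨b5 ε hε k, this.1.1, this.2.1⟩
    · exact fun k => (ept ε hε hε0 k).1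
  · intro ε hε p hp
    exact not_isBiflecnode (acomp ε p (hlt ε hε) hp) hG (z := (ε, p)) (aquart ε p (hlt ε hε) hp)
  · intro ε hε hε0 p hp hgp
    obtain ⟨i, rfl⟩ := hgod ε hε p hp hgp
    exact (gpt ε hε hε0 i).1

end DFourMinusTransition

/-! ### Invariance under linear changes of coordinates -/

section Transport

variable {f g : Plane → ℝ} {M : Plane ≃L[ℝ] Plane} {p : Plane}

theorem fderiv_comp_equiv (φ : Plane → ℝ) (M : Plane ≃L[ℝ] Plane) (p v : Plane) :
    fderiv ℝ (φ ∘ M) p v = fderiv ℝ φ (M p) (M v) := by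
  rw [M.comp_right_fderiv]; rfl

/-- Stated for germs, so that it can be iterated and applied to a family which agrees with a smooth
one only near the origin. -/
theorem dd_germ (h : f =ᶠ[𝓝 p] g ∘ M) (v : Plane) : dd v f =ᶠ[𝓝 p] dd (M v) g ∘ M := by
  filter_upwards [h.eventuallyEq_nhds] with q hq
  simp only [dd, Function.comp_apply]
  rw [hq.fderiv_eq, fderiv_comp_equiv]

theorem ddPow_germ (h : f =ᶠ[𝓝 p] g ∘ M) (n : ℕ) (v : Plane) :
    ddPow n v f =ᶠ[𝓝 p] ddPow n (M v) g ∘ M := by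
  induction n with
  | zero => exact h
  | succ n ih =>
    have e : ∀ (w : Plane) (k : Plane → ℝ), ddPow (n + 1) w k = dd w (ddPow n w k) := by
      intro w k; ext q; simp only [ddPow, Function.iterate_succ_apply']; rfl
    rw [e, e]
    exact dd_germ ih v

theorem ddPow_transport (h : f =ᶠ[𝓝 p] g ∘ M) (n : ℕ) (v : Plane) :
    ddPow n v f p = ddPow n (M v) g (M p) := (ddPow_germ h n v).eq_of_nhds

theorem dd_two_transport (h : f =ᶠ[𝓝 p] g ∘ M) (u v : Plane) :
    dd u (dd v f) p = dd (M u) (dd (M v) g) (M p) := (dd_germ (dd_germ h v) u).eq_of_nhds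

theorem dd_three_transport (h : f =ᶠ[𝓝 p] g ∘ M) (u v w : Plane) :
    dd u (dd v (dd w f)) p = dd (M u) (dd (M v) (dd (M w) g)) (M p) :=
  (dd_germ (dd_germ (dd_germ h w) v) u).eq_of_nhds

/-- The determinant of a linear change of coordinates. -/
noncomputable def det (M : Plane ≃L[ℝ] Plane) : ℝ :=
  (M (1, 0)).1 * (M (0, 1)).2 - (M (1, 0)).2 * (M (0, 1)).1

theorem det_ne_zero (M : Plane ≃L[ℝ] Plane) : det M ≠ 0 := by
  have h : LinearIndependent ℝ ![((1, 0) : Plane), (0, 1)] := by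
    rw [linearIndependent_pair_iff]; norm_num
  have h2 : LinearIndependent ℝ ![M (1, 0), M (0, 1)] := by
    rw [LinearIndependent.pair_iff] at h ⊢
    intro s t hst
    apply h
    apply M.injective
    rw [map_add, map_smul, map_smul, hst, map_zero]
  exact (linearIndependent_pair_iff _ _).1 h2

theorem hess_transport (hg : ContDiff ℝ ∞ g) (h : f =ᶠ[𝓝 p] g ∘ M) :
    hess f p = det M ^ 2 * hess g (M p) := by
  simp only [hess, fxx, fxy, fyy]
  rw [dd_two_transport h, dd_two_transport h, dd_two_transport h, det]
  simp only [dd_two hg]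
  ring

theorem hess_germ (hg : ContDiff ℝ ∞ g) (h : f =ᶠ[𝓝 p] g ∘ M) :
    hess f =ᶠ[𝓝 p] (fun q => det M ^ 2 * hess g q) ∘ M := by
  filter_upwards [h.eventuallyEq_nhds] with q hq
  exact hess_transport hg hq

theorem hess_pos_iff (hg : ContDiff ℝ ∞ g) (h : f =ᶠ[𝓝 p] g ∘ M) :
    0 < hess f p ↔ 0 < hess g (M p) := by
  rw [hess_transport hg h]
  exact mul_pos_iff_of_pos_left (pow_two_pos_of_ne_zero (det_ne_zero M))

theorem hess_neg_iff (hg : ContDiff ℝ ∞ g) (h : f =ᶠ[𝓝 p] g ∘ M) :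
    hess f p < 0 ↔ hess g (M p) < 0 := by
  rw [hess_transport hg h]
  have hpos := pow_two_pos_of_ne_zero (det_ne_zero M)
  exact ⟨fun h => by by_contra! hc; exact h.not_ge (mul_nonneg hpos.le hc),
    mul_neg_of_pos_of_neg hpos⟩

theorem hess_eq_zero_iff (hg : ContDiff ℝ ∞ g) (h : f =ᶠ[𝓝 p] g ∘ M) :
    hess f p = 0 ↔ hess g (M p) = 0 := by
  rw [hess_transport hg h, mul_eq_zero, or_iff_right (pow_ne_zero 2 (det_ne_zero M))]

theorem fderiv_hess_transport (hg : ContDiff ℝ ∞ g) (h : f =ᶠ[𝓝 p] g ∘ M) (v : Plane) :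
    fderiv ℝ (hess f) p v = det M ^ 2 * fderiv ℝ (hess g) (M p) (M v) := by
  rw [(hess_germ hg h).fderiv_eq, fderiv_comp_equiv,
    fderiv_const_mul ((hess_contDiff hg).differentiable (by simp) _)]
  simp

theorem fderiv_hess_ne_zero_iff (hg : ContDiff ℝ ∞ g) (h : f =ᶠ[𝓝 p] g ∘ M) :
    fderiv ℝ (hess f) p ≠ 0 ↔ fderiv ℝ (hess g) (M p) ≠ 0 := by
  rw [not_iff_not]
  have hd := pow_ne_zero 2 (det_ne_zero M)
  constructor
  · intro hc
    refine ContinuousLinearMap.ext fun v => ?_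
    have := fderiv_hess_transport hg h (M.symm v)
    rw [hc, M.apply_symm_apply] at this
    simpa [det_ne_zero M] using this
  · intro hc
    refine ContinuousLinearMap.ext fun v => ?_
    rw [fderiv_hess_transport hg h, hc]
    simp

theorem isFlecnodal_transport (h : f =ᶠ[𝓝 p] g ∘ M) : IsFlecnodal f p ↔ IsFlecnodal g (M p) := by
  constructor
  · rintro ⟨v, hv, h2, h3⟩
    exact ⟨M v, by simpa using hv, by rwa [← ddPow_transport h], by rwa [← ddPow_transport h]⟩
  · rintro ⟨v, hv, h2, h3⟩
    exact ⟨M.symm v, by simpa using hv, by rwa [ddPow_transport h, M.apply_symm_apply],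
      by rwa [ddPow_transport h, M.apply_symm_apply]⟩

theorem isBiflecnode_transport (h : f =ᶠ[𝓝 p] g ∘ M) (hb : IsBiflecnode f p) :
    IsBiflecnode g (M p) := by
  obtain ⟨v, hv, h2, h3, h4⟩ := hb
  exact ⟨M v, by simpa using hv, by rwa [← ddPow_transport h], by rwa [← ddPow_transport h],
    by rwa [← ddPow_transport h]⟩

theorem coorientedUp_transport (h : f =ᶠ[𝓝 p] g ∘ M) : CoorientedUp f p ↔ CoorientedUp g (M p) := by
  rw [CoorientedUp, CoorientedUp, ← M.map_nhds_eq, eventually_map]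
  refine eventually_congr ?_
  filter_upwards [h] with q hq
  rw [h.fderiv_eq, fderiv_comp_equiv, h.eq_of_nhds, hq, map_sub]; rfl

theorem coorientedDown_transport (h : f =ᶠ[𝓝 p] g ∘ M) :
    CoorientedDown f p ↔ CoorientedDown g (M p) := by
  rw [CoorientedDown, CoorientedDown, ← M.map_nhds_eq, eventually_map]
  refine eventually_congr ?_
  filter_upwards [h] with q hq
  rw [h.fderiv_eq, fderiv_comp_equiv, h.eq_of_nhds, hq, map_sub]; rfl

theorem isGodronDir_transport (hg : ContDiff ℝ ∞ g) (h : f =ᶠ[𝓝 p] g ∘ M) (v : Plane) :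
    IsGodronDir f p v ↔ IsGodronDir g (M p) (M v) := by
  have hd := pow_ne_zero 2 (det_ne_zero M)
  rw [IsGodronDir, IsGodronDir, hess_eq_zero_iff hg h, fderiv_hess_ne_zero_iff hg h,
    fderiv_hess_transport hg h, mul_eq_zero, or_iff_right hd]
  refine and_congr (by simp) (and_congr ?_ Iff.rfl)
  constructor
  · intro hw w
    have := hw (M.symm w)
    rw [ddPow_transport h, M.apply_symm_apply] at this
    rw [this]
    refine exists_congr fun c => ?_
    rw [← map_smul, M.symm_apply_eq]
  · intro hw w
    rw [ddPow_transport h, hw]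
    refine exists_congr fun c => ?_
    rw [← map_smul, M.injective.eq_iff]

theorem isGodron_transport (hg : ContDiff ℝ ∞ g) (h : f =ᶠ[𝓝 p] g ∘ M) :
    IsGodron f p ↔ IsGodron g (M p) := by
  constructor
  · rintro ⟨v, hv⟩; exact ⟨M v, (isGodronDir_transport hg h v).1 hv⟩
  · rintro ⟨v, hv⟩
    exact ⟨M.symm v, (isGodronDir_transport hg h _).2 (by rwa [M.apply_symm_apply])⟩

theorem linearIndependent_symm {v w : Plane} (hvw : LinearIndependent ℝ ![v, w]) :
    LinearIndependent ℝ ![M.symm v, M.symm w] := by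
  rw [LinearIndependent.pair_iff] at hvw ⊢
  intro s t hst
  apply hvw
  apply M.symm.injective
  rw [map_add, map_smul, map_smul, hst, map_zero]

theorem posGodron_transport (hg : ContDiff ℝ ∞ g) (h : f =ᶠ[𝓝 p] g ∘ M) (hp : PosGodron g (M p)) :
    PosGodron f p := by
  obtain ⟨v, w, h1, h2, h3⟩ := hp
  refine ⟨M.symm v, M.symm w, (isGodronDir_transport hg h _).2 (by rwa [M.apply_symm_apply]),
    linearIndependent_symm h2, ?_⟩
  rw [dd_three_transport h, ddPow_transport h, ddPow_transport h]
  simpa only [M.apply_symm_apply] using h3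

theorem IsNegativeGodron.congr {f' : Plane → ℝ} (h : f =ᶠ[𝓝 p] f') (hf : IsNegativeGodron f' p) :
    IsNegativeGodron f p := by
  have hh : ∀ {q}, f =ᶠ[𝓝 q] f' → f =ᶠ[𝓝 q] f' ∘ ContinuousLinearEquiv.refl ℝ Plane := fun h => h
  have hhess : ∀ {q}, f =ᶠ[𝓝 q] f' → hess f q = hess f' q := by
    intro q hq
    simp only [hess, fxx, fxy, fyy]
    rw [dd_two_transport (hh hq), dd_two_transport (hh hq), dd_two_transport (hh hq)]; rfl
  have hfd : ∀ {q}, f =ᶠ[𝓝 q] f' → fderiv ℝ (hess f) q = fderiv ℝ (hess f') q := by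
    intro q hq
    exact Filter.EventuallyEq.fderiv_eq (hq.eventuallyEq_nhds.mono fun x hx => hhess hx)
  have hpow : ∀ {q}, f =ᶠ[𝓝 q] f' → ∀ n v, ddPow n v f q = ddPow n v f' q := fun hq n v =>
    ddPow_transport (hh hq) n v
  obtain ⟨⟨v, w, ⟨a1, a2, a3, a4, a5⟩, h2, h3⟩, h4⟩ := hf
  refine ⟨⟨v, w, ⟨a1, fun w => ?_, ?_, ?_, ?_⟩, h2, ?_⟩, ?_⟩
  · rw [hpow h, a2]
  · rw [hhess h, a3]
  · rw [hfd h]; exact a4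
  · rw [hfd h]; exact a5
  · rw [hpow h, hpow h, dd_three_transport (hh h)]; exact h3
  · filter_upwards [h4, h.eventuallyEq_nhds.filter_mono nhdsWithin_le_nhds] with q h5 hq
    rw [hhess hq, hfd hq]
    intro h6 v hv h7
    rw [hpow hq] at h7
    exact h5 h6 v hv h7

/-- The definition of negativity involves the Euclidean scalar product, which `M` does not preserve.
The sign of `3f₂₁² - f₀₂f₄₀` is preserved, so the criterion is applied again after the change of
coordinates. -/
theorem isNegativeGodron_transport (hg : ContDiff ℝ ∞ g) (h : f =ᶠ[𝓝 p] g ∘ M)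
    (hp : PosGodron g (M p)) : IsNegativeGodron f p :=
  ((posGodron_transport hg EventuallyEq.rfl hp).isNegativeGodron (hg.comp M.contDiff)).congr h

theorem isNode_transport (h : f =ᶠ[𝓝 p] g ∘ M) : IsNode f p ↔ IsNode g (M p) := by
  constructor
  · rintro ⟨l, hl⟩
    refine ⟨l ∘ₗ (M.symm : Plane →ₗ[ℝ] Plane), fun v => ?_⟩
    have := hl (M.symm v)
    rw [ddPow_transport h, ddPow_transport h, M.apply_symm_apply] at this
    exact this
  · rintro ⟨l, hl⟩
    refine ⟨l ∘ₗ (M : Plane →ₗ[ℝ] Plane), fun v => ?_⟩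
    rw [ddPow_transport h, ddPow_transport h]
    exact hl (M v)

theorem linearIndependent_fderiv_transport {φ ψ φ' ψ' : Plane → ℝ} (h1 : φ' =ᶠ[𝓝 p] φ ∘ M)
    (h2 : ψ' =ᶠ[𝓝 p] ψ ∘ M) (hl : LinearIndependent ℝ ![fderiv ℝ φ (M p), fderiv ℝ ψ (M p)]) :
    LinearIndependent ℝ ![fderiv ℝ φ' p, fderiv ℝ ψ' p] := by
  rw [LinearIndependent.pair_iff] at hl ⊢
  intro s t hst
  apply hl
  refine ContinuousLinearMap.ext fun v => ?_
  have := congrArg (fun L : Plane →L[ℝ] ℝ => L (M.symm v)) hst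
  simp only [add_apply, smul_apply, zero_apply] at this ⊢
  rw [h1.fderiv_eq, h2.fderiv_eq, fderiv_comp_equiv, fderiv_comp_equiv, M.apply_symm_apply] at this
  exact this

theorem isHyperbonode_transport (hg : ContDiff ℝ ∞ g) (h : f =ᶠ[𝓝 p] g ∘ M)
    (hp : IsHyperbonode g (M p)) : IsHyperbonode f p := by
  obtain ⟨h1, a, b, ca, cb, hl, has, h3a, h3b, hd⟩ := hp
  have hpow : ∀ a : Plane → Plane, ∀ n, ∀ᶠ q in 𝓝 p,
      ddPow n (M.symm (a (M q))) f q = ddPow n (a (M q)) g (M q) := by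
    intro a n
    filter_upwards [h.eventuallyEq_nhds] with q hq
    rw [ddPow_transport hq, M.apply_symm_apply]
  have hc : ∀ a : Plane → Plane, ContDiffAt ℝ ∞ a (M p) →
      ContDiffAt ℝ ∞ (fun q => M.symm (a (M q))) p := fun a ha =>
    M.symm.contDiff.contDiffAt.comp p (ha.comp p M.contDiff.contDiffAt)
  refine ⟨(hess_neg_iff hg h).2 h1, fun q => M.symm (a (M q)), fun q => M.symm (b (M q)), hc a ca,
    hc b cb, linearIndependent_symm hl, ?_, ?_, ?_, ?_⟩
  · filter_upwards [hpow a 2, hpow b 2, (M.continuous.tendsto p).eventually has] with q q1 q2 q3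
    rw [q1, q2]; exact q3
  · rw [(hpow a 3).self_of_nhds]; exact h3a
  · rw [(hpow b 3).self_of_nhds]; exact h3b
  · exact linearIndependent_fderiv_transport (φ := fun q => ddPow 3 (a q) g q)
      (ψ := fun q => ddPow 3 (b q) g q) (hpow a 3) (hpow b 3) hd

theorem isEllipnode_transport (hg : ContDiff ℝ ∞ g) (h : f =ᶠ[𝓝 p] g ∘ M)
    (hp : IsEllipnode g (M p)) : IsEllipnode f p := by
  obtain ⟨h1, a, b, ca, cb, hl, has, h3a, h3b, hd⟩ := hp
  have hre : ∀ᶠ q in 𝓝 p, reCube (M.symm (a (M q))) (M.symm (b (M q))) f q =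
      reCube (a (M q)) (b (M q)) g (M q) := by
    filter_upwards [h.eventuallyEq_nhds] with q hq
    simp only [reCube, ddPow_transport hq, dd_three_transport hq, M.apply_symm_apply]
  have him : ∀ᶠ q in 𝓝 p, imCube (M.symm (a (M q))) (M.symm (b (M q))) f q =
      imCube (a (M q)) (b (M q)) g (M q) := by
    filter_upwards [h.eventuallyEq_nhds] with q hq
    simp only [imCube, ddPow_transport hq, dd_three_transport hq, M.apply_symm_apply]
  have hc : ∀ a : Plane → Plane, ContDiffAt ℝ ∞ a (M p) →
      ContDiffAt ℝ ∞ (fun q => M.symm (a (M q))) p := fun a ha =>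
    M.symm.contDiff.contDiffAt.comp p (ha.comp p M.contDiff.contDiffAt)
  refine ⟨(hess_pos_iff hg h).2 h1, fun q => M.symm (a (M q)), fun q => M.symm (b (M q)), hc a ca,
    hc b cb, linearIndependent_symm hl, ?_, ?_, ?_, ?_⟩
  · filter_upwards [h.eventuallyEq_nhds, (M.continuous.tendsto p).eventually has] with q hq q3
    simp only [ddPow_transport hq, dd_two_transport hq, M.apply_symm_apply]
    exact q3
  · rw [hre.self_of_nhds]; exact h3a
  · rw [him.self_of_nhds]; exact h3b
  · exact linearIndependent_fderiv_transport (φ := fun q => reCube (a q) (b q) g q)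
      (ψ := fun q => imCube (a q) (b q) g q) hre him hd

end Transport

/-! ### Transport of sets and arcs -/

section TransportSets

variable {f g : Plane → ℝ} {M : Plane ≃L[ℝ] Plane} {U : Set Plane}

theorem ellipticSet_transport (hg : ContDiff ℝ ∞ g) (h : ∀ p ∈ M ⁻¹' U, f =ᶠ[𝓝 p] g ∘ M) :
    ellipticSet f (M ⁻¹' U) = M ⁻¹' ellipticSet g U := by
  ext p
  exact and_congr_right fun hp => hess_pos_iff hg (h p hp)

theorem parabolicSet_transport (hg : ContDiff ℝ ∞ g) (h : ∀ p ∈ M ⁻¹' U, f =ᶠ[𝓝 p] g ∘ M) :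
    parabolicSet f (M ⁻¹' U) = M ⁻¹' parabolicSet g U := by
  ext p
  exact and_congr_right fun hp => hess_eq_zero_iff hg (h p hp)

theorem flecnodalSet_transport (h : ∀ p ∈ M ⁻¹' U, f =ᶠ[𝓝 p] g ∘ M) :
    flecnodalSet f (M ⁻¹' U) = M ⁻¹' flecnodalSet g U := by
  ext p
  exact and_congr_right fun hp => isFlecnodal_transport (h p hp)

theorem ellipticUp_transport (hg : ContDiff ℝ ∞ g) (h : ∀ p ∈ M ⁻¹' U, f =ᶠ[𝓝 p] g ∘ M) :
    ellipticUp f (M ⁻¹' U) = M ⁻¹' ellipticUp g U := by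
  rw [ellipticUp, ellipticSet_transport hg h]
  ext p
  exact and_congr_right fun hp => coorientedUp_transport (h p hp.1)

theorem ellipticDown_transport (hg : ContDiff ℝ ∞ g) (h : ∀ p ∈ M ⁻¹' U, f =ᶠ[𝓝 p] g ∘ M) :
    ellipticDown f (M ⁻¹' U) = M ⁻¹' ellipticDown g U := by
  rw [ellipticDown, ellipticSet_transport hg h]
  ext p
  exact and_congr_right fun hp => coorientedDown_transport (h p hp.1)

theorem IsSmoothArc.preimage {A : Set Plane} {d : Plane} (h : IsSmoothArc A U d)
    (M : Plane ≃L[ℝ] Plane) : IsSmoothArc (M ⁻¹' A) (M ⁻¹' U) (M.symm d) := by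
  obtain ⟨hd, φ, h1, h2, h3, ⟨h4⟩, h5, h6⟩ := h
  refine ⟨by simpa using hd, φ ∘ M, h1.comp M.contDiff.contDiffOn (mapsTo_preimage _ _), ?_, ?_,
    ⟨(M.toHomeomorph.sets (s := M ⁻¹' A) (t := A) rfl).trans h4⟩, by simpa using h5, ?_⟩
  · rw [h2]; rfl
  · intro q hq hc
    apply h3 (M q) hq
    refine ContinuousLinearMap.ext fun v => ?_
    have := fderiv_comp_equiv φ M q (M.symm v)
    rw [hc, M.apply_symm_apply] at this
    simpa using this.symm
  · rw [fderiv_comp_equiv, M.apply_symm_apply, map_zero]; exact h6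

theorem preimage_singleton_zero (M : Plane ≃L[ℝ] Plane) : M ⁻¹' {0} = {0} := by
  ext p; simp

theorem preimage_singleton (M : Plane ≃L[ℝ] Plane) (q : Plane) : M ⁻¹' {q} = {M.symm q} := by
  ext p; simp only [mem_preimage, mem_singleton_iff]; rw [M.eq_symm_apply]

theorem preimage_frontier (M : Plane ≃L[ℝ] Plane) (s : Set Plane) :
    M ⁻¹' frontier s = frontier (M ⁻¹' s) := M.toHomeomorph.preimage_frontier s

theorem isConnected_preimage {s : Set Plane} (h : IsConnected s) (M : Plane ≃L[ℝ] Plane) :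
    IsConnected (M ⁻¹' s) := by
  have : M ⁻¹' s = M.symm '' s := by rw [M.symm.image_eq_preimage_symm]; rfl
  rw [this]
  exact h.image _ M.symm.continuous.continuousOn

end TransportSets

/-! ### Transport of the two transitions -/

section TransportTransitions

variable {F G : ℝ → Plane → ℝ} {M : Plane ≃L[ℝ] Plane} {U : Set Plane} {ε₀ : ℝ}

/-- The hypothesis `hpos` replaces negativity of the godrons, which is not itself transported. -/
theorem DFourMinusTransition.comap {u : Fin 3 → Plane} (h : DFourMinusTransition G u U ε₀)
    (hε₀ : 0 < ε₀) (hG : ∀ ε, ContDiff ℝ ∞ (G ε))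
    (hFG : ∀ ε, |ε| < ε₀ → ∀ p ∈ M ⁻¹' U, F ε =ᶠ[𝓝 p] G ε ∘ M)
    (hpos : ∀ ε, |ε| < ε₀ → ε ≠ 0 → ∀ p ∈ U, IsGodron (G ε) p → PosGodron (G ε) p) :
    DFourMinusTransition F (fun i => M.symm (u i)) (M ⁻¹' U) ε₀ := by
  have h0 : |(0 : ℝ)| < ε₀ := by simpa using hε₀
  have hell := fun ε hε => ellipticSet_transport (hG ε) (hFG ε hε)
  have hpar := fun ε hε => parabolicSet_transport (hG ε) (hFG ε hε)
  have hMs : ∀ q, M (M.symm q) = q := M.apply_symm_apply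
  have hinj : ∀ {k : Fin 3 → ℝ → Plane} {ε : ℝ}, Function.Injective (fun i => k i ε) →
      Function.Injective (fun i => M.symm (k i ε)) := fun hk i j hij => hk (M.symm.injective hij)
  have hrange : ∀ {k : Fin 3 → ℝ → Plane} {ε : ℝ},
      M ⁻¹' range (fun i => k i ε) = range (fun i => M.symm (k i ε)) := by
    intro k ε
    ext p
    simp only [mem_preimage, mem_range]
    exact exists_congr fun i => by rw [M.symm_apply_eq]
  have hcont : ∀ {k : ℝ → Plane}, ContinuousOn k (Ioo (-ε₀) ε₀) ∧ k 0 = 0 →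
      ContinuousOn (fun ε => M.symm (k ε)) (Ioo (-ε₀) ε₀) ∧ M.symm (k 0) = 0 := by
    rintro k ⟨k1, k2⟩
    exact ⟨M.symm.continuous.comp_continuousOn k1, by rw [k2, map_zero]⟩
  refine ⟨?_, ?_, ?_, ?_, ?_, ?_, ?_, ?_, ?_⟩
  · obtain ⟨A, h1, h2, h3⟩ := h.flecnodal_zero
    refine ⟨fun i => M ⁻¹' A i, fun i => (h1 i).preimage M, fun i j hij => ?_, ?_⟩
    · rw [← preimage_inter, h2 i j hij, preimage_singleton_zero]
    · rw [flecnodalSet_transport (hFG 0 h0), h3, preimage_iUnion]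
  · rw [hell 0 h0, h.elliptic_zero, preimage_empty]
  · rw [hpar 0 h0, h.parabolic_zero, preimage_singleton_zero]
  · intro ε hε hε0
    obtain ⟨⟨Φ, h1, h2⟩, h3⟩ := h.elliptic_disc ε hε hε0
    have himg : ∀ S T : Set Plane, Φ '' S = T → Φ.trans M.symm.toHomeomorph '' S = M ⁻¹' T := by
      rintro S T rfl
      ext p
      simp only [mem_image, mem_preimage]
      exact exists_congr fun q => and_congr_right fun _ => by
        change M.symm (Φ q) = p ↔ _
        rw [M.symm_apply_eq]
    rw [hell ε hε, hpar ε hε]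
    exact ⟨⟨Φ.trans M.symm.toHomeomorph, himg _ _ h1, himg _ _ h2⟩, fun p hp =>
      (fderiv_hess_ne_zero_iff (hG ε) (hFG ε hε p hp.1)).2 (h3 (M p) hp)⟩
  · intro N hN
    have hN' : M.symm ⁻¹' N ∈ 𝓝 (0 : Plane) :=
      M.symm.continuous.continuousAt.preimage_mem_nhds (by simpa using hN)
    filter_upwards [h.collapse _ hN', Ioo_mem_nhds (neg_lt_zero.2 hε₀) hε₀] with ε h1 h2
    rw [hell ε (abs_lt.2 h2), hpar ε (abs_lt.2 h2), ← preimage_union]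
    intro p hp
    have := h1 hp
    simpa using this
  · obtain ⟨s, hs, h1⟩ := h.coorientation
    refine ⟨s, hs, fun ε hε p hp => ?_⟩
    rw [coorientedUp_transport (hFG ε hε p hp.1), coorientedDown_transport (hFG ε hε p hp.1)]
    rw [hell ε hε] at hp
    exact h1 ε hε (M p) hp
  · obtain ⟨g, h1, h2⟩ := h.godrons
    refine ⟨fun i ε => M.symm (g i ε), fun i => hcont (h1 i), fun ε hε hε0 => ?_⟩
    obtain ⟨h3, h4, h5⟩ := h2 ε hε hε0
    refine ⟨hinj h3, ?_, fun i => ?_⟩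
    · rw [← hrange, ← h4]
      ext p
      exact and_congr_right fun hp => isGodron_transport (hG ε) (hFG ε hε p hp)
    · have hmem : g i ε ∈ {p ∈ U | IsGodron (G ε) p} := h4 ▸ mem_range_self i
      refine isNegativeGodron_transport (M := M) (hG ε) (hFG ε hε _ ?_) ?_
      · rw [mem_preimage, hMs]; exact hmem.1
      · rw [hMs]; exact hpos ε hε hε0 _ hmem.1 hmem.2
  · obtain ⟨g, h1, h2⟩ := h.hyperbonodes
    refine ⟨fun i ε => M.symm (g i ε), fun i => hcont (h1 i), fun ε hε hε0 => ?_⟩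
    obtain ⟨h3, h4, h5⟩ := h2 ε hε hε0
    refine ⟨hinj h3, ?_, fun i => ?_⟩
    · rw [← hrange, ← h4]
      ext p
      exact and_congr_right fun hp => and_congr (hess_neg_iff (hG ε) (hFG ε hε p hp))
        (isNode_transport (hFG ε hε p hp))
    · have hmem : g i ε ∈ {p ∈ U | hess (G ε) p < 0 ∧ IsNode (G ε) p} := h4 ▸ mem_range_self i
      refine isHyperbonode_transport (M := M) (hG ε) (hFG ε hε _ ?_) ?_
      · rw [mem_preimage, hMs]; exact hmem.1
      · rw [hMs]; exact h5 i
  · intro ε hε p hp hb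
    exact h.no_biflecnode ε hε (M p) hp (isBiflecnode_transport (hFG ε hε p hp) hb)

theorem DFourPlusTransition.comap {u : Plane} (h : DFourPlusTransition G u U ε₀)
    (hε₀ : 0 < ε₀) (hG : ∀ ε, ContDiff ℝ ∞ (G ε))
    (hFG : ∀ ε, |ε| < ε₀ → ∀ p ∈ M ⁻¹' U, F ε =ᶠ[𝓝 p] G ε ∘ M)
    (hpos : ∀ ε, |ε| < ε₀ → ε ≠ 0 → ∀ p ∈ U, IsGodron (G ε) p → PosGodron (G ε) p) :
    DFourPlusTransition F (M.symm u) (M ⁻¹' U) ε₀ := by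
  have h0 : |(0 : ℝ)| < ε₀ := by simpa using hε₀
  have hell := fun ε hε => ellipticSet_transport (hG ε) (hFG ε hε)
  have hpar := fun ε hε => parabolicSet_transport (hG ε) (hFG ε hε)
  have hup := fun ε hε => ellipticUp_transport (hG ε) (hFG ε hε)
  have hdown := fun ε hε => ellipticDown_transport (hG ε) (hFG ε hε)
  have hfl := flecnodalSet_transport (hFG 0 h0)
  have hMs : ∀ q, M (M.symm q) = q := M.apply_symm_apply
  have hhom : ∀ {A : Set Plane}, Nonempty (A ≃ₜ ℝ) → Nonempty ((M ⁻¹' A : Set Plane) ≃ₜ ℝ) := by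
    rintro A ⟨e⟩
    exact ⟨(M.toHomeomorph.sets (s := M ⁻¹' A) (t := A) rfl).trans e⟩
  refine ⟨?_, ?_, ?_, ?_, ?_, ?_⟩
  · obtain ⟨d₁, d₂, P₁, P₂, h1, h2, h3, h4, h5, h6, h7, h8, h9⟩ := h.curves_zero
    refine ⟨M.symm d₁, M.symm d₂, M ⁻¹' P₁, M ⁻¹' P₂, ?_, h2.preimage M, h3.preimage M, ?_, ?_, ?_,
      linearIndependent_symm h7, linearIndependent_symm h8, linearIndependent_symm h9⟩
    · rw [hfl]; exact h1.preimage M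
    · rw [hpar 0 h0, h4, preimage_union]
    · rw [← preimage_inter, h5, preimage_singleton_zero]
    · rw [hfl, hpar 0 h0, ← preimage_inter, h6, preimage_singleton_zero]
  · intro ε hε
    obtain ⟨h1, h2, h3⟩ := h.domains ε hε
    rw [hell ε hε, hup ε hε, hdown ε hε, h3, preimage_union]
    exact ⟨isConnected_preimage h1 M, isConnected_preimage h2 M, rfl⟩
  · rw [hup 0 h0, hdown 0 h0, ← M.preimage_closure, ← M.preimage_closure, ← preimage_inter,
      ← preimage_inter, h.touch, preimage_singleton_zero]
  · intro ε hε hε0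
    obtain ⟨h1, h2, h3, h4, h5⟩ := h.apart ε hε hε0
    rw [hup ε hε, hdown ε hε, hpar ε hε, ← M.preimage_closure, ← M.preimage_closure,
      ← preimage_inter, ← preimage_inter, h1, preimage_empty, ← preimage_frontier,
      ← preimage_frontier, ← preimage_inter, ← preimage_inter, h2, preimage_union]
    refine ⟨rfl, rfl, hhom h3, hhom h4, fun p hp => ?_⟩
    have hp' : M p ∈ parabolicSet (G ε) U := by rw [h2]; exact hp
    exact (fderiv_hess_ne_zero_iff (hG ε) (hFG ε hε p hp'.1)).2 (h5 (M p) hp')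
  · obtain ⟨s, e, g, hs, ce, e0, cg, g0, h1⟩ := h.passage
    refine ⟨s, fun ε => M.symm (e ε), fun ε => M.symm (g ε), hs,
      M.symm.continuous.comp_continuousOn ce, by simp [e0],
      M.symm.continuous.comp_continuousOn cg, by simp [g0], fun ε hε hε0 => ?_⟩
    obtain ⟨h2, h3, h4, h5, h6, h7⟩ := h1 ε hε hε0
    have he : e ε ∈ {p ∈ U | 0 < hess (G ε) p ∧ IsNode (G ε) p} := by rw [h2]; rfl
    have hg : g ε ∈ {p ∈ U | IsGodron (G ε) p} := by rw [h4]; rfl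
    refine ⟨?_, ?_, ?_, ?_, ?_, ?_⟩
    · rw [← preimage_singleton, ← h2]
      ext p
      exact and_congr_right fun hp => and_congr (hess_pos_iff (hG ε) (hFG ε hε p hp))
        (isNode_transport (hFG ε hε p hp))
    · refine isEllipnode_transport (M := M) (hG ε) (hFG ε hε _ ?_) ?_
      · rw [mem_preimage, hMs]; exact he.1
      · rw [hMs]; exact h3
    · rw [← preimage_singleton, ← h4]
      ext p
      exact and_congr_right fun hp => isGodron_transport (hG ε) (hFG ε hε p hp)
    · refine isNegativeGodron_transport (M := M) (hG ε) (hFG ε hε _ ?_) ?_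
      · rw [mem_preimage, hMs]; exact hg.1
      · rw [hMs]; exact hpos ε hε hε0 _ hg.1 hg.2
    · rw [hup ε hε, hdown ε hε, ← preimage_frontier, mem_preimage, mem_preimage, hMs, hMs]
      exact h6
    · rw [hup ε hε, hdown ε hε, ← preimage_frontier, mem_preimage, mem_preimage, hMs, hMs]
      exact h7
  · intro ε hε p hp hb
    exact h.no_biflecnode ε hε (M p) hp (isBiflecnode_transport (hFG ε hε p hp) hb)

end TransportTransitions

/-! ### The normal form of the cubic form and of the family -/

section NormalForm

/-- The symmetric trilinear form of a binary cubic form. -/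
def polar (A B C D : ℝ) (u v w : Plane) : ℝ :=
  u.1 * v.1 * w.1 * A + (u.1 * v.1 * w.2 + u.1 * v.2 * w.1 + u.2 * v.1 * w.1) * B
    + (u.1 * v.2 * w.2 + u.2 * v.1 * w.2 + u.2 * v.2 * w.1) * C + u.2 * v.2 * w.2 * D

theorem exists_cube_root {y : ℝ} : ∃ a : ℝ, a ^ 3 = y := by
  have key : ∀ x : ℝ, 0 ≤ x → ∃ a : ℝ, a ^ 3 = x := fun x hx =>
    ⟨x ^ (((3 : ℕ) : ℝ)⁻¹), Real.rpow_inv_natCast_pow hx three_ne_zero⟩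
  rcases le_total 0 y with h | h
  · exact key y h
  · obtain ⟨a, ha⟩ := key (-y) (by linarith)
    exact ⟨-a, by rw [Odd.neg_pow (by decide), ha]; ring⟩

/-- The linear automorphism of the plane which takes the standard basis to given vectors. -/
theorem exists_equiv_of_basis {e₁ e₂ : Plane} (h : e₁.1 * e₂.2 - e₁.2 * e₂.1 ≠ 0) :
    ∃ L : Plane ≃L[ℝ] Plane, L (1, 0) = e₁ ∧ L (0, 1) = e₂ := by
  let T : Plane →ₗ[ℝ] Plane := (LinearMap.fst ℝ ℝ ℝ).smulRight e₁ + (LinearMap.snd ℝ ℝ ℝ).smulRight e₂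
  have hT : ∀ v, T v = v.1 • e₁ + v.2 • e₂ := fun v => rfl
  have hinj : Function.Injective T := by
    rw [← LinearMap.ker_eq_bot, LinearMap.ker_eq_bot']
    intro v hv
    rw [hT] at hv
    have h1 := congrArg Prod.fst hv
    have h2 := congrArg Prod.snd hv
    simp only [Prod.fst_add, Prod.smul_fst, smul_eq_mul, Prod.snd_add, Prod.smul_snd, Prod.fst_zero,
      Prod.snd_zero] at h1 h2
    ext
    · exact (mul_eq_zero.1 (by linear_combination e₂.2 * h1 - e₂.1 * h2 :
        v.1 * (e₁.1 * e₂.2 - e₁.2 * e₂.1) = 0)).resolve_right h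
    · exact (mul_eq_zero.1 (by linear_combination e₁.1 * h2 - e₁.2 * h1 :
        v.2 * (e₁.1 * e₂.2 - e₁.2 * e₂.1) = 0)).resolve_right h
  refine ⟨(LinearEquiv.ofInjectiveEndo T hinj).toContinuousLinearEquiv, ?_, ?_⟩
  · change T (1, 0) = e₁; rw [hT]; simp
  · change T (0, 1) = e₂; rw [hT]; simp

/-- The root `u` is the second basis direction, and nondegeneracy gives `w` with `polar w u u ≠ 0`.
Shifting `w` along `u` removes the coefficient of `x²y`; those of `y³` and, after rescaling, `x³`
and `xy²` are then `0`, `1` and `±3`. -/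
theorem exists_normal_basis {A B C D : ℝ}
    (hnd : ∀ v : Plane, v ≠ 0 → ∃ w, polar A B C D w v v ≠ 0) {u : Plane} (hu : u ≠ 0)
    (hroot : polar A B C D u u u = 0) : ∃ (σ : ℝ) (L : Plane ≃L[ℝ] Plane), σ * σ = 1 ∧
      polar A B C D (L (1, 0)) (L (1, 0)) (L (1, 0)) = 1 ∧
      polar A B C D (L (1, 0)) (L (1, 0)) (L (0, 1)) = 0 ∧
      polar A B C D (L (1, 0)) (L (0, 1)) (L (0, 1)) = σ ∧
      polar A B C D (L (0, 1)) (L (0, 1)) (L (0, 1)) = 0 := by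
  obtain ⟨w, hw⟩ := hnd u hu
  set P := polar A B C D w u u with hP
  set c := - polar A B C D w w u / (2 * P) with hc
  set e : Plane := w + c • u with he
  have e11u : polar A B C D e e u = 0 := by
    have : polar A B C D e e u = polar A B C D w w u + 2 * c * P + c ^ 2 * polar A B C D u u u := by
      simp only [he, hP, polar, Prod.fst_add, Prod.snd_add, Prod.smul_fst, Prod.smul_snd, smul_eq_mul]
      ring
    rw [this, hroot, hc]; field_simp; ring
  have e1uu : polar A B C D e u u = P := by
    have : polar A B C D e u u = P + c * polar A B C D u u u := by
      simp only [he, hP, polar, Prod.fst_add, Prod.snd_add, Prod.smul_fst, Prod.smul_snd, smul_eq_mul]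
      ring
    rw [this, hroot]; ring
  have hdet : e.1 * u.2 - e.2 * u.1 ≠ 0 := by
    intro h0
    apply hw
    have k1 : u.1 * P = e.1 * polar A B C D u u u := by
      rw [← e1uu]; simp only [polar]; linear_combination -(u.1 ^ 2 * B + 2 * u.1 * u.2 * C + u.2 ^ 2 * D) * h0
    have k2 : u.2 * P = e.2 * polar A B C D u u u := by
      rw [← e1uu]; simp only [polar]; linear_combination (u.1 ^ 2 * A + 2 * u.1 * u.2 * B + u.2 ^ 2 * C) * h0
    rw [hroot, mul_zero] at k1 k2
    by_contra hP0
    exact hu (Prod.ext ((mul_eq_zero.1 k1).resolve_right hP0) ((mul_eq_zero.1 k2).resolve_right hP0))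
  -- Otherwise the linear form `polar · e e` would vanish on both `e` and `u`, so `e` would be a
  -- multiple root.
  have hM : polar A B C D e e e ≠ 0 := by
    intro h0
    have he0 : e ≠ 0 := by intro h; rw [h] at hdet; simp at hdet
    obtain ⟨x, hx⟩ := hnd e he0
    apply hx
    apply (mul_eq_zero.1 (?_ : (e.1 * u.2 - e.2 * u.1) * polar A B C D x e e = 0)).resolve_left hdet
    have : (e.1 * u.2 - e.2 * u.1) * polar A B C D x e e =
        (x.1 * u.2 - x.2 * u.1) * polar A B C D e e e
          + (e.1 * x.2 - e.2 * x.1) * polar A B C D e e u := by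
      simp only [polar]; ring
    rw [this, h0, e11u]; ring
  obtain ⟨a, ha⟩ := exists_cube_root (y := (polar A B C D e e e)⁻¹)
  have ha0 : a ≠ 0 := by
    rintro rfl
    exact inv_ne_zero hM (by rw [← ha]; norm_num)
  have haP : a * P ≠ 0 := mul_ne_zero ha0 hw
  -- Chosen so that `a b² P = ±1`; the sign is `σ`, and it cannot be changed by the choice of `b`.
  set b := √(|a * P|⁻¹) with hb
  have hb2 : b ^ 2 = |a * P|⁻¹ := Real.sq_sqrt (by positivity)
  have hb0 : b ≠ 0 := by
    have : 0 < b := Real.sqrt_pos.2 (inv_pos.2 (abs_pos.2 haP))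
    exact this.ne'
  obtain ⟨L, hL1, hL2⟩ := exists_equiv_of_basis (e₁ := a • e) (e₂ := b • u) (by
    have : (a • e).1 * (b • u).2 - (a • e).2 * (b • u).1 = a * b * (e.1 * u.2 - e.2 * u.1) := by
      simp only [Prod.smul_fst, Prod.smul_snd, smul_eq_mul]; ring
    rw [this]
    exact mul_ne_zero (mul_ne_zero ha0 hb0) hdet)
  have hsc : ∀ (x y z : ℝ) (p q r : Plane), polar A B C D (x • p) (y • q) (z • r) =
      x * y * z * polar A B C D p q r := by
    intro x y z p q r
    simp only [polar, Prod.smul_fst, Prod.smul_snd, smul_eq_mul]; ring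
  refine ⟨a * b * b * P, L, ?_, ?_, ?_, ?_, ?_⟩
  · have h1 : a * b * b * P = a * P * |a * P|⁻¹ := by rw [← hb2]; ring
    have h2 : |a * P| * |a * P| = a * P * (a * P) := abs_mul_abs_self _
    have h3 : |a * P| ≠ 0 := abs_ne_zero.2 haP
    rw [h1]
    field_simp
    rw [sq_abs]; ring
  · rw [hL1, hsc, show a * a * a = a ^ 3 by ring, ha, inv_mul_cancel₀ hM]
  · rw [hL1, hL2, hsc, e11u, mul_zero]
  · rw [hL1, hL2, hsc, e1uu]
  · rw [hL2, hsc, hroot, mul_zero]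

theorem SmoothFamily.comp_equiv {F : ℝ → Plane → ℝ} (hF : SmoothFamily F) (L : Plane ≃L[ℝ] Plane) :
    SmoothFamily (fun ε => F ε ∘ L) := by
  have hL := L.contDiff (n := ∞)
  exact ContDiff.comp (g := fun z : ℝ × Plane => F z.1 z.2)
    (f := fun z : ℝ × Plane => (z.1, L z.2)) hF (by fun_prop)

/-- The second derivatives of `F` are combinations, with constant coefficients, of those of `F ∘ L`
at the preimage, so the kernels of the two differentials correspond under `L`. -/
theorem fderiv_secondJet_eq_zero {F : ℝ → Plane → ℝ} (hF : SmoothFamily F) (L : Plane ≃L[ℝ] Plane)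
    {ξ : ℝ × Plane} (h20 : fderiv ℝ (J (fun ε => F ε ∘ L) 2 0) 0 ξ = 0)
    (h11 : fderiv ℝ (J (fun ε => F ε ∘ L) 1 1) 0 ξ = 0)
    (h02 : fderiv ℝ (J (fun ε => F ε ∘ L) 0 2) 0 ξ = 0) :
    fderiv ℝ (secondJet F) (0, 0) (ξ.1, L ξ.2) = 0 := by
  set G : ℝ → Plane → ℝ := fun ε => F ε ∘ L with hG
  have hGs : SmoothFamily G := hF.comp_equiv L
  let Z : ℝ × Plane →L[ℝ] ℝ × Plane :=
    (ContinuousLinearMap.fst ℝ ℝ Plane).prod ((L.symm : Plane →L[ℝ] Plane) ∘L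
      ContinuousLinearMap.snd ℝ ℝ Plane)
  have hZ : ∀ z, Z z = (z.1, L.symm z.2) := fun z => rfl
  have hFG : ∀ ε p, F ε =ᶠ[𝓝 p] G ε ∘ L.symm := fun ε p => by
    have : F ε = G ε ∘ L.symm := by ext q; simp [hG]
    rw [← this]
  have e : ∀ (u v : Plane) (z : ℝ × Plane), dd u (dd v (F z.1)) z.2 =
      (L.symm u).1 * (L.symm v).1 * J G 2 0 (Z z)
      + ((L.symm u).1 * (L.symm v).2 + (L.symm u).2 * (L.symm v).1) * J G 1 1 (Z z)
      + (L.symm u).2 * (L.symm v).2 * J G 0 2 (Z z) := by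
    intro u v z
    rw [dd_two_transport (hFG z.1 z.2), dd_two (hGs.slice z.1)]
    rfl
  have hd : ∀ i j, HasFDerivAt (fun z => J G i j (Z z)) (fderiv ℝ (J G i j) 0 ∘L Z) (0, 0) := by
    intro i j
    have h0 : Z (0, 0) = 0 := Z.map_zero
    have h1 : HasFDerivAt (J G i j) (fderiv ℝ (J G i j) 0) (Z (0, 0)) := by
      rw [h0]
      exact ((hGs.jet i j).differentiable (by simp) 0).hasFDerivAt
    exact h1.comp (0, 0) Z.hasFDerivAt
  have hq : ∀ a b c : ℝ, HasFDerivAt (fun z => a * J G 2 0 (Z z) + b * J G 1 1 (Z z) + c * J G 0 2 (Z z))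
      (a • (fderiv ℝ (J G 2 0) 0 ∘L Z) + b • (fderiv ℝ (J G 1 1) 0 ∘L Z)
        + c • (fderiv ℝ (J G 0 2) 0 ∘L Z)) (0, 0) := fun a b c =>
    (((hd 2 0).const_mul a).add ((hd 1 1).const_mul b)).add ((hd 0 2).const_mul c)
  have hall := (hq ((L.symm (1, 0)).1 * (L.symm (1, 0)).1) ((L.symm (1, 0)).1 * (L.symm (1, 0)).2
      + (L.symm (1, 0)).2 * (L.symm (1, 0)).1) ((L.symm (1, 0)).2 * (L.symm (1, 0)).2)).prodMk
    ((hq ((L.symm (1, 0)).1 * (L.symm (0, 1)).1) ((L.symm (1, 0)).1 * (L.symm (0, 1)).2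
      + (L.symm (1, 0)).2 * (L.symm (0, 1)).1) ((L.symm (1, 0)).2 * (L.symm (0, 1)).2)).prodMk
    (hq ((L.symm (0, 1)).1 * (L.symm (0, 1)).1) ((L.symm (0, 1)).1 * (L.symm (0, 1)).2
      + (L.symm (0, 1)).2 * (L.symm (0, 1)).1) ((L.symm (0, 1)).2 * (L.symm (0, 1)).2)))
  have hsj := hall.congr_of_eventuallyEq (f₁ := secondJet F) (Eventually.of_forall fun z =>
    Prod.ext (e (1, 0) (1, 0) z) (Prod.ext (e (1, 0) (0, 1) z) (e (0, 1) (0, 1) z)))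
  rw [hsj.fderiv]
  have hZξ : Z (ξ.1, L ξ.2) = ξ := by rw [hZ]; simp
  simp [hZξ, h20, h11, h02]

/-- Normal form of a generic family with a nondegenerate flat umbilic. -/
theorem exists_normalFamily {F : ℝ → Plane → ℝ} (hF : SmoothFamily F) (hflat : IsFlatUmbilic (F 0))
    (hcubic : NondegenerateCubic (F 0)) (hgen : IsGenericFamily F) {u : Plane} (hu : u ≠ 0)
    (hroot : ddPow 3 u (F 0) 0 = 0) :
    ∃ (σ : ℝ) (L : Plane ≃L[ℝ] Plane), NormalFamily σ (fun ε => F ε ∘ L) := by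
  have hf := hF.slice 0
  have hpol : ∀ a b c, dd a (dd b (dd c (F 0))) 0 =
      polar (jet 3 0 (F 0) 0) (jet 2 1 (F 0) 0) (jet 1 2 (F 0) 0) (jet 0 3 (F 0) 0) a b c := by
    intro a b c; rw [dd_three hf, polar]
  obtain ⟨σ, L, h1, h2, h3, h4, h5⟩ := exists_normal_basis
    (A := jet 3 0 (F 0) 0) (B := jet 2 1 (F 0) 0) (C := jet 1 2 (F 0) 0) (D := jet 0 3 (F 0) 0)
    (by
      intro v hv
      obtain ⟨w, hw⟩ := hcubic v hv
      exact ⟨w, by rwa [← hpol]⟩) hu (by rw [← hpol]; exact hroot)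
  have hGs : SmoothFamily (fun ε => F ε ∘ L) := hF.comp_equiv L
  have hL0 : L 0 = 0 := map_zero L
  have t2 : ∀ a b, dd a (dd b (F 0 ∘ L)) 0 = 0 := by
    intro a b
    rw [dd_two_transport (f := F 0 ∘ L) (g := F 0) (M := L) EventuallyEq.rfl, hL0]
    have e1 : jet 2 0 (F 0) 0 = 0 := hflat.1
    have e2 : jet 1 1 (F 0) 0 = 0 := hflat.2.1
    have e3 : jet 0 2 (F 0) 0 = 0 := hflat.2.2
    simp only [dd_two hf, e1, e2, e3]; ring
  have t3 : ∀ a b c, dd a (dd b (dd c (F 0 ∘ L))) 0 =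
      polar (jet 3 0 (F 0) 0) (jet 2 1 (F 0) 0) (jet 1 2 (F 0) 0) (jet 0 3 (F 0) 0) (L a) (L b) (L c) := by
    intro a b c
    rw [dd_three_transport (f := F 0 ∘ L) (g := F 0) (M := L) EventuallyEq.rfl, hL0, hpol]
  have k30 : J (fun ε => F ε ∘ L) 3 0 0 = 1 := (t3 (1, 0) (1, 0) (1, 0)).trans h2
  have k21 : J (fun ε => F ε ∘ L) 2 1 0 = 0 := (t3 (1, 0) (1, 0) (0, 1)).trans h3
  have k12 : J (fun ε => F ε ∘ L) 1 2 0 = σ := (t3 (1, 0) (0, 1) (0, 1)).trans h4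
  have k03 : J (fun ε => F ε ∘ L) 0 3 0 = 0 := (t3 (0, 1) (0, 1) (0, 1)).trans h5
  refine ⟨σ, L, hGs, h1, t2 _ _, t2 _ _, t2 _ _, k30, k21, k12, k03, ?_⟩
  intro hc
  set a := fderiv ℝ (J (fun ε => F ε ∘ L) 2 0) 0 (1, 0)
  set b := fderiv ℝ (J (fun ε => F ε ∘ L) 1 1) 0 (1, 0)
  set c := fderiv ℝ (J (fun ε => F ε ∘ L) 0 2) 0 (1, 0)
  have hsplit : ∀ (D : ℝ × Plane →L[ℝ] ℝ) (d : Plane), D (1, d) = D (1, 0) + D (0, d) := by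
    intro D d
    rw [← map_add]; congr 1; ext <;> simp
  have hinj : Function.Injective (fderiv ℝ (secondJet F) (0, 0)) :=
    (LinearMap.injective_iff_surjective_of_finrank_eq_finrank
      (f := (fderiv ℝ (secondJet F) (0, 0) : ℝ × Plane →ₗ[ℝ] ℝ × ℝ × ℝ)) (by simp)).2 hgen
  -- If `-a + σc = 0`, the vector `(1, -a, -σb)` annihilates all three differentials. This
  -- contradicts genericity, because a surjective map between spaces of dimension three is
  -- injective.
  have hker := fderiv_secondJet_eq_zero hF L (ξ := ((1 : ℝ), ((-a, -(σ * b)) : Plane)))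
    (by rw [hsplit, hGs.fderiv_J, k30, k21]; ring)
    (by rw [hsplit, hGs.fderiv_J, k21, k12]; linear_combination (-b) * h1)
    (by rw [hsplit, hGs.fderiv_J, k12, k03]; linear_combination σ * hc - c * h1)
  have := hinj (hker.trans (map_zero _).symm)
  have := congrArg Prod.fst this
  simp at this

end NormalForm

/-! ### Reduction to a normal family -/

section Reduction

variable {F : ℝ → Plane → ℝ}

/-- A family which is smooth near the origin agrees there with a globally smooth family. -/
theorem exists_smoothFamily {W : Set (ℝ × Plane)} (hW : IsOpen W) (hW0 : (0, 0) ∈ W)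
    (hF : ContDiffOn ℝ ∞ (fun z : ℝ × Plane => F z.1 z.2) W) :
    ∃ H : ℝ → Plane → ℝ, SmoothFamily H ∧ ∃ δ > 0, ∀ ε, |ε| < δ → ∀ p ∈ Metric.ball (0 : Plane) δ,
      F ε =ᶠ[𝓝 p] H ε := by
  have h1 : ∀ᶠ z in 𝓝 ((0 : ℝ), (0 : Plane)), ContDiffAt ℝ ∞ (fun z : ℝ × Plane => F z.1 z.2) z := by
    filter_upwards [hW.mem_nhds hW0] with z hz
    exact hF.contDiffAt (hW.mem_nhds hz)
  obtain ⟨g, hg, hgF⟩ := exists_contDiff_eventuallyEq h1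
  obtain ⟨δ, hδ, hball⟩ := Metric.eventually_nhds_iff_ball.1 hgF
  refine ⟨fun ε p => g (ε, p), hg, δ, hδ, fun ε hε p hp => ?_⟩
  filter_upwards [Metric.isOpen_ball.mem_nhds hp] with q hq
  refine (hball (ε, q) ?_).symm
  rw [mem_ball_iff_norm] at hq ⊢
  rw [Prod.norm_def, max_lt_iff]
  exact ⟨by simpa using hε, hq⟩

theorem germ_refl {f g : Plane → ℝ} {p : Plane} (h : f =ᶠ[𝓝 p] g) :
    f =ᶠ[𝓝 p] g ∘ ContinuousLinearEquiv.refl ℝ Plane := h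

/-- Genericity depends only on the germ of the family at the origin, so it survives the replacement
of `F` by a globally smooth family. -/
theorem secondJet_congr {H : ℝ → Plane → ℝ} {δ : ℝ} (hδ : 0 < δ)
    (h : ∀ ε, |ε| < δ → ∀ p ∈ Metric.ball (0 : Plane) δ, F ε =ᶠ[𝓝 p] H ε) :
    secondJet F =ᶠ[𝓝 (0, 0)] secondJet H := by
  have : Ioo (-δ) δ ×ˢ Metric.ball (0 : Plane) δ ∈ 𝓝 ((0 : ℝ), (0 : Plane)) :=
    prod_mem_nhds (Ioo_mem_nhds (neg_lt_zero.2 hδ) hδ) (Metric.ball_mem_nhds _ hδ)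
  filter_upwards [this] with z hz
  have hg := germ_refl (h z.1 (abs_lt.2 hz.1) z.2 hz.2)
  simp only [secondJet, fxx, fxy, fyy]
  rw [dd_two_transport hg, dd_two_transport hg, dd_two_transport hg]
  rfl

/-- A generic family with a nondegenerate flat umbilic is locally conjugate to a normal family. -/
theorem exists_conjugate_normalFamily {W : Set (ℝ × Plane)} (hW : IsOpen W) (hW0 : (0, 0) ∈ W)
    (hF : ContDiffOn ℝ ∞ (fun z : ℝ × Plane => F z.1 z.2) W) (hflat : IsFlatUmbilic (F 0))
    (hcubic : NondegenerateCubic (F 0)) (hgen : IsGenericFamily F) {u : Plane} (hu : u ≠ 0)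
    (hroot : ddPow 3 u (F 0) 0 = 0) : ∃ (σ : ℝ) (G : ℝ → Plane → ℝ) (M : Plane ≃L[ℝ] Plane),
      NormalFamily σ G ∧ ∃ δ > 0, ∀ ε, |ε| < δ → ∀ p ∈ Metric.ball (0 : Plane) δ,
        F ε =ᶠ[𝓝 p] G ε ∘ M := by
  obtain ⟨H, hH, δ, hδ, hFH⟩ := exists_smoothFamily hW hW0 hF
  have h0 := germ_refl (hFH 0 (by simpa using hδ) 0 (Metric.mem_ball_self hδ))
  obtain ⟨σ, L, hN⟩ := exists_normalFamily hH (u := u)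
    (by
      obtain ⟨h1, h2, h3⟩ := hflat
      simp only [fxx, fxy, fyy, dd_two_transport h0] at h1 h2 h3
      exact ⟨h1, h2, h3⟩)
    (by
      intro v hv
      obtain ⟨w, hw⟩ := hcubic v hv
      rw [dd_three_transport h0] at hw
      exact ⟨w, hw⟩)
    (by
      rw [IsGenericFamily, (secondJet_congr hδ hFH).fderiv_eq] at hgen
      exact hgen) hu
    (by rw [ddPow_transport h0] at hroot; exact hroot)
  refine ⟨σ, fun ε => H ε ∘ L, L.symm, hN, δ, hδ, fun ε hε p hp => ?_⟩
  have : (H ε ∘ L) ∘ L.symm = H ε := by ext q; simp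
  rw [this]
  exact hFH ε hε p hp

theorem NormalFamily.cubic_zero {σ : ℝ} {G : ℝ → Plane → ℝ} (h : NormalFamily σ G) (v : Plane) :
    ddPow 3 v (G 0) 0 = v.1 ^ 3 + 3 * σ * (v.1 * v.2 ^ 2) := by
  have e := cubic_J h.smooth 0 v
  simp only [Prod.fst_zero, Prod.snd_zero] at e
  rw [e, h.j30, h.j21, h.j12, h.j03]; ring

/-- For `σ = 1` the cubic form `x(x² + 3y²)` has only one real zero line. -/
theorem NormalFamily.eq_neg_one {σ : ℝ} {G : ℝ → Plane → ℝ} (h : NormalFamily σ G) {v w : Plane}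
    (hvw : LinearIndependent ℝ ![v, w]) (hv : ddPow 3 v (G 0) 0 = 0) (hw : ddPow 3 w (G 0) 0 = 0) :
    σ = -1 := by
  rcases mul_self_eq_one_iff.1 h.sq with rfl | h1
  · exfalso
    rw [h.cubic_zero] at hv hw
    have key : ∀ x : Plane, x.1 ^ 3 + 3 * 1 * (x.1 * x.2 ^ 2) = 0 → x.1 = 0 := by
      intro x hx
      by_contra h0
      have h2 : 0 < x.1 ^ 2 := by positivity
      have h3 : x.1 * (x.1 ^ 2 + 3 * x.2 ^ 2) = 0 := by linear_combination hx
      have h4 := (mul_eq_zero.1 h3).resolve_left h0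
      linarith [sq_nonneg x.2]
    apply (linearIndependent_pair_iff _ _).1 hvw
    rw [key v hv, key w hw]; ring
  · exact h1

/-- For `σ = -1` the vectors `(0, 1)` and `(√3, 1)` are independent zeros of the cubic form. -/
theorem NormalFamily.eq_one {σ : ℝ} {G : ℝ → Plane → ℝ} (h : NormalFamily σ G) {u : Plane}
    (hu : ∀ w, ddPow 3 w (G 0) 0 = 0 → ∃ c : ℝ, w = c • u) : σ = 1 := by
  rcases mul_self_eq_one_iff.1 h.sq with h1 | rfl
  · exact h1
  · exfalso
    have h3 : √3 ^ 2 = (3 : ℝ) := Real.sq_sqrt (by norm_num)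
    obtain ⟨a, ha⟩ := hu (0, 1) (by rw [h.cubic_zero]; simp)
    obtain ⟨b, hb⟩ := hu (√3, 1) (by
      rw [h.cubic_zero]; simp only; linear_combination √3 * h3)
    have a1 := congrArg Prod.fst ha
    have a2 := congrArg Prod.snd ha
    have b1 := congrArg Prod.fst hb
    simp only [Prod.smul_fst, Prod.smul_snd, smul_eq_mul] at a1 a2 b1
    rcases mul_eq_zero.1 a1.symm with h4 | h4
    · rw [h4, zero_mul] at a2; exact one_ne_zero a2
    · rw [h4, mul_zero] at b1
      have : (0 : ℝ) < √3 := by positivity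
      exact this.ne' b1

theorem eventually_preimage_box_subset (M : Plane ≃L[ℝ] Plane) {V : Set Plane} {δ : ℝ}
    (hV : V ∈ 𝓝 (0 : Plane)) (hδ : 0 < δ) :
    ∀ᶠ r in 𝓝[>] (0 : ℝ), M ⁻¹' box r ⊆ V ∩ Metric.ball 0 δ := by
  have hV' : M.symm ⁻¹' (V ∩ Metric.ball 0 δ) ∈ 𝓝 (0 : Plane) :=
    M.symm.continuous.continuousAt.preimage_mem_nhds
      (by simpa using ⟨hV, Metric.ball_mem_nhds _ hδ⟩)
  filter_upwards [eventually_box_subset hV'] with r hr p hp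
  have := hr hp
  rwa [mem_preimage, M.symm_apply_apply] at this

theorem preimage_box_properties (M : Plane ≃L[ℝ] Plane) {r : ℝ} (hr : 0 < r) :
    IsOpen (M ⁻¹' box r) ∧ Convex ℝ (M ⁻¹' box r) ∧ (0 : Plane) ∈ M ⁻¹' box r := by
  refine ⟨(isOpen_box r).preimage M.continuous,
    (convex_box r).linear_preimage (M : Plane →ₗ[ℝ] Plane), ?_⟩
  rw [mem_preimage, map_zero]
  exact zero_mem_box hr

/-- The neighbourhood is the preimage of a box under the change of coordinates, so it is convex. The
box and `ε₀` are small enough for `F` to agree there with the normal family. -/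
theorem exists_dFourMinusTransition
    {W : Set (ℝ × Plane)} (hW : IsOpen W) (hW0 : (0, 0) ∈ W)
    (hF : ContDiffOn ℝ ∞ (fun z : ℝ × Plane => F z.1 z.2) W) (hflat : IsFlatUmbilic (F 0))
    (hcubic : NondegenerateCubic (F 0)) (hgen : IsGenericFamily F)
    {u : Fin 3 → Plane} (hu : ∀ i j, i ≠ j → LinearIndependent ℝ ![u i, u j])
    (hu3 : ∀ i, ddPow 3 (u i) (F 0) 0 = 0) (hu4 : ∀ i, ddPow 4 (u i) (F 0) 0 ≠ 0)
    {V : Set Plane} (hV : V ∈ 𝓝 (0 : Plane)) : ∃ U ⊆ V, IsOpen U ∧ Convex ℝ U ∧ 0 ∈ U ∧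
      ∃ ε₀ > 0, DFourMinusTransition F u U ε₀ := by
  have hu0 : u 0 ≠ 0 := by
    intro hc
    have := (linearIndependent_pair_iff _ _).1 (hu 0 1 (by decide))
    simp [hc] at this
  obtain ⟨σ, G, M, hN, δ, hδ, hFG⟩ :=
    exists_conjugate_normalFamily hW hW0 hF hflat hcubic hgen hu0 (hu3 0)
  have h0 := hFG 0 (by simpa using hδ) 0 (Metric.mem_ball_self hδ)
  have hM : ∀ i j, i ≠ j → LinearIndependent ℝ ![M (u i), M (u j)] := fun i j hij =>
    linearIndependent_symm (M := M.symm) (hu i j hij)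
  have h3 : ∀ i, ddPow 3 (M (u i)) (G 0) 0 = 0 := fun i => by
    rw [← map_zero M, ← ddPow_transport h0]; exact hu3 i
  have h4 : ∀ i, ddPow 4 (M (u i)) (G 0) 0 ≠ 0 := fun i => by
    rw [← map_zero M, ← ddPow_transport h0]; exact hu4 i
  obtain rfl := hN.eq_neg_one (hM 0 1 (by decide)) (h3 0) (h3 1)
  obtain ⟨r, hr1, hr2, hr⟩ := ((hN.eventually_dFourMinusTransition hM h3 h4).and
    ((eventually_preimage_box_subset M hV hδ).and self_mem_nhdsWithin)).exists
  obtain ⟨ε₀, ⟨he1, he2⟩, he3⟩ := (hr1.and (Ioo_mem_nhdsGT hδ)).exists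
  obtain ⟨k1, k2, k3⟩ := preimage_box_properties M hr
  refine ⟨M ⁻¹' box r, fun p hp => (hr2 hp).1, k1, k2, k3, ε₀, he3.1, ?_⟩
  have := he1.comap (F := F) (M := M) he3.1 (fun ε => hN.smooth.slice ε)
    (fun ε hε p hp => hFG ε (hε.trans he3.2) p (hr2 hp).2) he2
  simpa only [M.symm_apply_apply] using this

theorem exists_dFourPlusTransition
    {W : Set (ℝ × Plane)} (hW : IsOpen W) (hW0 : (0, 0) ∈ W)
    (hF : ContDiffOn ℝ ∞ (fun z : ℝ × Plane => F z.1 z.2) W) (hflat : IsFlatUmbilic (F 0))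
    (hcubic : NondegenerateCubic (F 0)) (hgen : IsGenericFamily F)
    {u : Plane} (hu : u ≠ 0) (hu3 : ddPow 3 u (F 0) 0 = 0)
    (huniq : ∀ w, ddPow 3 w (F 0) 0 = 0 → ∃ c : ℝ, w = c • u) (hu4 : ddPow 4 u (F 0) 0 ≠ 0)
    {V : Set Plane} (hV : V ∈ 𝓝 (0 : Plane)) : ∃ U ⊆ V, IsOpen U ∧ Convex ℝ U ∧ 0 ∈ U ∧
      ∃ ε₀ > 0, DFourPlusTransition F u U ε₀ := by
  obtain ⟨σ, G, M, hN, δ, hδ, hFG⟩ :=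
    exists_conjugate_normalFamily hW hW0 hF hflat hcubic hgen hu hu3
  have h0 := hFG 0 (by simpa using hδ) 0 (Metric.mem_ball_self hδ)
  have h3 : ddPow 3 (M u) (G 0) 0 = 0 := by
    rw [← map_zero M, ← ddPow_transport h0]; exact hu3
  have h4 : ddPow 4 (M u) (G 0) 0 ≠ 0 := by
    rw [← map_zero M, ← ddPow_transport h0]; exact hu4
  obtain rfl := hN.eq_one (u := M u) (by
    intro w hw
    have h5 : ddPow 3 (M.symm w) (F 0) 0 = 0 := by
      rw [ddPow_transport h0, M.apply_symm_apply, map_zero]; exact hw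
    obtain ⟨c, hc⟩ := huniq _ h5
    exact ⟨c, by rw [← map_smul, ← hc, M.apply_symm_apply]⟩)
  obtain ⟨r, hr1, hr2, hr⟩ := ((hN.eventually_dFourPlusTransition (by simpa using hu) h3 h4).and
    ((eventually_preimage_box_subset M hV hδ).and self_mem_nhdsWithin)).exists
  obtain ⟨ε₀, ⟨he1, he2⟩, he3⟩ := (hr1.and (Ioo_mem_nhdsGT hδ)).exists
  obtain ⟨k1, k2, k3⟩ := preimage_box_properties M hr
  refine ⟨M ⁻¹' box r, fun p hp => (hr2 hp).1, k1, k2, k3, ε₀, he3.1, ?_⟩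
  have := he1.comap (F := F) (M := M) he3.1 (fun ε => hN.smooth.slice ε)
    (fun ε hε p hp => hFG ε (hε.trans he3.2) p (hr2 hp).2) he2
  simpa only [M.symm_apply_apply] using this

end Reduction

end FlatUmbilic

theorem theorem5 (F : ℝ → FlatUmbilic.Plane → ℝ) (W : Set (ℝ × FlatUmbilic.Plane))
    (hW : IsOpen W) (hW0 : (0, 0) ∈ W)
    (hF : ContDiffOn ℝ ∞ (fun z : ℝ × FlatUmbilic.Plane => F z.1 z.2) W)
    (hflat : FlatUmbilic.IsFlatUmbilic (F 0))
    (hcubic : FlatUmbilic.NondegenerateCubic (F 0))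
    (hgen : FlatUmbilic.IsGenericFamily F) :
    (∀ u : Fin 3 → FlatUmbilic.Plane,
      (∀ i j, i ≠ j → LinearIndependent ℝ ![u i, u j]) →
      (∀ i, FlatUmbilic.ddPow 3 (u i) (F 0) 0 = 0) →
      (∀ i, FlatUmbilic.ddPow 4 (u i) (F 0) 0 ≠ 0) →
      ∀ V ∈ 𝓝 (0 : FlatUmbilic.Plane), ∃ U ⊆ V, IsOpen U ∧ Convex ℝ U ∧ 0 ∈ U ∧
        ∃ ε₀ > 0, FlatUmbilic.DFourMinusTransition F u U ε₀) ∧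
    (∀ u : FlatUmbilic.Plane, u ≠ 0 →
      FlatUmbilic.ddPow 3 u (F 0) 0 = 0 →
      (∀ w, FlatUmbilic.ddPow 3 w (F 0) 0 = 0 → ∃ c : ℝ, w = c • u) →
      FlatUmbilic.ddPow 4 u (F 0) 0 ≠ 0 →
      ∀ V ∈ 𝓝 (0 : FlatUmbilic.Plane), ∃ U ⊆ V, IsOpen U ∧ Convex ℝ U ∧ 0 ∈ U ∧
        ∃ ε₀ > 0, FlatUmbilic.DFourPlusTransition F u U ε₀) := by
  exact ⟨fun u hu hu3 hu4 V hV => FlatUmbilic.exists_dFourMinusTransition hW hW0 hF hflat hcubic hgen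
      hu hu3 hu4 hV,
    fun u hu hu3 huniq hu4 V hV => FlatUmbilic.exists_dFourPlusTransition hW hW0 hF hflat hcubic hgen
      hu hu3 huniq hu4 hV⟩
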